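/- Let $m,n,p$ be positive integers with $p\le\min\{m,n\}$, let $\mathcal M_p=\{X\in\mathbb R^{m\times n}:\operatorname{rank}X=p\}$ (an embedded submanifold of $\mathbb R^{m\times n}$), $\mathrm{St}(p,m)=\{M\in\mathbb R^{m\times p}:M^TM=I_p\}$, $\mathbb R_*^{n\times p}=\{N\in\mathbb R^{n\times p}:\operatorname{rank}N=p\}$, $\overline{\mathcal M}=\mathrm{St}(p,m)\times\mathbb R_*^{n\times p}$ and $\pi:\overline{\mathcal M}\to\mathcal M_p$, $\pi(M,N)=MN^T$. Endow $\overline{\mathcal M}$ with the Euclidean metric $\bar g((\dot M,\dot N),(\check M,\check N))=\operatorname{tr}(\dot M^T\check M+\dot N^T\check N)$. At $z=(M,N)\in\overline{\mathcal M}$ let the vertical space $\mathcal V_z$ be the tangent space to the fiber $\pi^{-1}(MN^T)$, let the horizontal space $\mathcal H_z$ be its $\bar g$-orthogonal complement in $T_z\overline{\mathcal M}$, and let $P^h_z$ be the projection of $T_z\overline{\mathcal M}$ onto $\mathcal H_z$ along $\mathcal V_z$. The horizontal lift at $z$ of $\xi\in T_{\pi(z)}\mathcal M_p$ is the $\xi_z\in\mathcal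 H_z$ with $\mathrm D\pi(z)[\xi_z]=\xi$. Then the following hold. (1) $\bar g$ is a Riemannian metric, $\pi$ is onto, $\mathrm D\pi(z)$ maps $\mathcal H_z$ bijectively onto $T_{\pi(z)}\mathcal M_p$ (so lifts exist and are unique), and $g_{\pi(z)}(\xi,\zeta)=\bar g(\xi_z,\zeta_z)$ is independent of the point $z$ of the fiber and defines a (smooth) Riemannian metric $g$ on $\mathcal M_p$. (2) For $(\dot M,\dot N)\in T_{(M,N)}\overline{\mathcal M}$, $P^h_{(M,N)}(\dot M,\dot N)=(\dot M+M\Omega,\dot N+N\Omega)$, where $\Omega=-\Omega^T$ is the unique skew-symmetric solution of $(N^TN+I)\Omega+\Omega(N^TN+I)=\dot M^TM-M^T\dot M+\dot N^TN-N^T\dot N$. (3) Let $P_{(M,N)}(A,B)=\big((I-MM^T)A+\tfrac12M(M^TA-A^TM),\,B\big)$. Then $\bar\nabla_{\dot X}\dot Y=P_{(M,N)}(\partial_{\dot X}\dot Y)$ is the Levi-Civita connection of $(\overline{\mathcal M},\bar g)$. (4) For $\eta=(\dot M,\dot N)\in T_{(M,N)}\overline{\mathcal M}$, the Riemannian exponential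 of $(\overline{\mathcal M},\bar g)$ at $\eta$ is defined if and only if $\operatorname{rank}(N+t\dot N)=p$ for all $t\in[0,1]$, and then $$\operatorname{Exp}_{(M,N)}(\dot M,\dot N)=\left(\begin{bmatrix}M&\dot M\end{bmatrix}\exp\begin{bmatrix}A&-S\\ I&A\end{bmatrix}\begin{bmatrix}I_p\\0\end{bmatrix}\exp(-A),\;N+\dot N\right),\quad A=M^T\dot M,\; S=\dot M^T\dot M.\qquad(*)$$ (5) $(\mathcal M_p,g)$ has a Levi-Civita connection $\nabla$. For $z\in\overline{\mathcal M}$ and $\xi\in T_{\pi(z)}\mathcal M_p$ with horizontal lift $\xi_z=(\dot M,\dot N)$ at $z=(M,N)$, the Riemannian exponential of $(\mathcal M_p,g)$ at $\xi$ is defined if and only if $\operatorname{rank}(N+t\dot N)=p$ for all $t\in[0,1]$, and then $\operatorname{Exp}_{\pi(z)}(\xi)=\pi(\operatorname{Exp}_z(\xi_z))$ with $\operatorname{Exp}_z$ given by $(*)$. (6) Let $f:\mathcal M_p\to\mathbb R$ be smooth, let $\bar f=f\circ\pi$ on $\overline{\mathcal M}$ and let $(M,N)\in\overline{\mathcal M}$.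 Then $\operatorname{grad}\bar f(M,N)=P_{(M,N)}$ applied to the Euclidean gradient at $(M,N)$ of $(M,N)\mapsto f(MN^T)$ on $\mathbb R_*^{m\times p}\times\mathbb R_*^{n\times p}$. A vector $\xi\in T_{MN^T}\mathcal M_p$ solves the Newton equation $\nabla_\xi\operatorname{grad}f=-\operatorname{grad}f(MN^T)$ if and only if its horizontal lift $X=\xi_{(M,N)}\in\mathcal H_{(M,N)}$ solves the lifted Newton equation $$P^h_{(M,N)}\big(\bar\nabla_{X}\operatorname{grad}\bar f\big)=-\operatorname{grad}\bar f(M,N).$$ The pure Riemannian Newton iteration for $f$ on $(\mathcal M_p,g)$ (Levi-Civita connection, exponential retraction) sends $MN^T$ to $\pi(\operatorname{Exp}_{(M,N)}(\dot X_M,\dot X_N))$ with $\operatorname{Exp}$ as in $(*)$, where $(\dot X_M,\dot X_N)\in\mathcal H_{(M,N)}$ is the solution of the lifted Newton equation. Precisely: a matrix $Y$ equals $\operatorname{Exp}_{MN^T}(\xi)$ for some solution $\xi$ of the Newton equation at which the exponential is defined if and only if $Y=\pi(\operatorname{Exp}_{(M,N)}(\dot X_M,\dot X_N))$ for some horizontal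 solution $(\dot X_M,\dot X_N)$ of the lifted Newton equation with $\operatorname{rank}(N+t\dot X_N)=p$ for all $t\in[0,1]$. -/

import Mathlib

open scoped ContDiff Matrix Topology

-- The entrywise sup norm only serves to express smoothness and derivatives of maps between matrix
-- spaces (all norms are equivalent there); the Riemannian metrics below are defined by traces.
attribute [local instance] Matrix.normedAddCommGroup Matrix.normedSpace

noncomputable section

namespace FixedRank

/-! ### Riemannian geometry of an embedded submanifold `S` of a finite-dimensional space `E`

Smoothness of a map on `S` is `ContDiffOn ℝ ∞ · S`; for an embedded submanifold this is the same as
having local smooth extensions to open subsets of `E`.  For a tangent vector `ξ` at `x ∈ S`,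
`fderivWithin ℝ φ S x ξ` is the derivative at `x` of the map `φ` on `S` in the direction `ξ`
(derivatives within `S` are uniquely determined in tangent directions). -/

section General

variable {E : Type*} [NormedAddCommGroup E] [NormedSpace ℝ E]

/-- The tangent space `T_x S`: velocities at time `0` of smooth curves in `S` through `x`. -/
def tangent (S : Set E) (x : E) : Set E :=
  {v | ∃ (c : ℝ → E) (ε : ℝ), 0 < ε ∧ ContDiffOn ℝ ∞ c (Set.Ioo (-ε) ε) ∧
    (∀ t ∈ Set.Ioo (-ε) ε, c t ∈ S) ∧ c 0 = x ∧ HasDerivAt c v 0}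

/-- Smooth tangent vector fields on `S` (values off `S` are irrelevant). -/
def IsField (S : Set E) (V : E → E) : Prop :=
  ContDiffOn ℝ ∞ V S ∧ ∀ x ∈ S, V x ∈ tangent S x

/-- `g` is a (smooth) Riemannian metric on `S`; `g x` is only relevant on `T_x S × T_x S`. -/
structure IsRiemannianMetric (S : Set E) (g : E → E → E → ℝ) : Prop where
  add_left : ∀ x ∈ S, ∀ ξ ∈ tangent S x, ∀ ζ ∈ tangent S x, ∀ η ∈ tangent S x,
    g x (ξ + ζ) η = g x ξ η + g x ζ η
  smul_left : ∀ x ∈ S, ∀ (a : ℝ), ∀ ξ ∈ tangent S x, ∀ η ∈ tangent S x,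
    g x (a • ξ) η = a * g x ξ η
  symm : ∀ x ∈ S, ∀ ξ ∈ tangent S x, ∀ η ∈ tangent S x, g x ξ η = g x η ξ
  pos : ∀ x ∈ S, ∀ ξ ∈ tangent S x, ξ ≠ 0 → 0 < g x ξ ξ
  smooth : ∀ V W : E → E, IsField S V → IsField S W →
    ContDiffOn ℝ ∞ (fun x => g x (V x) (W x)) S

/-- `nabla` is the Levi-Civita (Riemannian) connection of `(S, g)`: an affine connection that is
torsion-free and compatible with the metric.  `nabla x ξ V` stands for `(∇_ξ V)_x`, with
`ξ ∈ T_x S` and `V` a smooth tangent vector field on `S`. -/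
structure IsLeviCivita (S : Set E) (g : E → E → E → ℝ) (nabla : E → E → (E → E) → E) :
    Prop where
  mem_tangent : ∀ x ∈ S, ∀ ξ ∈ tangent S x, ∀ V, IsField S V → nabla x ξ V ∈ tangent S x
  smooth : ∀ V W, IsField S V → IsField S W → ContDiffOn ℝ ∞ (fun x => nabla x (V x) W) S
  congr : ∀ x ∈ S, ∀ ξ ∈ tangent S x, ∀ V W, IsField S V → IsField S W → Set.EqOn V W S →
    nabla x ξ V = nabla x ξ W
  add_left : ∀ x ∈ S, ∀ ξ ∈ tangent S x, ∀ ζ ∈ tangent S x, ∀ V, IsField S V →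
    nabla x (ξ + ζ) V = nabla x ξ V + nabla x ζ V
  smul_left : ∀ x ∈ S, ∀ (a : ℝ), ∀ ξ ∈ tangent S x, ∀ V, IsField S V →
    nabla x (a • ξ) V = a • nabla x ξ V
  add_right : ∀ x ∈ S, ∀ ξ ∈ tangent S x, ∀ V W, IsField S V → IsField S W →
    nabla x ξ (fun y => V y + W y) = nabla x ξ V + nabla x ξ W
  leibniz : ∀ x ∈ S, ∀ ξ ∈ tangent S x, ∀ (φ : E → ℝ) (V : E → E), ContDiffOn ℝ ∞ φ S →
    IsField S V →
    nabla x ξ (fun y => φ y • V y) = fderivWithin ℝ φ S x ξ • V x + φ x • nabla x ξ V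
  torsion_free : ∀ x ∈ S, ∀ V W, IsField S V → IsField S W →
    nabla x (V x) W - nabla x (W x) V = VectorField.lieBracketWithin ℝ V W S x
  metric : ∀ x ∈ S, ∀ ξ ∈ tangent S x, ∀ V W, IsField S V → IsField S W →
    fderivWithin ℝ (fun y => g y (V y) (W y)) S x ξ =
      g x (nabla x ξ V) (W x) + g x (V x) (nabla x ξ W)

/-- Smooth vector fields along the curve `γ` in `S`, on the open set `J` of parameters. -/
def IsFieldAlong (S : Set E) (γ : ℝ → E) (J : Set ℝ) (Z : ℝ → E) : Prop :=
  ContDiffOn ℝ ∞ Z J ∧ ∀ t ∈ J, Z t ∈ tangent S (γ t)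

/-- `D` is the covariant derivative `D/dt` along `γ` induced by the connection `nabla`. -/
structure IsCovDerivAlong (S : Set E) (nabla : E → E → (E → E) → E) (γ : ℝ → E) (J : Set ℝ)
    (D : (ℝ → E) → ℝ → E) : Prop where
  field : ∀ Z, IsFieldAlong S γ J Z → IsFieldAlong S γ J (D Z)
  add : ∀ Y Z, IsFieldAlong S γ J Y → IsFieldAlong S γ J Z → ∀ t ∈ J,
    D (fun s => Y s + Z s) t = D Y t + D Z t
  leibniz : ∀ (φ : ℝ → ℝ) (Z : ℝ → E), ContDiffOn ℝ ∞ φ J → IsFieldAlong S γ J Z → ∀ t ∈ J,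
    D (fun s => φ s • Z s) t = deriv φ t • Z t + φ t • D Z t
  comp : ∀ V, IsField S V → ∀ t ∈ J,
    D (fun s => V (γ s)) t = nabla (γ t) (deriv γ t) V

/-- `γ : J → S` is a geodesic: its acceleration `(D/dt) γ'` vanishes. -/
def IsGeodesic (S : Set E) (nabla : E → E → (E → E) → E) (γ : ℝ → E) (J : Set ℝ) : Prop :=
  ContDiffOn ℝ ∞ γ J ∧ (∀ t ∈ J, γ t ∈ S) ∧
    ∃ D, IsCovDerivAlong S nabla γ J D ∧ ∀ t ∈ J, D (deriv γ) t = 0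

/-- The exponential `Exp_x ξ` is defined and equal to `y`: there is a geodesic, on an open interval
containing `[0, 1]`, with initial point `x`, initial velocity `ξ` and value `y` at time `1`. -/
def HasExp (S : Set E) (nabla : E → E → (E → E) → E) (x ξ y : E) : Prop :=
  ∃ (γ : ℝ → E) (J : Set ℝ), IsOpen J ∧ J.OrdConnected ∧ Set.Icc 0 1 ⊆ J ∧
    IsGeodesic S nabla γ J ∧ γ 0 = x ∧ deriv γ 0 = ξ ∧ γ 1 = y

/-- The Riemannian gradient of `f` at `x`: the vector `v ∈ T_x S` with `g_x(v, ξ) = D f(x)[ξ]` for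
all `ξ ∈ T_x S`. -/
def rgrad (S : Set E) (g : E → E → E → ℝ) (f : E → ℝ) (x : E) : E :=
  Classical.epsilon fun v => v ∈ tangent S x ∧ ∀ ξ ∈ tangent S x, g x v ξ = fderivWithin ℝ f S x ξ

/-- `ξ ∈ T_x S` solves the Riemannian Newton equation `∇_ξ grad f = - grad f(x)`. -/
def IsNewtonVector (S : Set E) (g : E → E → E → ℝ) (nabla : E → E → (E → E) → E) (f : E → ℝ)
    (x ξ : E) : Prop :=
  ξ ∈ tangent S x ∧ nabla x ξ (rgrad S g f) = -rgrad S g f x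

/-- `y` is obtained from `x` by one step of the pure Riemannian Newton method for `f`:
`y = Exp_x ξ` with `ξ` a solution of the Newton equation at `x`. -/
def IsNewtonStep (S : Set E) (g : E → E → E → ℝ) (nabla : E → E → (E → E) → E) (f : E → ℝ)
    (x y : E) : Prop :=
  ∃ ξ, IsNewtonVector S g nabla f x ξ ∧ HasExp S nabla x ξ y

end General

/-! ### The manifold of matrices of rank `p` and the total space -/

/-- The ambient space `ℝ^{m×p} × ℝ^{n×p}` of the total space. -/
abbrev Pair (m n p : ℕ) : Type := Matrix (Fin m) (Fin p) ℝ × Matrix (Fin n) (Fin p) ℝ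

/-- The set `M_p` of `m × n` matrices of rank `p`. -/
def Mp (m n p : ℕ) : Set (Matrix (Fin m) (Fin n) ℝ) := {X | X.rank = p}

/-- The Stiefel manifold `St(p, m)`. -/
def Stiefel (m p : ℕ) : Set (Matrix (Fin m) (Fin p) ℝ) := {M | Mᵀ * M = 1}

/-- The total space `St(p, m) × ℝ_*^{n×p}`. -/
def SRp (m n p : ℕ) : Set (Pair m n p) := {z | z.1 ∈ Stiefel m p ∧ z.2.rank = p}

variable {m n p : ℕ}

/-- The map `π : (M, N) ↦ M Nᵀ`. -/
def proj (z : Pair m n p) : Matrix (Fin m) (Fin n) ℝ := z.1 * z.2ᵀ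

/-- The differential `Dπ(z)[η]`. -/
def dproj (z η : Pair m n p) : Matrix (Fin m) (Fin n) ℝ := fderiv ℝ proj z η

/-- The Euclidean metric on the total space. -/
def gBar (_z η ζ : Pair m n p) : ℝ := (η.1ᵀ * ζ.1 + η.2ᵀ * ζ.2).trace

/-- The vertical space at `z`: the tangent space to the fiber of `π` through `z`. -/
def vertical (z : Pair m n p) : Set (Pair m n p) :=
  tangent {w | w ∈ SRp m n p ∧ proj w = proj z} z

/-- The horizontal space at `z`: the orthogonal complement of the vertical space in the tangent
space to the total space. -/
def horizontal (z : Pair m n p) : Set (Pair m n p) :=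
  {η | η ∈ tangent (SRp m n p) z ∧ ∀ v ∈ vertical z, gBar z η v = 0}

/-- The horizontal lift at `z` of a tangent vector `ξ` to `M_p` at `π(z)`. -/
def lift (z : Pair m n p) (ξ : Matrix (Fin m) (Fin n) ℝ) : Pair m n p :=
  Classical.epsilon fun η => η ∈ horizontal z ∧ dproj z η = ξ

/-- The projection `P^h` at `z` of a tangent vector onto the horizontal space along the vertical
space. -/
def hproj (z η : Pair m n p) : Pair m n p :=
  Classical.epsilon fun h => h ∈ horizontal z ∧ η - h ∈ vertical z

/-- The quotient metric on `M_p`: the inner product of the horizontal lifts at some point of the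
fiber. (That the choice of this point does not matter is part of the theorem.) -/
def quotMetric (p : ℕ) (X ξ ζ : Matrix (Fin m) (Fin n) ℝ) : ℝ :=
  let z : Pair m n p := Classical.epsilon fun z => z ∈ SRp m n p ∧ proj z = X
  gBar z (lift z ξ) (lift z ζ)

/-- The orthogonal projection of `ℝ^{m×p} × ℝ^{n×p}` onto the tangent space to the total space at
`z = (M, N)`: `(A, B) ↦ ((I - M Mᵀ) A + M skew(Mᵀ A), B)`. -/
def tproj (z η : Pair m n p) : Pair m n p :=
  ((1 - z.1 * z.1ᵀ) * η.1 + z.1 * ((1 / 2 : ℝ) • (z.1ᵀ * η.1 - (z.1ᵀ * η.1)ᵀ)), η.2)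

/-- The connection on the total space: the orthogonal projection of the directional derivative. -/
def nablaBar (z η : Pair m n p) (V : Pair m n p → Pair m n p) : Pair m n p :=
  tproj z (fderivWithin ℝ V (SRp m n p) z η)

/-- The Euclidean gradient (matrices of partial derivatives) of `F` on `ℝ^{m×p} × ℝ^{n×p}`. -/
def euclGrad (F : Pair m n p → ℝ) (z : Pair m n p) : Pair m n p :=
  (Matrix.of fun i j => fderiv ℝ F z (Matrix.single i j 1, 0),
    Matrix.of fun i j => fderiv ℝ F z (0, Matrix.single i j 1))

/-- The closed form of the exponential on the total space: with `A = Mᵀ Ṁ` and `S = Ṁᵀ Ṁ`,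
`([M Ṁ] exp([A, -S; I, A]) [I; 0] exp(-A), N + Ṅ)`. -/
def expTotal (z η : Pair m n p) : Pair m n p :=
  (Matrix.fromCols z.1 η.1 *
      NormedSpace.exp (Matrix.fromBlocks (z.1ᵀ * η.1) (-(η.1ᵀ * η.1)) 1 (z.1ᵀ * η.1)) *
      Matrix.fromRows (1 : Matrix (Fin p) (Fin p) ℝ) (0 : Matrix (Fin p) (Fin p) ℝ) *
      NormedSpace.exp (-(z.1ᵀ * η.1)),
    z.2 + η.2)

/-- The straight line `N + t Ṅ`, `0 ≤ t ≤ 1`, stays in the set of matrices of rank `p`. -/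
def StaysFullRank (z η : Pair m n p) : Prop :=
  ∀ t ∈ Set.Icc (0 : ℝ) 1, (z.2 + t • η.2).rank = p

/-- The gradient of `f ∘ π` on the total space. -/
def gradBar (f : Matrix (Fin m) (Fin n) ℝ → ℝ) : Pair m n p → Pair m n p :=
  rgrad (SRp m n p) gBar fun z => f (proj z)

/-- `η` is a horizontal solution of the lifted Newton equation
`P^h (∇̄_η grad (f ∘ π)) = - grad (f ∘ π)` at `z`. -/
def IsLiftedNewtonVector (f : Matrix (Fin m) (Fin n) ℝ → ℝ) (z η : Pair m n p) : Prop :=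
  η ∈ horizontal z ∧ hproj z (nablaBar z η (gradBar f)) = -gradBar f z

end FixedRank

end

open FixedRank

/-! The orthogonal group `O(p)` acts on the total space by `(M, N) ↦ (MQ, NQ)`, isometrically for
`gBar`, and its orbits are the fibers of `π`, so `π` is a Riemannian submersion. A vector is
orthogonal to the fiber exactly when its momentum `Ṁᵀ M + Ṅᵀ N` is symmetric, and making the
momentum symmetric by a vertical correction `(MΩ, NΩ)` is a Sylvester equation with positive
definite coefficient.

The fields obtained by projecting the constant ones onto the tangent spaces span every tangent
space, which makes the Koszul argument available: a Levi-Civita connection is unique, and that of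
the quotient is computed by differentiating horizontal lifts upstairs. Geodesics of the total
space are pairs of a Stiefel geodesic and a straight line, and their images are geodesics
downstairs when they start horizontally. That there are no others is seen without lifting a whole
geodesic: the `O(p)`-invariants of degree two of a horizontally lifted velocity depend only on
the velocity itself, and they satisfy an autonomous ordinary differential equation, whose
solution is unique. -/

noncomputable section

namespace FixedRank

section MatrixCalculus

variable {𝕜 : Type*} [NontriviallyNormedField 𝕜] {l m n : Type*}

theorem hasDerivAt_matrix_iff [Finite m] {A : 𝕜 → Matrix l m 𝕜} {A' : Matrix l m 𝕜} {t : 𝕜} :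
    HasDerivAt A A' t ↔ ∀ i j, HasDerivAt (fun s => A s i j) (A' i j) t := by
  cases nonempty_fintype m
  exact hasDerivAt_pi.trans (forall_congr' fun _ => hasDerivAt_pi)

theorem hasDerivAt_matrix_mul [Fintype m] [Finite n] {A : 𝕜 → Matrix l m 𝕜}
    {B : 𝕜 → Matrix m n 𝕜} {A' : Matrix l m 𝕜} {B' : Matrix m n 𝕜} {t : 𝕜}
    (hA : HasDerivAt A A' t) (hB : HasDerivAt B B' t) :
    HasDerivAt (fun s => A s * B s) (A' * B t + A t * B') t := by
  rw [hasDerivAt_matrix_iff] at *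
  intro i j
  simp only [Matrix.add_apply, Matrix.mul_apply, ← Finset.sum_add_distrib]
  exact HasDerivAt.fun_sum fun r _ => (hA i r).mul (hB r j)

theorem hasDerivAt_matrix_transpose [Finite l] [Finite m] {A : 𝕜 → Matrix l m 𝕜}
    {A' : Matrix l m 𝕜} {t : 𝕜} (hA : HasDerivAt A A' t) : HasDerivAt (fun s => (A s)ᵀ) A'ᵀ t := by
  rw [hasDerivAt_matrix_iff] at *
  exact fun i j => hA j i

theorem hasDerivAt_matrix_trace [Fintype l] {A : 𝕜 → Matrix l l 𝕜} {A' : Matrix l l 𝕜} {t : 𝕜}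
    (hA : HasDerivAt A A' t) : HasDerivAt (fun s => (A s).trace) A'.trace t := by
  rw [hasDerivAt_matrix_iff] at hA
  exact HasDerivAt.fun_sum fun i _ => hA i i

variable [Fintype l] [Fintype m] [Fintype n] {E : Type*} [NormedAddCommGroup E] [NormedSpace 𝕜 E]
  {s : Set E} {x : E} {r : ℕ∞ω}

theorem contDiffWithinAt_matrix_iff {A : E → Matrix l m 𝕜} :
    ContDiffWithinAt 𝕜 r A s x ↔ ∀ i j, ContDiffWithinAt 𝕜 r (fun y => A y i j) s x :=
  contDiffWithinAt_pi.trans (forall_congr' fun _ => contDiffWithinAt_pi)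

@[fun_prop]
theorem contDiffWithinAt_matrix_mul {A : E → Matrix l m 𝕜} {B : E → Matrix m n 𝕜}
    (hA : ContDiffWithinAt 𝕜 r A s x) (hB : ContDiffWithinAt 𝕜 r B s x) :
    ContDiffWithinAt 𝕜 r (fun y => A y * B y) s x := by
  rw [contDiffWithinAt_matrix_iff] at *
  intro i j
  simp only [Matrix.mul_apply]
  exact ContDiffWithinAt.sum fun r _ => (hA i r).mul (hB r j)

@[fun_prop]
theorem contDiffAt_matrix_mul {A : E → Matrix l m 𝕜} {B : E → Matrix m n 𝕜}
    (hA : ContDiffAt 𝕜 r A x) (hB : ContDiffAt 𝕜 r B x) :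
    ContDiffAt 𝕜 r (fun y => A y * B y) x :=
  contDiffWithinAt_matrix_mul hA hB

@[fun_prop]
theorem contDiffOn_matrix_mul {A : E → Matrix l m 𝕜} {B : E → Matrix m n 𝕜}
    (hA : ContDiffOn 𝕜 r A s) (hB : ContDiffOn 𝕜 r B s) :
    ContDiffOn 𝕜 r (fun y => A y * B y) s :=
  fun y hy => contDiffWithinAt_matrix_mul (hA y hy) (hB y hy)

@[fun_prop]
theorem contDiff_matrix_mul {A : E → Matrix l m 𝕜} {B : E → Matrix m n 𝕜}
    (hA : ContDiff 𝕜 r A) (hB : ContDiff 𝕜 r B) : ContDiff 𝕜 r (fun y => A y * B y) :=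
  contDiffOn_univ.1 (contDiffOn_matrix_mul hA.contDiffOn hB.contDiffOn)

@[fun_prop]
theorem contDiffWithinAt_matrix_transpose {A : E → Matrix l m 𝕜}
    (hA : ContDiffWithinAt 𝕜 r A s x) : ContDiffWithinAt 𝕜 r (fun y => (A y)ᵀ) s x := by
  rw [contDiffWithinAt_matrix_iff] at *
  exact fun i j => hA j i

@[fun_prop]
theorem contDiffAt_matrix_transpose {A : E → Matrix l m 𝕜} (hA : ContDiffAt 𝕜 r A x) :
    ContDiffAt 𝕜 r (fun y => (A y)ᵀ) x :=
  contDiffWithinAt_matrix_transpose hA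

@[fun_prop]
theorem contDiffOn_matrix_transpose {A : E → Matrix l m 𝕜} (hA : ContDiffOn 𝕜 r A s) :
    ContDiffOn 𝕜 r (fun y => (A y)ᵀ) s :=
  fun y hy => contDiffWithinAt_matrix_transpose (hA y hy)

@[fun_prop]
theorem contDiff_matrix_transpose {A : E → Matrix l m 𝕜} (hA : ContDiff 𝕜 r A) :
    ContDiff 𝕜 r (fun y => (A y)ᵀ) :=
  contDiffOn_univ.1 (contDiffOn_matrix_transpose hA.contDiffOn)

theorem contDiffWithinAt_matrix_trace {A : E → Matrix l l 𝕜} (hA : ContDiffWithinAt 𝕜 r A s x) :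
    ContDiffWithinAt 𝕜 r (fun y => (A y).trace) s x := by
  rw [contDiffWithinAt_matrix_iff] at *
  exact ContDiffWithinAt.sum fun i _ => hA i i

theorem contDiffWithinAt_matrix_det [DecidableEq l] {A : E → Matrix l l 𝕜}
    (hA : ContDiffWithinAt 𝕜 r A s x) : ContDiffWithinAt 𝕜 r (fun y => (A y).det) s x := by
  rw [contDiffWithinAt_matrix_iff] at hA
  simp only [Matrix.det_apply]
  exact ContDiffWithinAt.sum fun σ _ => (contDiffWithinAt_prod fun i _ => hA _ _).const_smul _

theorem contDiffWithinAt_matrix_inv [DecidableEq l] {A : E → Matrix l l 𝕜}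
    (hA : ContDiffWithinAt 𝕜 r A s x) (hx : IsUnit (A x).det) :
    ContDiffWithinAt 𝕜 r (fun y => (A y)⁻¹) s x := by
  simp only [Matrix.inv_def, Ring.inverse_eq_inv']
  refine ((contDiffWithinAt_matrix_det hA).inv hx.ne_zero).smul ?_
  rw [contDiffWithinAt_matrix_iff] at *
  intro i j
  simp only [Matrix.adjugate_apply]
  refine contDiffWithinAt_matrix_det (contDiffWithinAt_matrix_iff.2 fun a b => ?_)
  by_cases h : a = j
  · subst h
    simpa using contDiffWithinAt_const
  · simpa [h] using hA a b

end MatrixCalculus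

section MatrixExponential

open NormedSpace (exp)

variable {𝕜 : Type*} [RCLike 𝕜] {n : Type*} [Fintype n] [DecidableEq n]

theorem hasDerivAt_matrix_exp_smul (A : Matrix n n 𝕜) (t : 𝕜) :
    HasDerivAt (fun s : 𝕜 => exp (s • A)) (exp (t • A) * A) t :=
  @hasDerivAt_exp_smul_const 𝕜 _ _ Matrix.linftyOpNormedRing Matrix.linftyOpNormedAlgebra
    (FiniteDimensional.complete 𝕜 _) A t

theorem commute_matrix_exp_smul (A : Matrix n n 𝕜) (t : 𝕜) : Commute (exp (t • A)) A :=
  ((Commute.refl A).smul_left t).exp_left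

theorem contDiff_linearMap_exp_smul {𝔸 F : Type*} [NormedRing 𝔸] [NormedAlgebra 𝕜 𝔸]
    [FiniteDimensional 𝕜 𝔸] [NormedAddCommGroup F] [NormedSpace 𝕜 F] (L : 𝔸 →ₗ[𝕜] F) (a : 𝔸)
    {r : ℕ∞ω} : ContDiff 𝕜 r fun s : 𝕜 => L (exp (s • a)) := by
  have : CompleteSpace 𝔸 := FiniteDimensional.complete 𝕜 𝔸
  have hexp : ContDiff 𝕜 r (exp : 𝔸 → 𝔸) :=
    contDiff_iff_contDiffAt.2 fun b => (NormedSpace.exp_analytic (𝕂 := 𝕜) b).contDiffAt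
  exact L.toContinuousLinearMap.contDiff.comp (hexp.comp (contDiff_id.smul contDiff_const))

-- The sup norm is not submultiplicative, so the identity is read as a linear map from the matrices
-- with the `L^∞` operator norm to those with the sup norm.
theorem contDiff_matrix_exp_smul (A : Matrix n n 𝕜) {r : ℕ∞ω} :
    ContDiff 𝕜 r fun s : 𝕜 => exp (s • A) :=
  @contDiff_linearMap_exp_smul 𝕜 _ _ _ Matrix.linftyOpNormedRing Matrix.linftyOpNormedAlgebra _ _ _
    LinearMap.id A r

theorem exp_smul_transpose_mul_mul_exp_smul {B G : Matrix n n 𝕜} (h : Bᵀ * G + G * B = 0) (t : 𝕜) :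
    (exp (t • B))ᵀ * G * exp (t • B) = G := by
  have hd (s : 𝕜) : HasDerivAt (fun s => (exp (s • B))ᵀ * G * exp (s • B)) 0 s := by
    have h1 := hasDerivAt_matrix_exp_smul B s
    convert! hasDerivAt_matrix_mul (hasDerivAt_matrix_mul (hasDerivAt_matrix_transpose h1)
      (hasDerivAt_const s G)) h1 using 1
    rw [(commute_matrix_exp_smul B s).eq, Matrix.transpose_mul, Matrix.mul_zero, add_zero,
      ← Matrix.mul_assoc, Matrix.mul_assoc _ Bᵀ, Matrix.mul_assoc _ G B, ← Matrix.add_mul,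
      ← Matrix.mul_add, h, Matrix.mul_zero, Matrix.zero_mul]
  have hconst := is_const_of_deriv_eq_zero (fun s => (hd s).differentiableAt)
    (fun s => (hd s).deriv) t 0
  simpa [NormedSpace.exp_zero] using hconst

theorem exp_transpose_mul_exp {A : Matrix n n 𝕜} (hA : Aᵀ = -A) : (exp A)ᵀ * exp A = 1 := by
  simpa [hA] using exp_smul_transpose_mul_mul_exp_smul (G := 1) (B := A) (by simp [hA]) 1

end MatrixExponential

section Curves

variable {E F : Type*} [NormedAddCommGroup E] [NormedSpace ℝ E] [NormedAddCommGroup F]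
  [NormedSpace ℝ F] {S : Set E}

theorem hasDerivAt_comp_curve {φ : E → F} {c : ℝ → E} {v : E} {t : ℝ}
    (hφ : DifferentiableWithinAt ℝ φ S (c t)) (hc : HasDerivAt c v t)
    (hS : ∀ᶠ s in 𝓝 t, c s ∈ S) :
    HasDerivAt (fun s => φ (c s)) (fderivWithin ℝ φ S (c t) v) t :=
  hφ.hasFDerivWithinAt.comp_hasDerivAt t hc hS

theorem exists_curve_of_mem_tangent {x v : E} (hv : v ∈ tangent S x) :
    ∃ c : ℝ → E, c 0 = x ∧ HasDerivAt c v 0 ∧ (∀ᶠ t in 𝓝 0, c t ∈ S) ∧ ContDiffAt ℝ ∞ c 0 := by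
  obtain ⟨c, ε, hε, hc, hS, h0, hd⟩ := hv
  have : Set.Ioo (-ε) ε ∈ 𝓝 (0 : ℝ) := Ioo_mem_nhds (by linarith) hε
  exact ⟨c, h0, hd, Filter.mem_of_superset this hS, hc.contDiffAt this⟩

theorem mem_tangent_of_curve {c : ℝ → E} {v : E} {t : ℝ} (hd : HasDerivAt c v t)
    (hS : ∀ᶠ s in 𝓝 t, c s ∈ S) (hc : ∀ᶠ s in 𝓝 t, ContDiffAt ℝ ∞ c s) :
    v ∈ tangent S (c t) := by
  obtain ⟨ε, hε, h⟩ := Metric.eventually_nhds_iff_ball.1 (hS.and hc)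
  have hball : ∀ s ∈ Set.Ioo (-ε) ε, t + s ∈ Metric.ball t ε := fun s hs => by
    simpa [abs_lt] using hs
  refine ⟨fun s => c (t + s), ε, hε, fun s hs => ?_, fun s hs => (h _ (hball s hs)).1, by simp, ?_⟩
  · exact ((h _ (hball s hs)).2.comp s (by fun_prop)).contDiffWithinAt
  · have hd' : HasDerivAt c v (t + 0) := by simpa using hd
    exact hd'.comp_const_add t 0

theorem eqOn_of_hasDerivAt {Φ : E → E} (hΦ : ContDiff ℝ 1 Φ) {f g : ℝ → E} {a b : ℝ}
    (hf : ∀ t ∈ Set.Icc a b, HasDerivAt f (Φ (f t)) t)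
    (hg : ∀ t ∈ Set.Icc a b, HasDerivAt g (Φ (g t)) t) (ha : f a = g a) :
    Set.EqOn f g (Set.Icc a b) := by
  have hfc : ContinuousOn f (Set.Icc a b) := fun t ht => (hf t ht).continuousAt.continuousWithinAt
  have hgc : ContinuousOn g (Set.Icc a b) := fun t ht => (hg t ht).continuousAt.continuousWithinAt
  have hK := (isCompact_Icc.image_of_continuousOn hfc).union
    (isCompact_Icc.image_of_continuousOn hgc)
  obtain ⟨C, hC⟩ := hΦ.locallyLipschitz.locallyLipschitzOn.exists_lipschitzOnWith_of_compact hK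
  exact ODE_solution_unique_of_mem_Icc_right (v := fun _ => Φ) (fun _ _ => hC) hfc
    (fun t ht => (hf t (Set.Ico_subset_Icc_self ht)).hasDerivWithinAt)
    (fun t ht => Or.inl ⟨t, Set.Ico_subset_Icc_self ht, rfl⟩) hgc
    (fun t ht => (hg t (Set.Ico_subset_Icc_self ht)).hasDerivWithinAt)
    (fun t ht => Or.inr ⟨t, Set.Ico_subset_Icc_self ht, rfl⟩) ha

end Curves

section MatrixProducts

theorem transpose_mul_mul_mul {k l q R : Type*} [Fintype k] [Fintype l] [CommSemiring R]
    {o : Type*} [Fintype o] (A : Matrix k l R) (B : Matrix k o R) (P : Matrix l q R)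
    (Q : Matrix o q R) : (A * P)ᵀ * (B * Q) = Pᵀ * (Aᵀ * B) * Q := by
  simp only [Matrix.transpose_mul, Matrix.mul_assoc]

theorem mul_mul_transpose_mul_of_orthogonal {k l o R : Type*} [Fintype o] [DecidableEq o]
    [CommRing R] {Q : Matrix o o R} (hQ : Qᵀ * Q = 1) (A : Matrix k o R) (B : Matrix l o R) :
    A * Q * (B * Q)ᵀ = A * Bᵀ := by
  rw [Matrix.transpose_mul, Matrix.mul_assoc, ← Matrix.mul_assoc Q, mul_eq_one_comm.1 hQ,
    Matrix.one_mul]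

theorem transpose_mul_one_sub_mul_transpose {k o R : Type*} [Fintype k] [DecidableEq k] [Fintype o]
    [DecidableEq o] [Ring R] {M : Matrix k o R} (hM : Mᵀ * M = 1) : Mᵀ * (1 - M * Mᵀ) = 0 := by
  rw [Matrix.mul_sub, ← Matrix.mul_assoc, hM, Matrix.mul_one, Matrix.one_mul, sub_self]

theorem one_sub_mul_transpose_mul_self {k o R : Type*} [Fintype k] [DecidableEq k] [Fintype o]
    [DecidableEq o] [Ring R] {M : Matrix k o R} (hM : Mᵀ * M = 1) : (1 - M * Mᵀ) * M = 0 := by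
  rw [Matrix.sub_mul, Matrix.mul_assoc, hM, Matrix.mul_one, Matrix.one_mul, sub_self]

end MatrixProducts

section RealMatrices

variable {m n : Type*} [Fintype n]

theorem trace_transpose_mul_self_nonneg [Fintype m] (A : Matrix m n ℝ) : 0 ≤ (Aᵀ * A).trace := by
  simpa using (Matrix.posSemidef_conjTranspose_mul_self A).trace_nonneg

theorem trace_transpose_mul_self_eq_zero_iff [Fintype m] {A : Matrix m n ℝ} :
    (Aᵀ * A).trace = 0 ↔ A = 0 := by
  simpa using Matrix.trace_conjTranspose_mul_self_eq_zero_iff (A := A)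

theorem trace_mul_eq_zero_of_symm_of_skew {C Ω : Matrix n n ℝ} (hC : Cᵀ = C) (hΩ : Ωᵀ = -Ω) :
    (C * Ω).trace = 0 := by
  have h := Matrix.trace_transpose (C * Ω)
  rw [Matrix.transpose_mul, hC, hΩ, Matrix.neg_mul, Matrix.trace_neg, Matrix.trace_mul_comm] at h
  linarith

variable {p : ℕ}

theorem isUnit_det_of_rank_eq {A : Matrix (Fin p) (Fin p) ℝ} (h : A.rank = p) : IsUnit A.det := by
  rw [← Matrix.isUnit_iff_isUnit_det, ← Matrix.mulVec_surjective_iff_isUnit]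
  have : LinearMap.range A.mulVecLin = ⊤ :=
    Submodule.eq_top_of_finrank_eq (by simpa [Matrix.rank] using h)
  exact LinearMap.range_eq_top.1 this

theorem rank_eq_iff_isUnit_det_gram [Fintype m] {N : Matrix m (Fin p) ℝ} :
    N.rank = p ↔ IsUnit (Nᵀ * N).det := by
  rw [← Matrix.rank_transpose_mul_self]
  refine ⟨isUnit_det_of_rank_eq, fun h => ?_⟩
  rw [Matrix.rank_of_isUnit _ ((Matrix.isUnit_iff_isUnit_det _).2 h), Fintype.card_fin]

theorem isOpen_setOf_rank_eq [Finite m] : IsOpen {N : Matrix m (Fin p) ℝ | N.rank = p} := by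
  cases nonempty_fintype m
  have hdet : Continuous fun N : Matrix m (Fin p) ℝ => (Nᵀ * N).det :=
    Continuous.matrix_det (by fun_prop)
  convert! (isOpen_compl_singleton (x := (0 : ℝ))).preimage hdet using 1
  ext N
  simp [rank_eq_iff_isUnit_det_gram]

theorem gram_mul_inv_gram [Fintype m] {N : Matrix m (Fin p) ℝ} (h : N.rank = p) :
    (Nᵀ * N) * (Nᵀ * N)⁻¹ = 1 := Matrix.mul_nonsing_inv _ (rank_eq_iff_isUnit_det_gram.1 h)

theorem rank_eq_of_transpose_mul_self_eq_one [Fintype m] {M : Matrix m (Fin p) ℝ} (h : Mᵀ * M = 1) :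
    M.rank = p := by
  rw [rank_eq_iff_isUnit_det_gram, h]
  simp

theorem rank_mul_transpose_eq_iff [Finite m] {M : Matrix m (Fin p) ℝ} (hM : M.rank = p)
    {N : Matrix n (Fin p) ℝ} : (M * Nᵀ).rank = p ↔ N.rank = p := by
  cases nonempty_fintype m
  suffices h : (M * Nᵀ).rank = N.rank by rw [h]
  refine le_antisymm ((Matrix.rank_mul_le_right _ _).trans_eq N.rank_transpose) ?_
  calc N.rank = (Mᵀ * M * Nᵀ).rank := by
        rw [Matrix.rank_mul_eq_right_of_isUnit_det _ _ (rank_eq_iff_isUnit_det_gram.1 hM),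
          N.rank_transpose]
    _ ≤ (M * Nᵀ).rank := by
        rw [Matrix.mul_assoc]
        exact Matrix.rank_mul_le_right _ _

theorem exists_orthonormal_matrix [Fintype m] (S : Submodule ℝ (EuclideanSpace ℝ m))
    (hS : Module.finrank ℝ S = p) :
    ∃ M : Matrix m (Fin p) ℝ, Mᵀ * M = 1 ∧
      ∀ v : m → ℝ, WithLp.toLp 2 v ∈ S → M *ᵥ (Mᵀ *ᵥ v) = v := by
  let b := (stdOrthonormalBasis ℝ S).reindex (finCongr hS)
  refine ⟨Matrix.of fun i k => (b k : EuclideanSpace ℝ m) i, ?_, fun v hv => ?_⟩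
  · ext i j
    have hij := orthonormal_iff_ite.1 b.orthonormal i j
    rw [Submodule.coe_inner, PiLp.inner_apply] at hij
    rw [Matrix.mul_apply, Matrix.one_apply, ← hij]
    exact Finset.sum_congr rfl fun k _ => mul_comm _ _
  · funext i
    have hsum := congrArg (fun w : S => (w : EuclideanSpace ℝ m).ofLp i)
      (b.sum_repr ⟨WithLp.toLp 2 v, hv⟩)
    simp only [Submodule.coe_sum, WithLp.ofLp_sum, Finset.sum_apply] at hsum
    rw [← hsum]
    simp [b.repr_apply_apply, PiLp.inner_apply, Matrix.mulVec, dotProduct, mul_comm]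

theorem exists_orthonormal_matrix_of_rank_eq [Fintype m] {X : Matrix m n ℝ} (hX : X.rank = p) :
    ∃ M : Matrix m (Fin p) ℝ, Mᵀ * M = 1 ∧ M * (Mᵀ * X) = X := by
  classical
  have hS : Module.finrank ℝ (LinearMap.range (Matrix.toEuclideanLin X)) = p := by
    rw [← hX, Matrix.rank_eq_finrank_range_toLin X (EuclideanSpace.basisFun m ℝ).toBasis
      (EuclideanSpace.basisFun n ℝ).toBasis, ← Matrix.toEuclideanLin_eq_toLin_orthonormal]
  obtain ⟨M, hM, hMS⟩ := exists_orthonormal_matrix _ hS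
  refine ⟨M, hM, Matrix.ext_of_mulVec_single fun j => ?_⟩
  simp only [← Matrix.mulVec_mulVec]
  refine hMS _ ⟨WithLp.toLp 2 (Pi.single j 1), ?_⟩
  simp [Matrix.toLpLin_apply]

end RealMatrices

section LinearEquations

variable {𝕜 : Type*} [NontriviallyNormedField 𝕜] [CompleteSpace 𝕜] {E V : Type*}
  [NormedAddCommGroup E] [NormedSpace 𝕜 E] [NormedAddCommGroup V] [NormedSpace 𝕜 V]
  [FiniteDimensional 𝕜 V] {s : Set E} {r : ℕ∞ω}

theorem contDiffOn_of_linearMap_apply {T : E → Module.End 𝕜 V} {u : E → V}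
    (hT : ∀ v, ContDiffOn 𝕜 r (fun y => T y v) s) (hinj : ∀ y ∈ s, Function.Injective (T y))
    (hu : ContDiffOn 𝕜 r (fun y => T y (u y)) s) : ContDiffOn 𝕜 r u s := by
  have : CompleteSpace V := FiniteDimensional.complete 𝕜 V
  let L (y : E) : V →L[𝕜] V := LinearMap.toContinuousLinearMap (T y)
  have hL : ContDiffOn 𝕜 r L s := contDiffOn_clm_apply.2 hT
  have hinv (y : E) (hy : y ∈ s) : (L y).IsInvertible :=
    ⟨(LinearEquiv.ofInjectiveEndo (T y) (hinj y hy)).toContinuousLinearEquiv, by ext; rfl⟩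
  have hsol : ∀ y ∈ s, u y = (L y).inverse (T y (u y)) :=
    fun y hy => ((hinv y hy).inverse_apply_eq.2 rfl).symm
  exact ContDiffOn.congr (fun y hy =>
    ((hinv y hy).contDiffAt_map_inverse.comp_contDiffWithinAt y (hL y hy)).clm_apply (hu y hy)) hsol

end LinearEquations

section Sylvester

variable {n : Type*} [Fintype n] [DecidableEq n]

/-- The Sylvester operator `Ω ↦ GΩ + ΩG`. -/
def sylvesterOp (G : Matrix n n ℝ) : Module.End ℝ (Matrix n n ℝ) :=
  LinearMap.mulLeft ℝ G + LinearMap.mulRight ℝ G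

@[simp]
theorem sylvesterOp_apply (G Ω : Matrix n n ℝ) : sylvesterOp G Ω = G * Ω + Ω * G := rfl

theorem eq_zero_of_sylvesterOp_eq_zero {G Ω : Matrix n n ℝ} (hG : G.PosDef)
    (h : sylvesterOp G Ω = 0) : Ω = 0 := by
  have h₁ := hG.posSemidef.conjTranspose_mul_mul_same Ω
  have h₂ := (hG.posSemidef.mul_mul_conjTranspose_same Ω).trace_nonneg
  simp only [Matrix.conjTranspose_eq_transpose_of_trivial] at h₁ h₂
  have hsum : (Ωᵀ * G * Ω).trace + (Ω * G * Ωᵀ).trace = 0 := by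
    rw [Matrix.trace_mul_comm (Ω * G), Matrix.mul_assoc, ← Matrix.trace_add, ← Matrix.mul_add,
      ← sylvesterOp_apply, h, Matrix.mul_zero, Matrix.trace_zero]
  have hzero : Ωᵀ * G * Ω = 0 := h₁.trace_eq_zero_iff.1 (by linarith [h₁.trace_nonneg])
  refine Matrix.ext_of_mulVec_single fun j => ?_
  rw [Matrix.zero_mulVec]
  by_contra hj
  refine (hG.dotProduct_mulVec_pos hj).ne' ?_
  rw [star_trivial, Matrix.dotProduct_mulVec, Matrix.vecMul_mulVec, ← Matrix.dotProduct_mulVec,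
    Matrix.mulVec_mulVec, hzero, Matrix.zero_mulVec, dotProduct_zero]

theorem injective_sylvesterOp {G : Matrix n n ℝ} (hG : G.PosDef) :
    Function.Injective (sylvesterOp G) :=
  (injective_iff_map_eq_zero _).2 fun _ h => eq_zero_of_sylvesterOp_eq_zero hG h

/-- The solution `Ω` of the Sylvester equation `GΩ + ΩG = C`, for positive definite `G`. -/
def sylvester (G C : Matrix n n ℝ) : Matrix n n ℝ := Ring.inverse (sylvesterOp G) C

theorem sylvester_eq_iff {G : Matrix n n ℝ} (hG : G.PosDef) {C Ω : Matrix n n ℝ} :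
    sylvester G C = Ω ↔ G * Ω + Ω * G = C := by
  have hunit : IsUnit (sylvesterOp G) := LinearMap.isUnit_iff_ker_eq_bot _ |>.2
    (LinearMap.ker_eq_bot.2 (injective_sylvesterOp hG))
  rw [← (injective_sylvesterOp hG).eq_iff, sylvester, ← Module.End.mul_apply,
    Ring.mul_inverse_cancel _ hunit, Module.End.one_apply, sylvesterOp_apply, eq_comm]

theorem sylvester_spec {G : Matrix n n ℝ} (hG : G.PosDef) (C : Matrix n n ℝ) :
    G * sylvester G C + sylvester G C * G = C := (sylvester_eq_iff hG).1 rfl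

theorem transpose_sylvester {G : Matrix n n ℝ} (hG : G.PosDef) (C : Matrix n n ℝ) :
    (sylvester G C)ᵀ = sylvester G Cᵀ := by
  have hGt : Gᵀ = G := by simpa using hG.isHermitian.eq
  refine ((sylvester_eq_iff hG).2 ?_).symm
  simpa [hGt, add_comm] using congrArg Matrix.transpose (sylvester_spec hG C)

theorem sylvester_neg (G C : Matrix n n ℝ) : sylvester G (-C) = -sylvester G C := map_neg _ _

theorem contDiffOn_sylvester {E : Type*} [NormedAddCommGroup E] [NormedSpace ℝ E] {s : Set E}
    {r : ℕ∞ω} {G C : E → Matrix n n ℝ} (hG : ContDiffOn ℝ r G s) (hC : ContDiffOn ℝ r C s)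
    (hpos : ∀ y ∈ s, (G y).PosDef) : ContDiffOn ℝ r (fun y => sylvester (G y) (C y)) s := by
  refine contDiffOn_of_linearMap_apply (T := fun y => sylvesterOp (G y)) (fun Ω => ?_)
    (fun y hy => injective_sylvesterOp (hpos y hy))
    (hC.congr fun y hy => sylvester_spec (hpos y hy) _)
  simp only [sylvesterOp_apply]
  fun_prop

end Sylvester

section FiberAction

variable {m n p : ℕ} {z w : Pair m n p} {Q : Matrix (Fin p) (Fin p) ℝ}

theorem proj_mem (hz : z ∈ SRp m n p) : proj z ∈ Mp m n p :=
  (rank_mul_transpose_eq_iff (rank_eq_of_transpose_mul_self_eq_one hz.1)).2 hz.2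

theorem orthonormalFactor_mem {X : Matrix (Fin m) (Fin n) ℝ} {M : Matrix (Fin m) (Fin p) ℝ}
    (hX : X ∈ Mp m n p) (hM : Mᵀ * M = 1) (hMX : M * (Mᵀ * X) = X) :
    (M, Xᵀ * M) ∈ SRp m n p ∧ proj (M, Xᵀ * M) = X := by
  have hproj : M * (Xᵀ * M)ᵀ = X := by
    rwa [Matrix.transpose_mul, Matrix.transpose_transpose]
  have hrank : (M * (Xᵀ * M)ᵀ).rank = p := (congrArg Matrix.rank hproj).trans hX
  exact ⟨⟨hM, (rank_mul_transpose_eq_iff (rank_eq_of_transpose_mul_self_eq_one hM)).1 hrank⟩,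
    hproj⟩

theorem exists_proj_eq {X : Matrix (Fin m) (Fin n) ℝ} (hX : X ∈ Mp m n p) :
    ∃ z ∈ SRp m n p, proj z = X := by
  obtain ⟨M, hM, hMX⟩ := exists_orthonormal_matrix_of_rank_eq hX
  exact ⟨_, orthonormalFactor_mem hX hM hMX⟩

/-- The right action of a square matrix on both factors; orthogonal matrices act simply
transitively on the fibers of `π`. -/
def act (z : Pair m n p) (Q : Matrix (Fin p) (Fin p) ℝ) : Pair m n p := (z.1 * Q, z.2 * Q)

theorem act_mem (hz : z ∈ SRp m n p) (hQ : Qᵀ * Q = 1) : act z Q ∈ SRp m n p := by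
  have hdet : IsUnit Q.det :=
    IsUnit.of_mul_eq_one_right Qᵀ.det (by rw [← Matrix.det_mul, hQ, Matrix.det_one])
  refine ⟨?_, (Matrix.rank_mul_eq_left_of_isUnit_det Q z.2 hdet).trans hz.2⟩
  exact (transpose_mul_mul_mul z.1 z.1 Q Q).trans (by rw [hz.1, Matrix.mul_one, hQ])

theorem proj_act (z : Pair m n p) (hQ : Qᵀ * Q = 1) : proj (act z Q) = proj z :=
  mul_mul_transpose_mul_of_orthogonal hQ z.1 z.2

theorem act_neg (z : Pair m n p) (Q : Matrix (Fin p) (Fin p) ℝ) : act z (-Q) = -act z Q := by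
  simp [act]

theorem exists_act_eq (hz : z ∈ SRp m n p) (hw : w ∈ SRp m n p) (h : proj w = proj z) :
    ∃ Q : Matrix (Fin p) (Fin p) ℝ, Qᵀ * Q = 1 ∧ w = act z Q := by
  have hz1 : z.1ᵀ * z.1 = 1 := hz.1
  have hw1 : w.1ᵀ * w.1 = 1 := hw.1
  simp only [proj] at h
  have hcol : w.1 = z.1 * (z.2ᵀ * (w.2 * (w.2ᵀ * w.2)⁻¹)) := by
    rw [← Matrix.mul_assoc, ← h, Matrix.mul_assoc, ← Matrix.mul_assoc w.2ᵀ,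
      gram_mul_inv_gram hw.2, Matrix.mul_one]
  have hfst : z.1 * (z.1ᵀ * w.1) = w.1 := by
    rw [hcol, ← Matrix.mul_assoc z.1ᵀ, hz1, Matrix.one_mul]
  have hsnd : (z.2 * (z.1ᵀ * w.1))ᵀ = w.2ᵀ := by
    rw [Matrix.transpose_mul, Matrix.transpose_mul, Matrix.transpose_transpose, Matrix.mul_assoc,
      ← h, ← Matrix.mul_assoc, hw1, Matrix.one_mul]
  refine ⟨z.1ᵀ * w.1, ?_, Prod.ext hfst.symm (Matrix.transpose_injective hsnd).symm⟩
  rw [Matrix.transpose_mul, Matrix.transpose_transpose, Matrix.mul_assoc, hfst, hw1]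

end FiberAction

section StiefelGeodesics

open NormedSpace (exp)

variable {m p : Type*} [Fintype m] [Fintype p] [DecidableEq p] (M U : Matrix m p ℝ) (t : ℝ)

/-- The generator of the one-parameter group in the closed form of the geodesics of the Stiefel
manifold with initial point `M` and initial velocity `U`. -/
def stiefelGen : Matrix (p ⊕ p) (p ⊕ p) ℝ :=
  Matrix.fromBlocks (Mᵀ * U) (-(Uᵀ * U)) 1 (Mᵀ * U)

/-- The frame `[M U] exp(t B)`, with `B` the generator `stiefelGen M U`. -/
def stiefelFrame : Matrix m (p ⊕ p) ℝ := Matrix.fromCols M U * exp (t • stiefelGen M U)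

/-- The geodesic of the Stiefel manifold with initial point `M` and initial velocity `U`. -/
def stiefelGeod : Matrix m p ℝ := (stiefelFrame M U t).toCols₁ * exp (t • -(Mᵀ * U))

/-- The velocity of `stiefelGeod M U`. -/
def stiefelVel : Matrix m p ℝ := (stiefelFrame M U t).toCols₂ * exp (t • -(Mᵀ * U))

theorem stiefelGeod_zero : stiefelGeod M U 0 = M := by
  simp [stiefelGeod, stiefelFrame]

theorem stiefelVel_zero : stiefelVel M U 0 = U := by
  simp [stiefelVel, stiefelFrame]

theorem contDiff_stiefelGeod : ContDiff ℝ ∞ (stiefelGeod M U) := by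
  have hframe : ContDiff ℝ ∞ (stiefelFrame M U) :=
    contDiff_matrix_mul contDiff_const (contDiff_matrix_exp_smul _)
  have hcols : ContDiff ℝ ∞ fun t => (stiefelFrame M U t).toCols₁ :=
    contDiff_pi.2 fun i => contDiff_pi.2 fun j => contDiff_pi.1 (contDiff_pi.1 hframe i) (.inl j)
  exact contDiff_matrix_mul hcols (contDiff_matrix_exp_smul _)

theorem hasDerivAt_stiefelFrame :
    HasDerivAt (stiefelFrame M U) (stiefelFrame M U t * stiefelGen M U) t := by
  have h := hasDerivAt_matrix_mul (hasDerivAt_const t (Matrix.fromCols M U))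
    (hasDerivAt_matrix_exp_smul (stiefelGen M U) t)
  rw [Matrix.zero_mul, zero_add, ← Matrix.mul_assoc] at h
  exact h

theorem stiefelFrame_mul_stiefelGen :
    stiefelFrame M U t * stiefelGen M U =
      Matrix.fromCols ((stiefelFrame M U t).toCols₁ * (Mᵀ * U) + (stiefelFrame M U t).toCols₂)
        ((stiefelFrame M U t).toCols₂ * (Mᵀ * U) - (stiefelFrame M U t).toCols₁ * (Uᵀ * U)) := by
  conv_lhs => rw [← Matrix.fromCols_toCols (stiefelFrame M U t), stiefelGen,
    Matrix.fromCols_mul_fromBlocks]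
  simp only [Matrix.mul_one, Matrix.mul_neg, neg_add_eq_sub]

theorem hasDerivAt_mul_exp_smul_neg {l : Type*} {F : ℝ → Matrix l p ℝ} {F' : Matrix l p ℝ}
    {t : ℝ} (hF : HasDerivAt F F' t) (A : Matrix p p ℝ) :
    HasDerivAt (fun s => F s * exp (s • -A)) ((F' - F t * A) * exp (t • -A)) t := by
  convert hasDerivAt_matrix_mul hF (hasDerivAt_matrix_exp_smul (-A) t) using 1
  rw [commute_matrix_exp_smul, Matrix.sub_mul, Matrix.neg_mul, Matrix.mul_neg, ← Matrix.mul_assoc,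
    sub_eq_add_neg]

theorem hasDerivAt_stiefelGeod : HasDerivAt (stiefelGeod M U) (stiefelVel M U t) t := by
  have hF := hasDerivAt_stiefelFrame M U t
  rw [stiefelFrame_mul_stiefelGen] at hF
  have hcol := hasDerivAt_matrix_iff.2 fun i j => hasDerivAt_matrix_iff.1 hF i (.inl j)
  refine (hasDerivAt_mul_exp_smul_neg hcol (Mᵀ * U)).congr_deriv ?_
  exact congrArg (· * exp (t • -(Mᵀ * U))) (add_sub_cancel_left _ _)

variable {M U}

theorem stiefelFrame_gram (hM : Mᵀ * M = 1) (hU : Mᵀ * U + Uᵀ * M = 0) :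
    (stiefelFrame M U t)ᵀ * stiefelFrame M U t =
      Matrix.fromBlocks 1 (Mᵀ * U) (Uᵀ * M) (Uᵀ * U) := by
  have hA : Uᵀ * M = -(Mᵀ * U) := eq_neg_of_add_eq_zero_right hU
  have hgram : (Matrix.fromCols M U)ᵀ * Matrix.fromCols M U =
      Matrix.fromBlocks 1 (Mᵀ * U) (Uᵀ * M) (Uᵀ * U) := by
    rw [Matrix.transpose_fromCols, Matrix.fromRows_mul_fromCols, hM]
  have hinv : (stiefelGen M U)ᵀ * Matrix.fromBlocks 1 (Mᵀ * U) (Uᵀ * M) (Uᵀ * U) +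
      Matrix.fromBlocks 1 (Mᵀ * U) (Uᵀ * M) (Uᵀ * U) * stiefelGen M U = 0 := by
    simp only [stiefelGen, Matrix.fromBlocks_transpose, Matrix.fromBlocks_multiply,
      Matrix.fromBlocks_add, Matrix.transpose_mul, Matrix.transpose_transpose,
      Matrix.transpose_neg, Matrix.transpose_one, hA, Matrix.mul_one, Matrix.one_mul,
      Matrix.neg_mul, Matrix.mul_neg]
    rw [← Matrix.fromBlocks_zero]
    congr 1 <;> abel
  rw [← exp_smul_transpose_mul_mul_exp_smul hinv t, ← hgram, stiefelFrame]
  simp only [Matrix.transpose_mul, Matrix.mul_assoc]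

theorem exp_smul_neg_orthogonal (hU : Mᵀ * U + Uᵀ * M = 0) :
    (exp (t • -(Mᵀ * U)))ᵀ * exp (t • -(Mᵀ * U)) = 1 := by
  refine exp_transpose_mul_exp ?_
  rw [Matrix.transpose_smul, Matrix.transpose_neg, Matrix.transpose_mul,
    Matrix.transpose_transpose, eq_neg_of_add_eq_zero_right hU, smul_neg]

theorem stiefelFrame_cols_gram (hM : Mᵀ * M = 1) (hU : Mᵀ * U + Uᵀ * M = 0) :
    (stiefelFrame M U t).toCols₁ᵀ * (stiefelFrame M U t).toCols₁ = 1 ∧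
    (stiefelFrame M U t).toCols₂ᵀ * (stiefelFrame M U t).toCols₁ = Uᵀ * M ∧
    (stiefelFrame M U t).toCols₂ᵀ * (stiefelFrame M U t).toCols₂ = Uᵀ * U := by
  have h := stiefelFrame_gram t hM hU
  rw [← Matrix.fromCols_toCols (stiefelFrame M U t), Matrix.transpose_fromCols,
    Matrix.fromRows_mul_fromCols, Matrix.fromBlocks_inj] at h
  exact ⟨h.1, h.2.2⟩

theorem stiefelGeod_transpose_mul_self (hM : Mᵀ * M = 1) (hU : Mᵀ * U + Uᵀ * M = 0) :
    (stiefelGeod M U t)ᵀ * stiefelGeod M U t = 1 := by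
  have hgram := (stiefelFrame_cols_gram t hM hU).1
  have horth := exp_smul_neg_orthogonal t hU
  rw [stiefelGeod, transpose_mul_mul_mul, hgram, Matrix.mul_one, horth]

theorem stiefelVel_transpose_mul_stiefelGeod (hM : Mᵀ * M = 1) (hU : Mᵀ * U + Uᵀ * M = 0) :
    (stiefelVel M U t)ᵀ * stiefelGeod M U t = Uᵀ * M := by
  have hgram := (stiefelFrame_cols_gram t hM hU).2.1
  have horth := exp_smul_neg_orthogonal t hU
  have hcomm := (commute_matrix_exp_smul (-(Mᵀ * U)) t).eq
  rw [stiefelGeod, stiefelVel, transpose_mul_mul_mul, hgram, eq_neg_of_add_eq_zero_right hU,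
    Matrix.mul_assoc, ← hcomm, ← Matrix.mul_assoc, horth, Matrix.one_mul]

theorem stiefelGeod_mul_stiefelVel_gram (hM : Mᵀ * M = 1) (hU : Mᵀ * U + Uᵀ * M = 0) :
    stiefelGeod M U t * ((stiefelVel M U t)ᵀ * stiefelVel M U t) =
      (stiefelFrame M U t).toCols₁ * (Uᵀ * U) * exp (t • -(Mᵀ * U)) := by
  have hgram := (stiefelFrame_cols_gram t hM hU).2.2
  have horth := mul_eq_one_comm.1 (exp_smul_neg_orthogonal t hU)
  rw [stiefelGeod, stiefelVel, transpose_mul_mul_mul, hgram]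
  simp only [Matrix.mul_assoc]
  rw [← Matrix.mul_assoc (exp _), horth, Matrix.one_mul]

theorem hasDerivAt_stiefelVel (hM : Mᵀ * M = 1) (hU : Mᵀ * U + Uᵀ * M = 0) :
    HasDerivAt (stiefelVel M U)
      (-(stiefelGeod M U t * ((stiefelVel M U t)ᵀ * stiefelVel M U t))) t := by
  have hF := hasDerivAt_stiefelFrame M U t
  rw [stiefelFrame_mul_stiefelGen] at hF
  have hcol := hasDerivAt_matrix_iff.2 fun i j => hasDerivAt_matrix_iff.1 hF i (.inr j)
  rw [stiefelGeod_mul_stiefelVel_gram t hM hU, ← Matrix.neg_mul]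
  refine (hasDerivAt_mul_exp_smul_neg hcol (Mᵀ * U)).congr_deriv ?_
  exact congrArg (· * exp (t • -(Mᵀ * U))) (sub_sub_cancel_left _ _)

end StiefelGeodesics

section TotalGeodesics

variable {m n p : ℕ} (z η : Pair m n p) (t : ℝ)

/-- The geodesic of the total space with initial point `z` and initial velocity `η`. -/
def geod : Pair m n p := (stiefelGeod z.1 η.1 t, z.2 + t • η.2)

theorem geod_zero : geod z η 0 = z := by
  simp [geod, stiefelGeod_zero]

theorem geod_one : geod z η 1 = expTotal z η := by
  have htoCols (X : Matrix (Fin m) (Fin p ⊕ Fin p) ℝ) :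
      X * Matrix.fromRows (1 : Matrix (Fin p) (Fin p) ℝ) (0 : Matrix (Fin p) (Fin p) ℝ) =
        X.toCols₁ := by
    conv_lhs => rw [← Matrix.fromCols_toCols X, Matrix.fromCols_mul_fromRows, Matrix.mul_one,
      Matrix.mul_zero, add_zero]
  simp only [geod, expTotal, stiefelGeod, stiefelFrame, stiefelGen, one_smul, htoCols]

theorem contDiff_geod : ContDiff ℝ ∞ (geod z η) :=
  (contDiff_stiefelGeod z.1 η.1).prodMk (by fun_prop)

theorem hasDerivAt_geod : HasDerivAt (geod z η) (stiefelVel z.1 η.1 t, η.2) t :=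
  (hasDerivAt_stiefelGeod z.1 η.1 t).prodMk
    (by simpa using ((hasDerivAt_id t).smul_const η.2).const_add z.2)

theorem hasDerivAt_geod_zero : HasDerivAt (geod z η) η 0 := by
  simpa only [stiefelVel_zero] using hasDerivAt_geod z η 0

variable {z η t}

theorem geod_mem_iff (hz : z.1ᵀ * z.1 = 1) (hη : z.1ᵀ * η.1 + η.1ᵀ * z.1 = 0) :
    geod z η t ∈ SRp m n p ↔ (z.2 + t • η.2).rank = p :=
  and_iff_right (stiefelGeod_transpose_mul_self t hz hη)

end TotalGeodesics

section Products

variable {E F : Type*} [NormedAddCommGroup E] [NormedSpace ℝ E] [NormedAddCommGroup F]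
  [NormedSpace ℝ F] {c : ℝ → E × F} {v : E × F} {t : ℝ}

theorem hasDerivAt_fst (h : HasDerivAt c v t) : HasDerivAt (fun s => (c s).1) v.1 t :=
  (ContinuousLinearMap.fst ℝ E F).hasFDerivAt.comp_hasDerivAt t h

theorem hasDerivAt_snd (h : HasDerivAt c v t) : HasDerivAt (fun s => (c s).2) v.2 t :=
  (ContinuousLinearMap.snd ℝ E F).hasFDerivAt.comp_hasDerivAt t h

theorem hasDerivAt_add_smul (x v : E) : HasDerivAt (fun t : ℝ => x + t • v) v 0 := by
  simpa using ((hasDerivAt_id (0 : ℝ)).smul_const v).const_add x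

end Products

section TangentSpaces

variable {m n p : ℕ} {z η : Pair m n p} {Ω : Matrix (Fin p) (Fin p) ℝ}

theorem contDiff_proj : ContDiff ℝ ∞ (proj : Pair m n p → _) := by
  unfold proj
  fun_prop

theorem hasDerivAt_proj {c : ℝ → Pair m n p} {v : Pair m n p} {t : ℝ} (h : HasDerivAt c v t) :
    HasDerivAt (fun s => proj (c s)) (dproj (c t) v) t :=
  (contDiff_proj.differentiable (by simp) (c t)).hasFDerivAt.comp_hasDerivAt t h

theorem dproj_eq (z η : Pair m n p) : dproj z η = η.1 * z.2ᵀ + z.1 * η.2ᵀ := by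
  have hline := hasDerivAt_add_smul z η
  have hprod := hasDerivAt_matrix_mul (hasDerivAt_fst hline)
    (hasDerivAt_matrix_transpose (hasDerivAt_snd hline))
  simpa using (hasDerivAt_proj hline).unique hprod

/-- The tangent space to the total space at `z` as a linear subspace. -/
def tangentSpace (z : Pair m n p) : Submodule ℝ (Pair m n p) where
  carrier := {η | z.1ᵀ * η.1 + η.1ᵀ * z.1 = 0}
  add_mem' {η ζ} hη hζ := by
    simpa [Matrix.mul_add, Matrix.add_mul, add_add_add_comm] using congrArg₂ (· + ·) hη hζ
  zero_mem' := by simp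
  smul_mem' a η hη := by simpa [← smul_add] using congrArg (a • ·) hη

theorem mem_tangentSpace : η ∈ tangentSpace z ↔ z.1ᵀ * η.1 + η.1ᵀ * z.1 = 0 := Iff.rfl

theorem transpose_mul_self_skew (hη : η ∈ tangentSpace z) : (z.1ᵀ * η.1)ᵀ = -(z.1ᵀ * η.1) := by
  rw [Matrix.transpose_mul, Matrix.transpose_transpose]
  exact eq_neg_of_add_eq_zero_right hη

theorem deriv_mem_tangentSpace {c : ℝ → Pair m n p} {v : Pair m n p} {t : ℝ}
    (hd : HasDerivAt c v t) (hS : ∀ᶠ s in 𝓝 t, c s ∈ SRp m n p) : v ∈ tangentSpace (c t) := by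
  have hgram : HasDerivAt (fun s => (c s).1ᵀ * (c s).1) 0 t :=
    (hasDerivAt_const t (1 : Matrix (Fin p) (Fin p) ℝ)).congr_of_eventuallyEq
      (hS.mono fun s hs => hs.1)
  rw [mem_tangentSpace, add_comm]
  exact (hasDerivAt_matrix_mul (hasDerivAt_matrix_transpose (hasDerivAt_fst hd))
    (hasDerivAt_fst hd)).unique hgram

theorem eventually_geod_mem (hz : z ∈ SRp m n p) (hη : η ∈ tangentSpace z) :
    ∀ᶠ t in 𝓝 (0 : ℝ), geod z η t ∈ SRp m n p := by
  have hcont : ContinuousAt (fun t : ℝ => z.2 + t • η.2) 0 := by fun_prop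
  have hrank := hcont.eventually (isOpen_setOf_rank_eq.mem_nhds (by simpa using hz.2))
  exact hrank.mono fun t ht => (geod_mem_iff hz.1 hη).2 ht

theorem mem_tangent_SRp_iff (hz : z ∈ SRp m n p) :
    η ∈ tangent (SRp m n p) z ↔ η ∈ tangentSpace z := by
  constructor
  · intro h
    obtain ⟨c, rfl, hd, hS, -⟩ := exists_curve_of_mem_tangent h
    exact deriv_mem_tangentSpace hd hS
  · intro h
    simpa only [geod_zero] using mem_tangent_of_curve (hasDerivAt_geod_zero z η)
      (eventually_geod_mem hz h) (.of_forall fun t => (contDiff_geod z η).contDiffAt)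

theorem exists_act_of_dproj_eq_zero (hz : z ∈ SRp m n p) (hη : η ∈ tangentSpace z)
    (hp : dproj z η = 0) : ∃ Ω : Matrix (Fin p) (Fin p) ℝ, Ωᵀ = -Ω ∧ η = act z Ω := by
  have hz1 : z.1ᵀ * z.1 = 1 := hz.1
  have hskew := transpose_mul_self_skew hη
  rw [dproj_eq] at hp
  have hsnd : η.2 = z.2 * (z.1ᵀ * η.1) := by
    have h := congrArg (z.1ᵀ * ·) hp
    simp only [Matrix.mul_add, Matrix.mul_zero, ← Matrix.mul_assoc, hz1, Matrix.one_mul] at h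
    have h' := congrArg Matrix.transpose (eq_neg_of_add_eq_zero_right h)
    rwa [Matrix.transpose_transpose, Matrix.transpose_neg, Matrix.transpose_mul,
      Matrix.transpose_transpose, hskew, Matrix.mul_neg, neg_neg] at h'
  have hfst : (η.1 - z.1 * (z.1ᵀ * η.1)) * z.2ᵀ = 0 := by
    rwa [hsnd, Matrix.transpose_mul, hskew, Matrix.neg_mul, Matrix.mul_neg, ← Matrix.mul_assoc,
      ← sub_eq_add_neg, ← Matrix.sub_mul] at hp
  have hcancel : η.1 - z.1 * (z.1ᵀ * η.1) = 0 := by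
    rw [← Matrix.mul_one (η.1 - _), ← gram_mul_inv_gram hz.2, ← Matrix.mul_assoc,
      ← Matrix.mul_assoc, hfst, Matrix.zero_mul, Matrix.zero_mul]
  exact ⟨z.1ᵀ * η.1, hskew, Prod.ext (sub_eq_zero.1 hcancel) hsnd⟩

theorem act_mem_vertical (hz : z ∈ SRp m n p) (hΩ : Ωᵀ = -Ω) : act z Ω ∈ vertical z := by
  have hd : HasDerivAt (fun t : ℝ => act z (NormedSpace.exp (t • Ω))) (act z Ω) 0 := by
    have h := hasDerivAt_matrix_exp_smul Ω 0
    exact ((hasDerivAt_matrix_mul (hasDerivAt_const 0 z.1) h).prodMk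
      (hasDerivAt_matrix_mul (hasDerivAt_const 0 z.2) h)).congr_deriv (by simp [act])
  have hc : ContDiff ℝ ∞ (fun t : ℝ => act z (NormedSpace.exp (t • Ω))) := by
    have := contDiff_matrix_exp_smul Ω (r := ∞)
    unfold act
    fun_prop
  have ho (t : ℝ) : (NormedSpace.exp (t • Ω))ᵀ * NormedSpace.exp (t • Ω) = 1 :=
    exp_transpose_mul_exp (by rw [Matrix.transpose_smul, hΩ, smul_neg])
  have := mem_tangent_of_curve (S := {w | w ∈ SRp m n p ∧ proj w = proj z}) hd
    (.of_forall fun t => ⟨act_mem hz (ho t), proj_act z (ho t)⟩)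
    (.of_forall fun t => hc.contDiffAt)
  simpa [vertical, act] using this

theorem mem_vertical_iff (hz : z ∈ SRp m n p) :
    η ∈ vertical z ↔ ∃ Ω : Matrix (Fin p) (Fin p) ℝ, Ωᵀ = -Ω ∧ η = act z Ω := by
  refine ⟨fun h => ?_, fun ⟨Ω, hΩ, hη⟩ => hη ▸ act_mem_vertical hz hΩ⟩
  obtain ⟨c, h0, hd, hS, -⟩ := exists_curve_of_mem_tangent h
  have ht := deriv_mem_tangentSpace hd (hS.mono fun _ h => h.1)
  have hp := (hasDerivAt_proj hd).unique
    ((hasDerivAt_const (0 : ℝ) (proj z)).congr_of_eventuallyEq (hS.mono fun _ h => h.2))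
  rw [h0] at ht hp
  exact exists_act_of_dproj_eq_zero hz ht hp

/-- The momentum map of the right action of the orthogonal group: it represents the functional
`Ω ↦ gBar z η (act z Ω)` through the trace, so that `η` is orthogonal to the fiber if and only if
its momentum is symmetric. -/
def momentum (z : Pair m n p) : Pair m n p →ₗ[ℝ] Matrix (Fin p) (Fin p) ℝ where
  toFun η := η.1ᵀ * z.1 + η.2ᵀ * z.2
  map_add' η ζ := by simp [Matrix.add_mul, add_add_add_comm]
  map_smul' a η := by simp [smul_add]

theorem momentum_apply (z η : Pair m n p) : momentum z η = η.1ᵀ * z.1 + η.2ᵀ * z.2 := rfl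

theorem gBar_act (z η : Pair m n p) (Ω : Matrix (Fin p) (Fin p) ℝ) :
    gBar z η (act z Ω) = (momentum z η * Ω).trace := by
  simp [gBar, act, momentum, Matrix.add_mul, Matrix.mul_assoc]

/-- The horizontal space at `z` as a linear subspace. -/
def horizontalSpace (z : Pair m n p) : Submodule ℝ (Pair m n p) where
  carrier := {η | η ∈ tangentSpace z ∧ (momentum z η)ᵀ = momentum z η}
  add_mem' hη hζ := ⟨add_mem hη.1 hζ.1, by rw [map_add, Matrix.transpose_add, hη.2, hζ.2]⟩
  zero_mem' := ⟨zero_mem _, by simp⟩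
  smul_mem' a _ hη := ⟨Submodule.smul_mem _ a hη.1, by
    rw [map_smul, Matrix.transpose_smul, hη.2]⟩

theorem mem_horizontalSpace :
    η ∈ horizontalSpace z ↔ η ∈ tangentSpace z ∧ (momentum z η)ᵀ = momentum z η := Iff.rfl

theorem transpose_eq_self_iff_trace_mul_skew_eq_zero {q : Type*} [Fintype q] {C : Matrix q q ℝ} :
    Cᵀ = C ↔ ∀ Ω : Matrix q q ℝ, Ωᵀ = -Ω → (C * Ω).trace = 0 := by
  refine ⟨fun hC Ω hΩ => trace_mul_eq_zero_of_symm_of_skew hC hΩ, fun h => ?_⟩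
  have hskew : (C - Cᵀ)ᵀ = -(C - Cᵀ) := by simp
  have hsymm : (C + Cᵀ)ᵀ = C + Cᵀ := by simp [add_comm]
  have hC := h _ hskew
  have hsum := trace_mul_eq_zero_of_symm_of_skew hsymm hskew
  rw [Matrix.add_mul, Matrix.trace_add, hC, zero_add] at hsum
  have hnorm : ((C - Cᵀ)ᵀ * (C - Cᵀ)).trace = 0 := by
    rw [Matrix.transpose_sub, Matrix.transpose_transpose, Matrix.sub_mul, Matrix.trace_sub, hC,
      hsum, sub_zero]
  exact (sub_eq_zero.1 (trace_transpose_mul_self_eq_zero_iff.1 hnorm)).symm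

theorem mem_horizontal_iff (hz : z ∈ SRp m n p) : η ∈ horizontal z ↔ η ∈ horizontalSpace z := by
  rw [horizontal, Set.mem_ofPred_eq, mem_tangent_SRp_iff hz, mem_horizontalSpace,
    transpose_eq_self_iff_trace_mul_skew_eq_zero]
  refine and_congr_right fun _ => ⟨fun h Ω hΩ => ?_, fun h v hv => ?_⟩
  · rw [← gBar_act]
    exact h _ (act_mem_vertical hz hΩ)
  · obtain ⟨Ω, hΩ, rfl⟩ := (mem_vertical_iff hz).1 hv
    rw [gBar_act, h Ω hΩ]

end TangentSpaces

section Orthonormalization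

-- Analyticity rather than smoothness is assumed because it is, unlike the latter, an open
-- condition.
theorem exists_local_inverse_of_hasDerivAt_smul {E : Type*} [NormedAddCommGroup E]
    [NormedSpace ℝ E] [CompleteSpace E] {q : E → E} {e : E} {a : ℝ} (ha : a ≠ 0)
    (hq : ContDiffAt ℝ ω q e) (hd : ∀ v, HasDerivAt (fun t : ℝ => q (e + t • v)) (a • v) 0) :
    ∃ R : E → E, R (q e) = e ∧ (∀ᶠ y in 𝓝 (q e), ContDiffAt ℝ ω R y ∧ q (R y) = y) ∧
      ∀ᶠ x in 𝓝 e, R (q x) = x := by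
  let f' : E ≃L[ℝ] E := ContinuousLinearEquiv.smulLeft (Units.mk0 a ha)
  have hf : HasFDerivAt q (f' : E →L[ℝ] E) e := by
    refine (hq.differentiableAt (by simp)).hasFDerivAt.congr_fderiv ?_
    ext v
    exact ((hq.differentiableAt (by simp)).hasFDerivAt.comp_hasDerivAt_of_eq (0 : ℝ)
      (hasDerivAt_add_smul e v) (by simp)).unique (hd v)
  have hs := hq.hasStrictFDerivAt' hf (by simp)
  exact ⟨hs.localInverse, hs.localInverse_apply_image,
    ((hq.to_localInverse hf (by simp)).eventually (by simp)).and hs.eventually_right_inverse,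
    hs.eventually_left_inverse⟩

variable {m p : Type*} [Fintype m] [Fintype p] [DecidableEq p]

theorem exists_matrix_sqrt : ∃ R : Matrix p p ℝ → Matrix p p ℝ,
    R 1 = 1 ∧ (∀ᶠ G in 𝓝 1, ContDiffAt ℝ ω R G ∧ R G * R G = G) ∧
      ∀ᶠ A in 𝓝 1, R (A * A) = A := by
  have : CompleteSpace (Matrix p p ℝ) := FiniteDimensional.complete ℝ _
  have hq : ContDiff ℝ ω (fun A : Matrix p p ℝ => A * A) := by fun_prop
  have hd (v : Matrix p p ℝ) :
      HasDerivAt (fun t : ℝ => (1 + t • v) * (1 + t • v)) ((2 : ℝ) • v) 0 :=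
    (hasDerivAt_matrix_mul (hasDerivAt_add_smul 1 v) (hasDerivAt_add_smul 1 v)).congr_deriv
      (by simp [two_smul])
  obtain ⟨R, hR1, hR, hinv⟩ := exists_local_inverse_of_hasDerivAt_smul two_ne_zero hq.contDiffAt hd
  rw [Matrix.mul_one] at hR1 hR
  exact ⟨R, hR1, hR, hinv⟩

theorem exists_smooth_inv_sqrt : ∃ T : Matrix p p ℝ → Matrix p p ℝ, T 1 = 1 ∧
    ∀ᶠ G in 𝓝 1, ContDiffAt ℝ ω T G ∧ (Gᵀ = G → (T G)ᵀ * G * T G = 1) := by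
  obtain ⟨R, hR1, hR, hinv⟩ := exists_matrix_sqrt (p := p)
  have hcont : Filter.Tendsto R (𝓝 1) (𝓝 1) := by
    conv_rhs => rw [← hR1]
    exact hR.self_of_nhds.1.continuousAt
  have htr : Filter.Tendsto (fun A : Matrix p p ℝ => Aᵀ) (𝓝 1) (𝓝 1) := by
    simpa using (Continuous.matrix_transpose continuous_id).tendsto (1 : Matrix p p ℝ)
  have hdet : ∀ᶠ A in 𝓝 (1 : Matrix p p ℝ), A.det ≠ 0 :=
    (Continuous.matrix_det continuous_id).continuousAt.eventually_ne (by simp)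
  refine ⟨fun G => (R G)⁻¹, by simp [hR1], ?_⟩
  filter_upwards [hR, hcont.eventually hdet, hcont.eventually (htr.eventually hinv)]
    with G ⟨hsmooth, hsq⟩ hG hleft
  have hunit : IsUnit (R G).det := isUnit_iff_ne_zero.2 hG
  refine ⟨contDiffWithinAt_matrix_inv hsmooth hunit, fun hsymm => ?_⟩
  have hRsymm : (R G)ᵀ = R G := by
    rw [← Matrix.transpose_mul, hsq, hsymm] at hleft
    exact hleft.symm
  rw [Matrix.transpose_nonsing_inv, hRsymm]
  nth_rw 2 [← hsq]
  rw [Matrix.mul_assoc, Matrix.mul_nonsing_inv_cancel_right _ _ hunit,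
    Matrix.nonsing_inv_mul _ hunit]

-- The polar factor `M (MᵀM)^(-1/2)` of a matrix of full column rank.
theorem exists_orthonormalization {M₀ : Matrix m p ℝ} (h₀ : M₀ᵀ * M₀ = 1) :
    ∃ O : Matrix m p ℝ → Matrix m p ℝ,
      (∀ᶠ M in 𝓝 M₀, ContDiffAt ℝ ω O M ∧ (O M)ᵀ * O M = 1) ∧
        (∀ M, ∃ B : Matrix p p ℝ, O M = M * B) ∧ ∀ M, Mᵀ * M = 1 → O M = M := by
  obtain ⟨T, hT1, hT⟩ := exists_smooth_inv_sqrt (p := p)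
  have hgram : ContDiff ℝ ω fun M : Matrix m p ℝ => Mᵀ * M := by fun_prop
  refine ⟨fun M => M * T (Mᵀ * M), ?_, fun M => ⟨_, rfl⟩, fun M hM => by simp [hM, hT1]⟩
  have hlim : Filter.Tendsto (fun M : Matrix m p ℝ => Mᵀ * M) (𝓝 M₀) (𝓝 1) :=
    h₀ ▸ hgram.continuous.continuousAt
  filter_upwards [hlim.eventually hT] with M ⟨hsmooth, horth⟩
  refine ⟨contDiffAt_matrix_mul contDiffAt_id ?_,
    (transpose_mul_mul_mul _ _ _ _).trans (horth (by simp))⟩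
  exact ContDiffAt.comp (f := fun M : Matrix m p ℝ => Mᵀ * M) M hsmooth hgram.contDiffAt

end Orthonormalization

section LocalSections

variable {m n p : ℕ} {z : Pair m n p}

theorem exists_retraction (hz : z ∈ SRp m n p) :
    ∃ ρ : Pair m n p → Pair m n p,
      (∀ᶠ w in 𝓝 z, ContDiffAt ℝ ∞ ρ w ∧ ρ w ∈ SRp m n p) ∧ ∀ w ∈ SRp m n p, ρ w = w := by
  obtain ⟨O, hO, -, hid⟩ := exists_orthonormalization hz.1
  refine ⟨fun w => (O w.1, w.2), ?_, fun w hw => Prod.ext (hid _ hw.1) rfl⟩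
  filter_upwards [continuous_fst.continuousAt.eventually hO,
    continuous_snd.continuousAt.eventually (isOpen_setOf_rank_eq.mem_nhds hz.2)] with w h1 h2
  exact ⟨((h1.1.of_le le_top).comp w contDiffAt_fst).prodMk contDiffAt_snd, h1.2, h2⟩

theorem orthonormal_mul_transpose_mul_of_eq_mul {X : Matrix (Fin m) (Fin n) ℝ}
    {M : Matrix (Fin m) (Fin p) ℝ} {B : Matrix (Fin n) (Fin p) ℝ} (hX : X ∈ Mp m n p)
    (hM : Mᵀ * M = 1) (hMX : M = X * B) : M * (Mᵀ * X) = X := by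
  obtain ⟨w, hw, rfl⟩ := exists_proj_eq hX
  obtain ⟨C, hC⟩ : ∃ C, M = w.1 * C := ⟨w.2ᵀ * B, by rw [hMX, proj, Matrix.mul_assoc]⟩
  have horth : Cᵀ * C = 1 := by
    rwa [hC, transpose_mul_mul_mul, hw.1, Matrix.mul_one] at hM
  rw [← Matrix.mul_assoc, hC, mul_mul_transpose_mul_of_orthogonal horth, proj, Matrix.mul_assoc,
    ← Matrix.mul_assoc w.1ᵀ, hw.1, Matrix.one_mul]

theorem exists_section (hz : z ∈ SRp m n p) :
    ∃ σ : Matrix (Fin m) (Fin n) ℝ → Pair m n p, σ (proj z) = z ∧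
      ∀ᶠ X in 𝓝 (proj z), ContDiffAt ℝ ∞ σ X ∧
        (X ∈ Mp m n p → σ X ∈ SRp m n p ∧ proj (σ X) = X) := by
  obtain ⟨O, hO, hcol, hid⟩ := exists_orthonormalization hz.1
  obtain ⟨B, hB⟩ : ∃ B, proj z * B = z.1 := ⟨z.2 * (z.2ᵀ * z.2)⁻¹, by
    rw [proj, Matrix.mul_assoc, ← Matrix.mul_assoc z.2ᵀ, gram_mul_inv_gram hz.2, Matrix.mul_one]⟩
  have hsmooth : ContDiff ℝ ∞ fun X : Matrix (Fin m) (Fin n) ℝ => X * B := by fun_prop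
  refine ⟨fun X => (O (X * B), Xᵀ * O (X * B)), ?_, ?_⟩
  · refine Prod.ext (by simp only [hB, hid _ hz.1]) ?_
    simp only [hB, hid _ hz.1]
    rw [proj, Matrix.transpose_mul, Matrix.transpose_transpose, Matrix.mul_assoc, hz.1,
      Matrix.mul_one]
  · rw [← hB] at hO
    filter_upwards [hsmooth.continuous.continuousAt.eventually hO] with X ⟨hOX, horth⟩
    refine ⟨?_, fun hX => orthonormalFactor_mem hX horth ?_⟩
    · have hfst := (hOX.of_le le_top).comp X hsmooth.contDiffAt
      exact hfst.prodMk (contDiffAt_matrix_mul (contDiffAt_matrix_transpose contDiffAt_id) hfst)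
    · obtain ⟨C, hC⟩ := hcol (X * B)
      exact orthonormal_mul_transpose_mul_of_eq_mul hX horth (hC.trans (Matrix.mul_assoc _ _ _))

variable {F : Type*} [NormedAddCommGroup F] [NormedSpace ℝ F]

theorem contDiffOn_Mp_of_comp_proj {h : Matrix (Fin m) (Fin n) ℝ → F}
    (hh : ContDiffOn ℝ ∞ (fun z : Pair m n p => h (proj z)) (SRp m n p)) :
    ContDiffOn ℝ ∞ h (Mp m n p) := by
  intro X hX
  obtain ⟨z, hz, rfl⟩ := exists_proj_eq hX
  obtain ⟨σ, hσz, hσ⟩ := exists_section hz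
  have hev : ∀ᶠ Y in 𝓝[Mp m n p] (proj z), σ Y ∈ SRp m n p ∧ proj (σ Y) = Y := by
    filter_upwards [self_mem_nhdsWithin, nhdsWithin_le_nhds hσ] with Y hY hσY using hσY.2 hY
  have hmaps : Filter.Tendsto σ (𝓝[Mp m n p] (proj z)) (𝓝[SRp m n p] (σ (proj z))) :=
    tendsto_nhdsWithin_iff.2 ⟨hσ.self_of_nhds.1.continuousAt.continuousWithinAt,
      hev.mono fun _ h => h.1⟩
  have hcomp := ContDiffWithinAt.comp_of_preimage_mem_nhdsWithin (g := fun z => h (proj z))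
    (proj z) (hh _ (by rwa [hσz])) hσ.self_of_nhds.1.contDiffWithinAt
    (hmaps self_mem_nhdsWithin)
  exact hcomp.congr_of_eventuallyEq (hev.mono fun Y hY => by simp [hY.2]) (by simp [hσz])

theorem contDiffOn_comp_proj {h : Matrix (Fin m) (Fin n) ℝ → F} (hh : ContDiffOn ℝ ∞ h (Mp m n p)) :
    ContDiffOn ℝ ∞ (fun z : Pair m n p => h (proj z)) (SRp m n p) :=
  hh.comp contDiff_proj.contDiffOn fun _ hz => proj_mem hz

theorem dproj_mem_tangent (hz : z ∈ SRp m n p) {η : Pair m n p} (hη : η ∈ tangentSpace z) :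
    dproj z η ∈ tangent (Mp m n p) (proj z) := by
  obtain ⟨c, ε, hε, hc, hS, rfl, hd⟩ := (mem_tangent_SRp_iff hz).2 hη
  exact ⟨fun t => proj (c t), ε, hε, contDiff_proj.comp_contDiffOn hc,
    fun t ht => proj_mem (hS t ht), rfl, hasDerivAt_proj hd⟩

theorem exists_dproj_eq (hz : z ∈ SRp m n p) {ξ : Matrix (Fin m) (Fin n) ℝ}
    (hξ : ξ ∈ tangent (Mp m n p) (proj z)) : ∃ η ∈ tangentSpace z, dproj z η = ξ := by
  obtain ⟨c, ε, hε, -, hS, h0, hd⟩ := hξ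
  obtain ⟨σ, hσz, hσ⟩ := exists_section hz
  rw [← h0] at hσ
  have hev : ∀ᶠ t in 𝓝 0, σ (c t) ∈ SRp m n p ∧ proj (σ (c t)) = c t := by
    filter_upwards [hd.continuousAt.eventually hσ, Ioo_mem_nhds (neg_lt_zero.2 hε) hε]
      with t hσt ht using hσt.2 (hS t ht)
  have hσc := (hσ.self_of_nhds.1.differentiableAt (by simp)).hasFDerivAt.comp_hasDerivAt 0 hd
  have hσc0 : (σ ∘ c) 0 = z := by simp [h0, hσz]
  refine ⟨_, hσc0 ▸ deriv_mem_tangentSpace hσc (hev.mono fun _ h => h.1), ?_⟩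
  rw [← hσc0]
  exact (hasDerivAt_proj hσc).unique (hd.congr_of_eventuallyEq (hev.mono fun _ h => h.2))

end LocalSections

section HorizontalProjection

variable {m n p : ℕ} {z η ζ : Pair m n p} {Q : Matrix (Fin p) (Fin p) ℝ}

theorem gBar_comm (z η ζ : Pair m n p) : gBar z η ζ = gBar z ζ η := by
  rw [gBar, ← Matrix.trace_transpose]
  simp [gBar]

theorem gBar_add_left (z η ζ χ : Pair m n p) : gBar z (η + ζ) χ = gBar z η χ + gBar z ζ χ := by
  simp [gBar, Matrix.add_mul, add_add_add_comm]

theorem gBar_smul_left (z : Pair m n p) (a : ℝ) (η χ : Pair m n p) :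
    gBar z (a • η) χ = a * gBar z η χ := by
  simp [gBar, mul_add]

theorem gBar_sub_left (z η ζ χ : Pair m n p) : gBar z (η - ζ) χ = gBar z η χ - gBar z ζ χ := by
  rw [eq_sub_iff_add_eq, ← gBar_add_left, sub_add_cancel]

theorem gBar_self_pos (z : Pair m n p) (h : η ≠ 0) : 0 < gBar z η η := by
  have h₁ := trace_transpose_mul_self_nonneg η.1
  have h₂ := trace_transpose_mul_self_nonneg η.2
  rw [gBar, Matrix.trace_add]
  refine lt_of_le_of_ne (add_nonneg h₁ h₂) fun h0 => h (Prod.ext ?_ ?_)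
  · exact trace_transpose_mul_self_eq_zero_iff.1 (by linarith)
  · exact trace_transpose_mul_self_eq_zero_iff.1 (by linarith)

theorem gBar_act_act (z w η ζ : Pair m n p) (hQ : Qᵀ * Q = 1) :
    gBar w (act η Q) (act ζ Q) = gBar z η ζ := by
  rw [gBar, act, act, transpose_mul_mul_mul, transpose_mul_mul_mul, ← Matrix.add_mul,
    ← Matrix.mul_add, Matrix.trace_mul_comm, ← Matrix.mul_assoc, mul_eq_one_comm.1 hQ,
    Matrix.one_mul, gBar]

theorem dproj_add (z η ζ : Pair m n p) : dproj z (η + ζ) = dproj z η + dproj z ζ := map_add _ _ _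

theorem dproj_sub (z η ζ : Pair m n p) : dproj z (η - ζ) = dproj z η - dproj z ζ := map_sub _ _ _

theorem dproj_smul (z : Pair m n p) (a : ℝ) (η : Pair m n p) :
    dproj z (a • η) = a • dproj z η := map_smul _ _ _

theorem dproj_act_act (z η : Pair m n p) (hQ : Qᵀ * Q = 1) :
    dproj (act z Q) (act η Q) = dproj z η := by
  simp only [dproj_eq, act, mul_mul_transpose_mul_of_orthogonal hQ]

theorem dproj_vertical (hz : z ∈ SRp m n p) (h : η ∈ vertical z) : dproj z η = 0 := by
  obtain ⟨Ω, hΩ, rfl⟩ := (mem_vertical_iff hz).1 h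
  simp [dproj_eq, act, Matrix.transpose_mul, hΩ, Matrix.mul_assoc]

theorem vertical_of_dproj (hz : z ∈ SRp m n p) (hη : η ∈ tangentSpace z) (h : dproj z η = 0) :
    η ∈ vertical z :=
  (mem_vertical_iff hz).2 (exists_act_of_dproj_eq_zero hz hη h)

theorem vertical_subset_tangentSpace (hη : η ∈ vertical z) : η ∈ tangentSpace z := by
  obtain ⟨c, rfl, hd, hS, -⟩ := exists_curve_of_mem_tangent hη
  exact deriv_mem_tangentSpace hd (hS.mono fun _ h => h.1)

theorem gBar_horizontal_vertical (hz : z ∈ SRp m n p) (hη : η ∈ horizontalSpace z)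
    (hζ : ζ ∈ vertical z) : gBar z η ζ = 0 :=
  ((mem_horizontal_iff hz).2 hη).2 ζ hζ

theorem eq_zero_of_horizontal_of_vertical (hz : z ∈ SRp m n p) (hη : η ∈ horizontalSpace z)
    (hv : η ∈ vertical z) : η = 0 := by
  by_contra h
  exact (gBar_self_pos z h).ne' (gBar_horizontal_vertical hz hη hv)

theorem horizontal_ext (hz : z ∈ SRp m n p) (hη : η ∈ horizontalSpace z)
    (hζ : ζ ∈ horizontalSpace z) (h : dproj z η = dproj z ζ) : η = ζ := by
  have hsub := sub_mem hη hζ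
  exact sub_eq_zero.1 (eq_zero_of_horizontal_of_vertical hz hsub
    (vertical_of_dproj hz hsub.1 (by rw [dproj_sub, h, sub_self])))

theorem posDef_gram_add_one (N : Matrix (Fin n) (Fin p) ℝ) : (Nᵀ * N + 1).PosDef := by
  simpa using
    Matrix.PosDef.posSemidef_add (Matrix.posSemidef_conjTranspose_mul_self N) Matrix.PosDef.one

/-- The skew-symmetric matrix `Ω` for which `act z (-Ω)` is the vertical part of `η`. -/
def omegaOf (z η : Pair m n p) : Matrix (Fin p) (Fin p) ℝ :=
  sylvester (z.2ᵀ * z.2 + 1) (momentum z η - (momentum z η)ᵀ)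

/-- The horizontal part `η + act z Ω` of a tangent vector `η` to the total space at `z`. -/
def horPart (z η : Pair m n p) : Pair m n p := η + act z (omegaOf z η)

theorem omegaOf_skew (z η : Pair m n p) : (omegaOf z η)ᵀ = -omegaOf z η := by
  rw [omegaOf, transpose_sylvester (posDef_gram_add_one _), ← sylvester_neg, Matrix.transpose_sub,
    Matrix.transpose_transpose, neg_sub]

theorem momentum_act (hz : z.1ᵀ * z.1 = 1) (Ω : Matrix (Fin p) (Fin p) ℝ) :
    momentum z (act z Ω) = Ωᵀ * (z.2ᵀ * z.2 + 1) := by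
  simp only [momentum_apply, act, Matrix.transpose_mul, Matrix.mul_assoc, hz, Matrix.mul_add]
  exact add_comm _ _

theorem horPart_mem (hz : z ∈ SRp m n p) (hη : η ∈ tangentSpace z) :
    horPart z η ∈ horizontalSpace z := by
  have hskew := omegaOf_skew z η
  have hG : (z.2ᵀ * z.2 + 1)ᵀ = z.2ᵀ * z.2 + 1 := by simp
  have hsylv := sylvester_spec (posDef_gram_add_one z.2) (momentum z η - (momentum z η)ᵀ)
  refine ⟨add_mem hη (vertical_subset_tangentSpace (act_mem_vertical hz hskew)), ?_⟩
  rw [horPart, map_add, momentum_act hz.1, Matrix.transpose_add, Matrix.transpose_mul, hG,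
    Matrix.transpose_transpose, hskew, Matrix.neg_mul, ← sub_eq_add_neg, eq_sub_iff_add_eq,
    add_assoc, omegaOf, hsylv, add_sub_cancel]

theorem sub_horPart_mem (hz : z ∈ SRp m n p) (η : Pair m n p) : η - horPart z η ∈ vertical z := by
  rw [horPart, sub_add_cancel_left, ← act_neg]
  exact act_mem_vertical hz (by rw [Matrix.transpose_neg, omegaOf_skew])

theorem hproj_eq_of_mem (hz : z ∈ SRp m n p) (hζ : ζ ∈ horizontalSpace z)
    (hv : η - ζ ∈ vertical z) : hproj z η = ζ := by
  have h := Classical.epsilon_spec (p := fun h => h ∈ horizontal z ∧ η - h ∈ vertical z)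
    ⟨ζ, (mem_horizontal_iff hz).2 hζ, hv⟩
  have hdproj := (dproj_vertical hz h.2).trans (dproj_vertical hz hv).symm
  rw [dproj_sub, dproj_sub, sub_right_inj] at hdproj
  exact horizontal_ext hz ((mem_horizontal_iff hz).1 h.1) hζ hdproj

theorem hproj_eq (hz : z ∈ SRp m n p) (hη : η ∈ tangentSpace z) : hproj z η = horPart z η :=
  hproj_eq_of_mem hz (horPart_mem hz hη) (sub_horPart_mem hz η)

theorem hproj_mem (hz : z ∈ SRp m n p) (hη : η ∈ tangentSpace z) : hproj z η ∈ horizontalSpace z :=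
  hproj_eq hz hη ▸ horPart_mem hz hη

theorem sub_hproj_mem (hz : z ∈ SRp m n p) (hη : η ∈ tangentSpace z) :
    η - hproj z η ∈ vertical z :=
  hproj_eq hz hη ▸ sub_horPart_mem hz η

theorem dproj_hproj (hz : z ∈ SRp m n p) (hη : η ∈ tangentSpace z) :
    dproj z (hproj z η) = dproj z η := by
  have := dproj_vertical hz (sub_hproj_mem hz hη)
  rw [dproj_sub, sub_eq_zero] at this
  exact this.symm

theorem gBar_hproj (hz : z ∈ SRp m n p) (hη : η ∈ tangentSpace z) (hζ : ζ ∈ horizontalSpace z) :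
    gBar z (hproj z η) ζ = gBar z η ζ := by
  have := gBar_horizontal_vertical hz hζ (sub_hproj_mem hz hη)
  rw [gBar_comm, gBar_sub_left, sub_eq_zero] at this
  exact this.symm

theorem mem_tangent_Mp_iff (hz : z ∈ SRp m n p) {ξ : Matrix (Fin m) (Fin n) ℝ} :
    ξ ∈ tangent (Mp m n p) (proj z) ↔ ∃ η ∈ horizontalSpace z, dproj z η = ξ := by
  refine ⟨fun hξ => ?_, fun ⟨η, hη, h⟩ => h ▸ dproj_mem_tangent hz hη.1⟩
  obtain ⟨η, hη, rfl⟩ := exists_dproj_eq hz hξ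
  exact ⟨hproj z η, hproj_mem hz hη, dproj_hproj hz hη⟩

end HorizontalProjection

section HorizontalLifts

variable {m n p : ℕ} {z η : Pair m n p} {ξ ξ' : Matrix (Fin m) (Fin n) ℝ}
  {Q : Matrix (Fin p) (Fin p) ℝ}

theorem lift_spec (hz : z ∈ SRp m n p) (hξ : ξ ∈ tangent (Mp m n p) (proj z)) :
    lift z ξ ∈ horizontalSpace z ∧ dproj z (lift z ξ) = ξ := by
  obtain ⟨η, hη, h⟩ := (mem_tangent_Mp_iff hz).1 hξ
  have hspec := Classical.epsilon_spec (p := fun η => η ∈ horizontal z ∧ dproj z η = ξ)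
    ⟨η, (mem_horizontal_iff hz).2 hη, h⟩
  exact hspec.imp_left (mem_horizontal_iff hz).1

theorem lift_mem (hz : z ∈ SRp m n p) (hξ : ξ ∈ tangent (Mp m n p) (proj z)) :
    lift z ξ ∈ horizontalSpace z := (lift_spec hz hξ).1

theorem dproj_lift (hz : z ∈ SRp m n p) (hξ : ξ ∈ tangent (Mp m n p) (proj z)) :
    dproj z (lift z ξ) = ξ := (lift_spec hz hξ).2

theorem lift_eq_of_mem (hz : z ∈ SRp m n p) (hη : η ∈ horizontalSpace z) (h : dproj z η = ξ) :
    lift z ξ = η := by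
  have hξ := (mem_tangent_Mp_iff hz).2 ⟨η, hη, h⟩
  exact horizontal_ext hz (lift_mem hz hξ) hη ((dproj_lift hz hξ).trans h.symm)

theorem lift_dproj (hz : z ∈ SRp m n p) (hη : η ∈ tangentSpace z) :
    lift z (dproj z η) = hproj z η :=
  lift_eq_of_mem hz (hproj_mem hz hη) (dproj_hproj hz hη)

theorem act_mem_horizontalSpace (hη : η ∈ horizontalSpace z) :
    act η Q ∈ horizontalSpace (act z Q) := by
  have htan := mem_tangentSpace.1 hη.1
  have hmom : momentum (act z Q) (act η Q) = Qᵀ * momentum z η * Q := by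
    simp only [momentum_apply, act, transpose_mul_mul_mul, ← Matrix.add_mul, ← Matrix.mul_add]
  refine ⟨?_, ?_⟩
  · simp only [mem_tangentSpace, act, transpose_mul_mul_mul, ← Matrix.add_mul, ← Matrix.mul_add,
      htan, Matrix.mul_zero, Matrix.zero_mul]
  · rw [hmom, Matrix.transpose_mul, Matrix.transpose_mul, hη.2, Matrix.transpose_transpose,
      Matrix.mul_assoc]

theorem lift_act (hz : z ∈ SRp m n p) (hξ : ξ ∈ tangent (Mp m n p) (proj z)) (hQ : Qᵀ * Q = 1) :
    lift (act z Q) ξ = act (lift z ξ) Q :=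
  lift_eq_of_mem (act_mem hz hQ) (act_mem_horizontalSpace (lift_mem hz hξ))
    ((dproj_act_act _ _ hQ).trans (dproj_lift hz hξ))

theorem tangent_Mp_add (hz : z ∈ SRp m n p) (hξ : ξ ∈ tangent (Mp m n p) (proj z))
    (hξ' : ξ' ∈ tangent (Mp m n p) (proj z)) : ξ + ξ' ∈ tangent (Mp m n p) (proj z) := by
  rw [mem_tangent_Mp_iff hz] at *
  obtain ⟨η, hη, rfl⟩ := hξ
  obtain ⟨η', hη', rfl⟩ := hξ'
  exact ⟨η + η', add_mem hη hη', dproj_add _ _ _⟩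

theorem tangent_Mp_smul (hz : z ∈ SRp m n p) (a : ℝ) (hξ : ξ ∈ tangent (Mp m n p) (proj z)) :
    a • ξ ∈ tangent (Mp m n p) (proj z) := by
  rw [mem_tangent_Mp_iff hz] at *
  obtain ⟨η, hη, rfl⟩ := hξ
  exact ⟨a • η, Submodule.smul_mem _ a hη, dproj_smul _ _ _⟩

theorem lift_add (hz : z ∈ SRp m n p) (hξ : ξ ∈ tangent (Mp m n p) (proj z))
    (hξ' : ξ' ∈ tangent (Mp m n p) (proj z)) : lift z (ξ + ξ') = lift z ξ + lift z ξ' :=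
  lift_eq_of_mem hz (add_mem (lift_mem hz hξ) (lift_mem hz hξ'))
    (by rw [dproj_add, dproj_lift hz hξ, dproj_lift hz hξ'])

theorem lift_smul (hz : z ∈ SRp m n p) (a : ℝ) (hξ : ξ ∈ tangent (Mp m n p) (proj z)) :
    lift z (a • ξ) = a • lift z ξ :=
  lift_eq_of_mem hz (Submodule.smul_mem _ a (lift_mem hz hξ)) (by rw [dproj_smul, dproj_lift hz hξ])

/-- A tangent vector to the total space at `z`, given by a smooth formula in `z` and in an arbitrary
matrix `ξ`, which is mapped to `ξ` by `Dπ(z)` when `ξ` is tangent to the matrices of rank `p`. -/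
def tangentLift (z : Pair m n p) (ξ : Matrix (Fin m) (Fin n) ℝ) : Pair m n p :=
  ((1 - z.1 * z.1ᵀ) * ξ * (z.2 * (z.2ᵀ * z.2)⁻¹), ξᵀ * z.1)

theorem tangentLift_mem (hz : z ∈ SRp m n p) (ξ : Matrix (Fin m) (Fin n) ℝ) :
    tangentLift z ξ ∈ tangentSpace z := by
  have h : z.1ᵀ * (tangentLift z ξ).1 = 0 := by
    rw [tangentLift, Matrix.mul_assoc, ← Matrix.mul_assoc,
      transpose_mul_one_sub_mul_transpose hz.1, Matrix.zero_mul]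
  have h' := congrArg Matrix.transpose h
  rw [Matrix.transpose_mul, Matrix.transpose_transpose, Matrix.transpose_zero] at h'
  rw [mem_tangentSpace, h, h', add_zero]

theorem dproj_tangentLift (hz : z ∈ SRp m n p) (hξ : ξ ∈ tangent (Mp m n p) (proj z)) :
    dproj z (tangentLift z ξ) = ξ := by
  obtain ⟨η, -, rfl⟩ := exists_dproj_eq hz hξ
  have hnormal : (1 - z.1 * z.1ᵀ) * dproj z η = (1 - z.1 * z.1ᵀ) * η.1 * z.2ᵀ := by
    rw [dproj_eq, Matrix.mul_add, ← Matrix.mul_assoc _ z.1, one_sub_mul_transpose_mul_self hz.1,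
      Matrix.zero_mul, add_zero, Matrix.mul_assoc]
  have hfst : (tangentLift z (dproj z η)).1 = (1 - z.1 * z.1ᵀ) * η.1 := by
    rw [tangentLift, hnormal, Matrix.mul_assoc, ← Matrix.mul_assoc z.2ᵀ, gram_mul_inv_gram hz.2,
      Matrix.mul_one]
  rw [dproj_eq, hfst, ← hnormal, tangentLift, Matrix.transpose_mul, Matrix.transpose_transpose,
    ← Matrix.mul_assoc, ← Matrix.add_mul, sub_add_cancel, Matrix.one_mul]

theorem tangentLift_act (z : Pair m n p) (ξ : Matrix (Fin m) (Fin n) ℝ) (hQ : Qᵀ * Q = 1) :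
    tangentLift (act z Q) ξ = act (tangentLift z ξ) Q := by
  have hinv : Q⁻¹ = Qᵀ := Matrix.inv_eq_left_inv hQ
  have hinv' : (Qᵀ)⁻¹ = Q := Matrix.inv_eq_left_inv (mul_eq_one_comm.1 hQ)
  have hpinv : z.2 * Q * ((z.2 * Q)ᵀ * (z.2 * Q))⁻¹ = z.2 * (z.2ᵀ * z.2)⁻¹ * Q := by
    rw [transpose_mul_mul_mul, Matrix.mul_inv_rev, Matrix.mul_inv_rev, hinv, hinv',
      ← Matrix.mul_assoc, Matrix.mul_assoc z.2, mul_eq_one_comm.1 hQ, Matrix.mul_one,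
      Matrix.mul_assoc]
  simp only [tangentLift, act, mul_mul_transpose_mul_of_orthogonal hQ, hpinv, Matrix.mul_assoc]

theorem lift_eq_horPart (hz : z ∈ SRp m n p) (hξ : ξ ∈ tangent (Mp m n p) (proj z)) :
    lift z ξ = horPart z (tangentLift z ξ) := by
  rw [← hproj_eq hz (tangentLift_mem hz ξ), ← lift_dproj hz (tangentLift_mem hz ξ),
    dproj_tangentLift hz hξ]

variable {E : Type*} [NormedAddCommGroup E] [NormedSpace ℝ E] {s : Set E}

theorem contDiffOn_tangentLift {Z : E → Pair m n p} {Ξ : E → Matrix (Fin m) (Fin n) ℝ}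
    (hZ : ContDiffOn ℝ ∞ Z s) (hΞ : ContDiffOn ℝ ∞ Ξ s) (hmem : ∀ y ∈ s, Z y ∈ SRp m n p) :
    ContDiffOn ℝ ∞ (fun y => tangentLift (Z y) (Ξ y)) s := by
  have hgram : ContDiffOn ℝ ∞ (fun y => (Z y).2ᵀ * (Z y).2) s := by fun_prop
  have hinv : ContDiffOn ℝ ∞ (fun y => ((Z y).2ᵀ * (Z y).2)⁻¹) s := fun y hy =>
    contDiffWithinAt_matrix_inv (hgram y hy) (rank_eq_iff_isUnit_det_gram.1 (hmem y hy).2)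
  unfold tangentLift
  fun_prop

theorem contDiffOn_momentum {Z H : E → Pair m n p} (hZ : ContDiffOn ℝ ∞ Z s)
    (hH : ContDiffOn ℝ ∞ H s) : ContDiffOn ℝ ∞ (fun y => momentum (Z y) (H y)) s := by
  simp only [momentum_apply]
  fun_prop

theorem contDiffOn_dproj {Z H : E → Pair m n p} (hZ : ContDiffOn ℝ ∞ Z s)
    (hH : ContDiffOn ℝ ∞ H s) : ContDiffOn ℝ ∞ (fun y => dproj (Z y) (H y)) s := by
  simp only [dproj_eq]
  fun_prop

theorem contDiffOn_lift {Z : E → Pair m n p} {Ξ : E → Matrix (Fin m) (Fin n) ℝ}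
    (hZ : ContDiffOn ℝ ∞ Z s) (hΞ : ContDiffOn ℝ ∞ Ξ s) (hmem : ∀ y ∈ s, Z y ∈ SRp m n p)
    (htan : ∀ y ∈ s, Ξ y ∈ tangent (Mp m n p) (proj (Z y))) :
    ContDiffOn ℝ ∞ (fun y => lift (Z y) (Ξ y)) s := by
  have hT := contDiffOn_tangentLift hZ hΞ hmem
  have hmom := contDiffOn_momentum hZ hT
  have hΩ : ContDiffOn ℝ ∞ (fun y => omegaOf (Z y) (tangentLift (Z y) (Ξ y))) s :=
    contDiffOn_sylvester (by fun_prop) (by fun_prop) fun _ _ => posDef_gram_add_one _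
  refine ContDiffOn.congr ?_ fun y hy => lift_eq_horPart (hmem y hy) (htan y hy)
  unfold horPart act
  fun_prop

end HorizontalLifts

section QuotientMetric

variable {m n p : ℕ} {z : Pair m n p} {ξ ξ' : Matrix (Fin m) (Fin n) ℝ}

/-- The point of the fiber over `X` chosen in the definition of the quotient metric. -/
def fiberPoint (p : ℕ) (X : Matrix (Fin m) (Fin n) ℝ) : Pair m n p :=
  Classical.epsilon fun z => z ∈ SRp m n p ∧ proj z = X

theorem exists_fiberPoint_proj_eq_act (hz : z ∈ SRp m n p) :
    ∃ Q : Matrix (Fin p) (Fin p) ℝ, Qᵀ * Q = 1 ∧ fiberPoint p (proj z) = act z Q := by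
  have h := Classical.epsilon_spec (p := fun w => w ∈ SRp m n p ∧ proj w = proj z) ⟨z, hz, rfl⟩
  exact exists_act_eq hz h.1 h.2

theorem quotMetric_proj (hz : z ∈ SRp m n p) (hξ : ξ ∈ tangent (Mp m n p) (proj z))
    (hξ' : ξ' ∈ tangent (Mp m n p) (proj z)) :
    quotMetric p (proj z) ξ ξ' = gBar z (lift z ξ) (lift z ξ') := by
  obtain ⟨Q, hQ, hact⟩ := exists_fiberPoint_proj_eq_act hz
  change gBar (fiberPoint p (proj z)) (lift (fiberPoint p (proj z)) ξ)
    (lift (fiberPoint p (proj z)) ξ') = _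
  rw [hact, lift_act hz hξ hQ, lift_act hz hξ' hQ, gBar_act_act z _ _ _ hQ]

/-- The tangent vector field on the matrices of rank `p` obtained by projecting the constant vector
field `w`. -/
def frameField (p : ℕ) (w X : Matrix (Fin m) (Fin n) ℝ) : Matrix (Fin m) (Fin n) ℝ :=
  dproj (fiberPoint p X) (tangentLift (fiberPoint p X) w)

theorem frameField_proj (hz : z ∈ SRp m n p) (w : Matrix (Fin m) (Fin n) ℝ) :
    frameField p w (proj z) = dproj z (tangentLift z w) := by
  obtain ⟨Q, hQ, hact⟩ := exists_fiberPoint_proj_eq_act hz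
  rw [frameField, hact, tangentLift_act _ _ hQ, dproj_act_act _ _ hQ]

theorem frameField_self (hz : z ∈ SRp m n p) (hξ : ξ ∈ tangent (Mp m n p) (proj z)) :
    frameField p ξ (proj z) = ξ := by
  rw [frameField_proj hz, dproj_tangentLift hz hξ]

theorem isField_frameField (w : Matrix (Fin m) (Fin n) ℝ) :
    IsField (Mp m n p) (frameField p w) := by
  constructor
  · exact contDiffOn_Mp_of_comp_proj ((contDiffOn_dproj contDiffOn_id
      (contDiffOn_tangentLift contDiffOn_id contDiffOn_const fun _ hz => hz)).congr
        fun z hz => frameField_proj hz w)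
  · intro X hX
    obtain ⟨z, hz, rfl⟩ := exists_proj_eq hX
    rw [frameField_proj hz]
    exact dproj_mem_tangent hz (tangentLift_mem hz w)

end QuotientMetric

section TangentProjection

variable {m n p : ℕ} {z ζ : Pair m n p}

theorem tproj_eq (z η : Pair m n p) :
    tproj z η = η - (z.1 * ((1 / 2 : ℝ) • (z.1ᵀ * η.1 + η.1ᵀ * z.1)), 0) := by
  refine Prod.ext ?_ (by simp [tproj])
  simp only [tproj, Prod.fst_sub, Matrix.sub_mul, Matrix.one_mul, Matrix.mul_smul, smul_sub,
    smul_add, Matrix.mul_sub, Matrix.mul_add, Matrix.transpose_mul, Matrix.transpose_transpose,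
    Matrix.mul_assoc]
  module

theorem tproj_mem (hz : z.1ᵀ * z.1 = 1) (η : Pair m n p) : tproj z η ∈ tangentSpace z := by
  have hnormal : z.1ᵀ * (tproj z η).1 = (1 / 2 : ℝ) • (z.1ᵀ * η.1 - (z.1ᵀ * η.1)ᵀ) := by
    rw [tproj, Matrix.mul_add, ← Matrix.mul_assoc, transpose_mul_one_sub_mul_transpose hz,
      Matrix.zero_mul, zero_add, ← Matrix.mul_assoc, hz, Matrix.one_mul]
  have hnormal' : (tproj z η).1ᵀ * z.1 = (z.1ᵀ * (tproj z η).1)ᵀ := by simp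
  rw [mem_tangentSpace, hnormal', hnormal, Matrix.transpose_smul, ← smul_add, Matrix.transpose_sub,
    Matrix.transpose_transpose, sub_add_sub_cancel, sub_self, smul_zero]

theorem tproj_of_mem (hζ : ζ ∈ tangentSpace z) : tproj z ζ = ζ := by
  simp [tproj_eq, mem_tangentSpace.1 hζ]

theorem tproj_add (z η ζ : Pair m n p) : tproj z (η + ζ) = tproj z η + tproj z ζ := by
  refine Prod.ext ?_ rfl
  simp only [tproj, Prod.fst_add, Matrix.mul_add, Matrix.transpose_add, smul_add, smul_sub,
    Matrix.mul_sub]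
  abel

theorem tproj_smul (z : Pair m n p) (a : ℝ) (η : Pair m n p) :
    tproj z (a • η) = a • tproj z η := by
  refine Prod.ext ?_ rfl
  simp only [tproj, Prod.smul_fst, Matrix.mul_smul, Matrix.transpose_smul, smul_add, smul_sub,
    Matrix.mul_sub, smul_comm a]

theorem tproj_sub (z η ζ : Pair m n p) : tproj z (η - ζ) = tproj z η - tproj z ζ := by
  rw [eq_sub_iff_add_eq, ← tproj_add, sub_add_cancel]

theorem tproj_act_act (z η : Pair m n p) {Q : Matrix (Fin p) (Fin p) ℝ} (hQ : Qᵀ * Q = 1) :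
    tproj (act z Q) (act η Q) = act (tproj z η) Q := by
  have hQQ (C : Matrix (Fin p) (Fin p) ℝ) : Q * (Qᵀ * C * Q) = C * Q := by
    rw [← Matrix.mul_assoc, ← Matrix.mul_assoc, mul_eq_one_comm.1 hQ, Matrix.one_mul]
  rw [tproj_eq, tproj_eq]
  refine Prod.ext ?_ (by simp [act])
  simp only [act, Prod.fst_sub, transpose_mul_mul_mul, ← Matrix.add_mul, ← Matrix.mul_add,
    Matrix.mul_smul, Matrix.sub_mul, Matrix.smul_mul, Matrix.mul_assoc z.1, hQQ]

theorem gBar_tproj (η : Pair m n p) (hζ : ζ ∈ tangentSpace z) :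
    gBar z (tproj z η) ζ = gBar z η ζ := by
  rw [tproj_eq, gBar_sub_left, sub_eq_self]
  simp only [gBar, Matrix.transpose_mul, Matrix.transpose_zero, Matrix.zero_mul, add_zero,
    Matrix.mul_assoc]
  exact trace_mul_eq_zero_of_symm_of_skew (by simp [add_comm]) (transpose_mul_self_skew hζ)

theorem contDiffOn_tproj {E : Type*} [NormedAddCommGroup E] [NormedSpace ℝ E] {s : Set E}
    {Z H : E → Pair m n p} (hZ : ContDiffOn ℝ ∞ Z s) (hH : ContDiffOn ℝ ∞ H s) :
    ContDiffOn ℝ ∞ (fun y => tproj (Z y) (H y)) s := by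
  unfold tproj
  fun_prop

end TangentProjection

section TangentialDerivatives

variable {E F : Type*} [NormedAddCommGroup E] [NormedSpace ℝ E] [NormedAddCommGroup F]
  [NormedSpace ℝ F] {S : Set E} {x ξ : E}

theorem fderivWithin_eq_of_curve {φ : E → F} (hφ : DifferentiableWithinAt ℝ φ S x)
    (hξ : ξ ∈ tangent S x) {L : F}
    (h : ∀ c : ℝ → E, c 0 = x → HasDerivAt c ξ 0 → (∀ᶠ t in 𝓝 0, c t ∈ S) →
      HasDerivAt (fun t => φ (c t)) L 0) : fderivWithin ℝ φ S x ξ = L := by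
  obtain ⟨c, rfl, hd, hS, -⟩ := exists_curve_of_mem_tangent hξ
  exact (hasDerivAt_comp_curve hφ hd hS).unique (h c rfl hd hS)

theorem fderivWithin_add_of_mem_tangent {φ ψ : E → F} (hφ : DifferentiableWithinAt ℝ φ S x)
    (hψ : DifferentiableWithinAt ℝ ψ S x) (hξ : ξ ∈ tangent S x) :
    fderivWithin ℝ (fun y => φ y + ψ y) S x ξ = fderivWithin ℝ φ S x ξ + fderivWithin ℝ ψ S x ξ :=
  fderivWithin_eq_of_curve (hφ.add hψ) hξ <| by
    rintro c rfl hd hS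
    exact (hasDerivAt_comp_curve hφ hd hS).add (hasDerivAt_comp_curve hψ hd hS)

theorem fderivWithin_smul_of_mem_tangent {a : E → ℝ} {φ : E → F}
    (ha : DifferentiableWithinAt ℝ a S x) (hφ : DifferentiableWithinAt ℝ φ S x)
    (hξ : ξ ∈ tangent S x) :
    fderivWithin ℝ (fun y => a y • φ y) S x ξ =
      fderivWithin ℝ a S x ξ • φ x + a x • fderivWithin ℝ φ S x ξ :=
  fderivWithin_eq_of_curve (ha.smul hφ) hξ <| by
    rintro c rfl hd hS
    exact ((hasDerivAt_comp_curve ha hd hS).smul (hasDerivAt_comp_curve hφ hd hS)).congr_deriv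
      (add_comm _ _)

theorem fderivWithin_apply_eq_fderiv_retraction {ρ : E → E} {W : E → F}
    (hρ : ∀ y ∈ S, ρ y = y) (hW : DifferentiableWithinAt ℝ W S x)
    (hWρ : DifferentiableAt ℝ (fun y => W (ρ y)) x) (hξ : ξ ∈ tangent S x) :
    fderivWithin ℝ W S x ξ = fderiv ℝ (fun y => W (ρ y)) x ξ := by
  refine fderivWithin_eq_of_curve hW hξ fun c hc hd hS => ?_
  have hcomp := hWρ.hasFDerivAt.comp_hasDerivAt_of_eq (0 : ℝ) hd hc.symm
  exact hcomp.congr_of_eventuallyEq (hS.mono fun t ht => by simp [hρ _ ht])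

/-- Near a point of `S` that has a smooth local retraction onto `S`, the derivative of `W` along a
vector field on `S` agrees with that of the smooth local extension `W ∘ ρ`. -/
theorem contDiffOn_fderivWithin_apply
    (hret : ∀ x ∈ S, ∃ ρ : E → E, (∀ᶠ y in 𝓝 x, ContDiffAt ℝ ∞ ρ y ∧ ρ y ∈ S) ∧ ∀ y ∈ S, ρ y = y)
    {W : E → F} {V : E → E} (hW : ContDiffOn ℝ ∞ W S) (hV : IsField S V) :
    ContDiffOn ℝ ∞ (fun x => fderivWithin ℝ W S x (V x)) S := by
  intro x hx
  obtain ⟨ρ, hρ, hid⟩ := hret x hx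
  have hsmooth : ∀ᶠ y in 𝓝 x, ContDiffAt ℝ ∞ (fun y => W (ρ y)) y := by
    filter_upwards [hρ.eventually_nhds] with y hy
    refine (((hW (ρ y) hy.self_of_nhds.2).comp_of_mem_nhdsWithin_image y (s := {y | ρ y ∈ S})
      hy.self_of_nhds.1.contDiffWithinAt (Filter.mem_of_superset self_mem_nhdsWithin
        (Set.image_subset_iff.2 fun _ h => h)))).contDiffAt (hy.mono fun _ h => h.2)
  have hagree (y) (hy : y ∈ S) (h : ContDiffAt ℝ ∞ (fun y => W (ρ y)) y) :
      fderivWithin ℝ W S y (V y) = fderiv ℝ (fun y => W (ρ y)) y (V y) :=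
    fderivWithin_apply_eq_fderiv_retraction hid ((hW y hy).differentiableWithinAt (by simp))
      (h.differentiableAt (by simp)) (hV.2 y hy)
  have hext : ContDiffWithinAt ℝ ∞ (fun y => fderiv ℝ (fun y => W (ρ y)) y (V y)) S x :=
    ((hsmooth.self_of_nhds.fderiv_right (m := ∞) (by simp)).contDiffWithinAt).clm_apply (hV.1 x hx)
  refine hext.congr_of_eventuallyEq ?_ (hagree x hx hsmooth.self_of_nhds)
  filter_upwards [self_mem_nhdsWithin, mem_nhdsWithin_of_mem_nhds hsmooth] with y hy h
  exact hagree y hy h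

end TangentialDerivatives

section TangentProjections

variable {E : Type*} [NormedAddCommGroup E] [NormedSpace ℝ E] {S : Set E} {P : E → E → E}
  {x ξ ζ : E}

/-- A smooth family of linear projections `w ↦ P w x` of the ambient space onto the tangent spaces
`T_x S`: it provides a global frame of tangent fields `P w`. -/
structure IsTangentProjection (S : Set E) (P : E → E → E) : Prop where
  isField : ∀ w, IsField S (P w)
  isLinearMap : ∀ x ∈ S, IsLinearMap ℝ fun w => P w x
  eq_self : ∀ x ∈ S, ∀ ξ ∈ tangent S x, P ξ x = ξ

namespace IsTangentProjection

theorem add_mem (hP : IsTangentProjection S P) (hx : x ∈ S) (hξ : ξ ∈ tangent S x)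
    (hζ : ζ ∈ tangent S x) : ξ + ζ ∈ tangent S x := by
  have h := (hP.isField (ξ + ζ)).2 x hx
  rwa [(hP.isLinearMap x hx).map_add, hP.eq_self x hx ξ hξ, hP.eq_self x hx ζ hζ] at h

theorem smul_mem (hP : IsTangentProjection S P) (hx : x ∈ S) (a : ℝ) (hξ : ξ ∈ tangent S x) :
    a • ξ ∈ tangent S x := by
  have h := (hP.isField (a • ξ)).2 x hx
  rwa [(hP.isLinearMap x hx).map_smul, hP.eq_self x hx ξ hξ] at h

theorem sub_mem (hP : IsTangentProjection S P) (hx : x ∈ S) (hξ : ξ ∈ tangent S x)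
    (hζ : ζ ∈ tangent S x) : ξ - ζ ∈ tangent S x := by
  simpa [sub_eq_add_neg] using hP.add_mem hx hξ (hP.smul_mem hx (-1) hζ)

theorem sum_coord_smul (hP : IsTangentProjection S P) {ι : Type*} [Fintype ι]
    (b : Module.Basis ι ℝ E) (hx : x ∈ S) (hξ : ξ ∈ tangent S x) :
    ∑ i, b.coord i ξ • P (b i) x = ξ := by
  have h := congrArg ((hP.isLinearMap x hx).mk' _) (b.sum_repr ξ)
  simpa only [map_sum, map_smul, IsLinearMap.mk'_apply, hP.eq_self x hx ξ hξ,
    Module.Basis.coord_apply] using h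

end IsTangentProjection

end TangentProjections

section LeviCivitaUniqueness

theorem eq_zero_of_symm_of_antisymm {α : Type*} {c : α → α → α → ℝ}
    (hsymm : ∀ A B C, c A B C = c B A C) (hanti : ∀ A B C, c A B C = -c A C B) (A B C : α) :
    c A B C = 0 := by
  linarith [hanti A B C, hsymm A C B, hanti C A B, hsymm C B A, hanti B C A, hsymm B A C]

variable {E : Type*} [NormedAddCommGroup E] [NormedSpace ℝ E] {S : Set E} {x ξ : E}
  {g : E → E → E → ℝ} {nabla nabla' : E → E → (E → E) → E} {P : E → E → E}

theorem IsRiemannianMetric.sub_left (hg : IsRiemannianMetric S g) (hP : IsTangentProjection S P)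
    (hx : x ∈ S) {ζ η : E} (hξ : ξ ∈ tangent S x) (hζ : ζ ∈ tangent S x) (hη : η ∈ tangent S x) :
    g x (ξ - ζ) η = g x ξ η - g x ζ η := by
  have h := hg.add_left x hx _ (hP.sub_mem hx hξ hζ) ζ hζ η hη
  rw [sub_add_cancel] at h
  linarith

namespace IsLeviCivita

/-- The difference of two Levi-Civita connections, paired with the metric, is symmetric in its first
two arguments and antisymmetric in the last two. -/
theorem metric_sub_eq_zero (hg : IsRiemannianMetric S g) (hP : IsTangentProjection S P)
    (h : IsLeviCivita S g nabla) (h' : IsLeviCivita S g nabla') (hx : x ∈ S) {A B C : E → E}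
    (hA : IsField S A) (hB : IsField S B) (hC : IsField S C) :
    g x (nabla x (A x) B - nabla' x (A x) B) (C x) = 0 := by
  refine eq_zero_of_symm_of_antisymm (α := {V // IsField S V})
    (c := fun A B C => g x (nabla x (A.1 x) B - nabla' x (A.1 x) B) (C.1 x))
    (fun A B C => ?_) (fun A B C => ?_) ⟨A, hA⟩ ⟨B, hB⟩ ⟨C, hC⟩
  · have htor := h.torsion_free x hx A B A.2 B.2
    have htor' := h'.torsion_free x hx A B A.2 B.2
    have hdiff :
        nabla x (A.1 x) B - nabla' x (A.1 x) B = nabla x (B.1 x) A - nabla' x (B.1 x) A := by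
      rw [sub_eq_sub_iff_sub_eq_sub, htor, htor']
    simp only [hdiff]
  · have hmem (B : {V // IsField S V}) := h.mem_tangent x hx _ (A.2.2 x hx) B B.2
    have hmem' (B : {V // IsField S V}) := h'.mem_tangent x hx _ (A.2.2 x hx) B B.2
    have hmet := h.metric x hx _ (A.2.2 x hx) B C B.2 C.2
    have hmet' := h'.metric x hx _ (A.2.2 x hx) B C B.2 C.2
    simp only [hg.sub_left hP hx (hmem _) (hmem' _) (B.2.2 x hx),
      hg.sub_left hP hx (hmem _) (hmem' _) (C.2.2 x hx),
      hg.symm x hx _ (hmem C) _ (B.2.2 x hx), hg.symm x hx _ (hmem' C) _ (B.2.2 x hx)]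
    linarith

theorem unique (hg : IsRiemannianMetric S g) (hP : IsTangentProjection S P)
    (h : IsLeviCivita S g nabla) (h' : IsLeviCivita S g nabla') (hx : x ∈ S)
    (hξ : ξ ∈ tangent S x) {V : E → E} (hV : IsField S V) : nabla x ξ V = nabla' x ξ V := by
  have hd := hP.sub_mem hx (h.mem_tangent x hx ξ hξ V hV) (h'.mem_tangent x hx ξ hξ V hV)
  by_contra hne
  have hzero := metric_sub_eq_zero hg hP h h' hx (hP.isField ξ) hV
    (hP.isField (nabla x ξ V - nabla' x ξ V))
  rw [hP.eq_self x hx ξ hξ, hP.eq_self x hx _ hd] at hzero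
  exact (hg.pos x hx _ hd (sub_ne_zero.2 hne)).ne' hzero

end IsLeviCivita

end LeviCivitaUniqueness

section CovariantDerivatives

variable {E : Type*} [NormedAddCommGroup E] [NormedSpace ℝ E] {S : Set E}
  {nabla : E → E → (E → E) → E} {γ : ℝ → E} {J : Set ℝ} {t : ℝ} {P : E → E → E}

/-- `Λ` is the covariant derivative along `γ : J → S` at the single parameter `t`. The pointwise
notion allows `Λ` to be computed with a lift of `γ` that is horizontal only at `t`. -/
structure IsCovDerivAt (S : Set E) (nabla : E → E → (E → E) → E) (γ : ℝ → E) (J : Set ℝ) (t : ℝ)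
    (Λ : (ℝ → E) → E) : Prop where
  add : ∀ Y Z, IsFieldAlong S γ J Y → IsFieldAlong S γ J Z → Λ (fun s => Y s + Z s) = Λ Y + Λ Z
  leibniz : ∀ (φ : ℝ → ℝ) (Z : ℝ → E), ContDiffOn ℝ ∞ φ J → IsFieldAlong S γ J Z →
    Λ (fun s => φ s • Z s) = deriv φ t • Z t + φ t • Λ Z
  comp : ∀ V, IsField S V → Λ (fun s => V (γ s)) = nabla (γ t) (deriv γ t) V

theorem isCovDerivAlong_iff {D : (ℝ → E) → ℝ → E} :
    IsCovDerivAlong S nabla γ J D ↔ (∀ Z, IsFieldAlong S γ J Z → IsFieldAlong S γ J (D Z)) ∧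
      ∀ t ∈ J, IsCovDerivAt S nabla γ J t fun Z => D Z t :=
  ⟨fun h => ⟨h.field, fun t ht => ⟨fun Y Z hY hZ => h.add Y Z hY hZ t ht,
      fun φ Z hφ hZ => h.leibniz φ Z hφ hZ t ht, fun V hV => h.comp V hV t ht⟩⟩,
    fun h => ⟨h.1, fun Y Z hY hZ t ht => (h.2 t ht).add Y Z hY hZ,
      fun φ Z hφ hZ t ht => (h.2 t ht).leibniz φ Z hφ hZ, fun V hV t ht => (h.2 t ht).comp V hV⟩⟩

theorem IsField.comp_curve {V : E → E} (hV : IsField S V) (hγ : ContDiffOn ℝ ∞ γ J)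
    (hS : ∀ t ∈ J, γ t ∈ S) : IsFieldAlong S γ J fun s => V (γ s) :=
  ⟨hV.1.comp hγ hS, fun s hs => hV.2 _ (hS s hs)⟩

namespace IsFieldAlong

variable {Y Z : ℝ → E}

theorem smul (hP : IsTangentProjection S P) (hS : ∀ t ∈ J, γ t ∈ S) {φ : ℝ → ℝ}
    (hφ : ContDiffOn ℝ ∞ φ J) (hZ : IsFieldAlong S γ J Z) :
    IsFieldAlong S γ J fun s => φ s • Z s :=
  ⟨hφ.smul hZ.1, fun s hs => hP.smul_mem (hS s hs) _ (hZ.2 s hs)⟩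

theorem add (hP : IsTangentProjection S P) (hS : ∀ t ∈ J, γ t ∈ S) (hY : IsFieldAlong S γ J Y)
    (hZ : IsFieldAlong S γ J Z) : IsFieldAlong S γ J fun s => Y s + Z s :=
  ⟨hY.1.add hZ.1, fun s hs => hP.add_mem (hS s hs) (hY.2 s hs) (hZ.2 s hs)⟩

end IsFieldAlong

namespace IsCovDerivAt

variable {Λ Λ' : (ℝ → E) → E} {Y Z : ℝ → E}

theorem congr (hΛ : IsCovDerivAt S nabla γ J t Λ) (ht : t ∈ J) (hY : IsFieldAlong S γ J Y)
    (hZ : IsFieldAlong S γ J Z) (h : Set.EqOn Y Z J) : Λ Y = Λ Z := by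
  -- Multiplied by the indicator function of `J`, which is smooth on `J`, the two fields coincide.
  have hone : ContDiffOn ℝ ∞ (J.indicator fun _ => (1 : ℝ)) J :=
    contDiffOn_const.congr fun s hs => Set.indicator_of_mem hs _
  have hcut : (fun s => (J.indicator fun _ => (1 : ℝ)) s • Y s) =
      fun s => (J.indicator fun _ => (1 : ℝ)) s • Z s := funext fun s => by
    by_cases hs : s ∈ J
    · rw [h hs]
    · simp [hs]
  have hY' := hΛ.leibniz _ Y hone hY
  rw [hcut, hΛ.leibniz _ Z hone hZ, h ht, Set.indicator_of_mem ht, one_smul, one_smul] at hY'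
  exact (add_left_cancel hY').symm

theorem finset_sum (hP : IsTangentProjection S P) (hS : ∀ t ∈ J, γ t ∈ S)
    (hΛ : IsCovDerivAt S nabla γ J t Λ) (hZ : IsFieldAlong S γ J Z) {ι : Type*} (A : Finset ι)
    {Y : ι → ℝ → E} (hY : ∀ i, IsFieldAlong S γ J (Y i)) :
    IsFieldAlong S γ J (fun s => ∑ i ∈ A, Y i s) ∧
      Λ (fun s => ∑ i ∈ A, Y i s) = ∑ i ∈ A, Λ (Y i) := by
  classical
  induction A using Finset.induction_on with
  | empty =>
    have hzero : IsFieldAlong S γ J fun _ => 0 := by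
      simpa using hZ.smul hP hS (contDiffOn_const (c := (0 : ℝ)))
    have hΛzero : Λ (fun _ => 0) = 0 := by
      simpa using hΛ.leibniz (fun _ => 0) Z contDiffOn_const hZ
    simpa using ⟨hzero, hΛzero⟩
  | insert i A hi ih =>
    simp only [Finset.sum_insert hi]
    exact ⟨(hY i).add hP hS ih.1, by rw [hΛ.add _ _ (hY i) ih.1, ih.2]⟩

variable [FiniteDimensional ℝ E]

theorem eq_sum (hP : IsTangentProjection S P) (hγ : ContDiffOn ℝ ∞ γ J) (hS : ∀ t ∈ J, γ t ∈ S)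
    (ht : t ∈ J) (hΛ : IsCovDerivAt S nabla γ J t Λ) (hZ : IsFieldAlong S γ J Z) {ι : Type*}
    [Fintype ι] (b : Module.Basis ι ℝ E) :
    Λ Z = ∑ i, (deriv (fun s => b.coord i (Z s)) t • P (b i) (γ t) +
      b.coord i (Z t) • nabla (γ t) (deriv γ t) (P (b i))) := by
  have hcoord (i) : ContDiffOn ℝ ∞ (fun s => b.coord i (Z s)) J :=
    (LinearMap.toContinuousLinearMap (b.coord i)).contDiff.comp_contDiffOn hZ.1
  have hframe (i) := (hP.isField (b i)).comp_curve hγ hS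
  obtain ⟨hsum, hΛsum⟩ := hΛ.finset_sum hP hS hZ Finset.univ
    fun i => (hframe i).smul hP hS (hcoord i)
  rw [← hΛ.congr ht hsum hZ fun s hs => hP.sum_coord_smul b (hS s hs) (hZ.2 s hs), hΛsum]
  exact Finset.sum_congr rfl fun i _ => by
    rw [hΛ.leibniz _ _ (hcoord i) (hframe i), hΛ.comp _ (hP.isField (b i))]

theorem unique (hP : IsTangentProjection S P) (hγ : ContDiffOn ℝ ∞ γ J) (hS : ∀ t ∈ J, γ t ∈ S)
    (ht : t ∈ J) (hΛ : IsCovDerivAt S nabla γ J t Λ) (hΛ' : IsCovDerivAt S nabla γ J t Λ')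
    (hZ : IsFieldAlong S γ J Z) : Λ Z = Λ' Z :=
  (hΛ.eq_sum hP hγ hS ht hZ (Module.finBasis ℝ E)).trans
    (hΛ'.eq_sum hP hγ hS ht hZ (Module.finBasis ℝ E)).symm

end IsCovDerivAt

theorem hasDerivAt_deriv_of_contDiffOn (hγ : ContDiffOn ℝ ∞ γ J) (hJ : IsOpen J) (ht : t ∈ J) :
    HasDerivAt γ (deriv γ t) t :=
  ((hγ.contDiffAt (hJ.mem_nhds ht)).differentiableAt (by simp)).hasDerivAt

theorem isFieldAlong_deriv (hJ : IsOpen J) (hγ : ContDiffOn ℝ ∞ γ J) (hS : ∀ t ∈ J, γ t ∈ S) :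
    IsFieldAlong S γ J (deriv γ) := by
  refine ⟨hγ.deriv_of_isOpen hJ (by simp), fun t ht =>
    mem_tangent_of_curve (hasDerivAt_deriv_of_contDiffOn hγ hJ ht)
      (Filter.mem_of_superset (hJ.mem_nhds ht) hS) ?_⟩
  filter_upwards [hJ.mem_nhds ht] with s hs using hγ.contDiffAt (hJ.mem_nhds hs)

theorem IsGeodesic.covDerivAt_deriv [FiniteDimensional ℝ E] (hP : IsTangentProjection S P)
    (hJ : IsOpen J) (hγ : IsGeodesic S nabla γ J) (ht : t ∈ J) {Λ : (ℝ → E) → E}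
    (hΛ : IsCovDerivAt S nabla γ J t Λ) : Λ (deriv γ) = 0 := by
  obtain ⟨hsmooth, hS, D, hD, hzero⟩ := hγ
  rw [← hzero t ht]
  exact hΛ.unique hP hsmooth hS ht ((isCovDerivAlong_iff.1 hD).2 t ht)
    (isFieldAlong_deriv hJ hsmooth hS)

end CovariantDerivatives

section TotalSpace

variable {m n p : ℕ} {z η ζ : Pair m n p}

theorem hasDerivAt_gBar (z : Pair m n p) {A B : ℝ → Pair m n p} {A' B' : Pair m n p} {t : ℝ}
    (hA : HasDerivAt A A' t) (hB : HasDerivAt B B' t) :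
    HasDerivAt (fun s => gBar z (A s) (B s)) (gBar z A' (B t) + gBar z (A t) B') t := by
  have hfst := hasDerivAt_matrix_mul (hasDerivAt_matrix_transpose (hasDerivAt_fst hA))
    (hasDerivAt_fst hB)
  have hsnd := hasDerivAt_matrix_mul (hasDerivAt_matrix_transpose (hasDerivAt_snd hA))
    (hasDerivAt_snd hB)
  refine (hasDerivAt_matrix_trace (hfst.add hsnd)).congr_deriv ?_
  simp only [gBar, Matrix.trace_add]
  ring

theorem contDiffOn_gBar {E : Type*} [NormedAddCommGroup E] [NormedSpace ℝ E] {s : Set E}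
    {Z A B : E → Pair m n p} (hA : ContDiffOn ℝ ∞ A s) (hB : ContDiffOn ℝ ∞ B s) :
    ContDiffOn ℝ ∞ (fun y => gBar (Z y) (A y) (B y)) s := fun y hy =>
  contDiffWithinAt_matrix_trace
    ((by fun_prop : ContDiffOn ℝ ∞ (fun y => (A y).1ᵀ * (B y).1 + (A y).2ᵀ * (B y).2) s) y hy)

theorem isRiemannianMetric_gBar : IsRiemannianMetric (SRp m n p) gBar where
  add_left _ _ _ _ _ _ _ _ := gBar_add_left _ _ _ _
  smul_left _ _ _ _ _ _ _ := gBar_smul_left _ _ _ _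
  symm _ _ _ _ _ _ := gBar_comm _ _ _
  pos _ _ _ _ h := gBar_self_pos _ h
  smooth _ _ hV hW := contDiffOn_gBar hV.1 hW.1

theorem isTangentProjection_tproj :
    IsTangentProjection (SRp m n p) fun w z => tproj z w where
  isField w := ⟨contDiffOn_tproj contDiffOn_id contDiffOn_const,
    fun _ hz => (mem_tangent_SRp_iff hz).2 (tproj_mem hz.1 w)⟩
  isLinearMap z _ := ⟨tproj_add z, tproj_smul z⟩
  eq_self _ hz _ hξ := tproj_of_mem ((mem_tangent_SRp_iff hz).1 hξ)

theorem deriv_tangency {c Z : ℝ → Pair m n p} {v w : Pair m n p} {t : ℝ} (hc : HasDerivAt c v t)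
    (hZ : HasDerivAt Z w t) (h : ∀ᶠ s in 𝓝 t, Z s ∈ tangentSpace (c s)) :
    (c t).1ᵀ * w.1 + w.1ᵀ * (c t).1 + (v.1ᵀ * (Z t).1 + (Z t).1ᵀ * v.1) = 0 := by
  have hcZ := hasDerivAt_matrix_mul (hasDerivAt_matrix_transpose (hasDerivAt_fst hc))
    (hasDerivAt_fst hZ)
  have hZc := hasDerivAt_matrix_mul (hasDerivAt_matrix_transpose (hasDerivAt_fst hZ))
    (hasDerivAt_fst hc)
  have hconst := (hcZ.add hZc).unique
    ((hasDerivAt_const t (0 : Matrix (Fin p) (Fin p) ℝ)).congr_of_eventuallyEq h)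
  rw [← hconst]
  abel

variable {V W : Pair m n p → Pair m n p}

theorem fderivWithin_tangency (hW : IsField (SRp m n p) W) (hz : z ∈ SRp m n p)
    (hη : η ∈ tangent (SRp m n p) z) :
    z.1ᵀ * (fderivWithin ℝ W (SRp m n p) z η).1 + (fderivWithin ℝ W (SRp m n p) z η).1ᵀ * z.1 +
      (η.1ᵀ * (W z).1 + (W z).1ᵀ * η.1) = 0 := by
  obtain ⟨c, rfl, hd, hS, -⟩ := exists_curve_of_mem_tangent hη
  exact deriv_tangency hd
    (hasDerivAt_comp_curve ((hW.1 _ hz).differentiableWithinAt (by simp)) hd hS)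
    (hS.mono fun t ht => (mem_tangent_SRp_iff ht).1 (hW.2 _ ht))

theorem nablaBar_congr (h : Set.EqOn V W (SRp m n p)) (hz : z ∈ SRp m n p) (η : Pair m n p) :
    nablaBar z η V = nablaBar z η W := by
  rw [nablaBar, nablaBar, fderivWithin_congr h (h hz)]

theorem nablaBar_add_right (hη : η ∈ tangent (SRp m n p) z)
    (hV : DifferentiableWithinAt ℝ V (SRp m n p) z)
    (hW : DifferentiableWithinAt ℝ W (SRp m n p) z) :
    nablaBar z η (fun y => V y + W y) = nablaBar z η V + nablaBar z η W :=
  (congrArg (tproj z) (fderivWithin_add_of_mem_tangent hV hW hη)).trans (tproj_add _ _ _)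

theorem nablaBar_leibniz (hz : z ∈ SRp m n p) (hη : η ∈ tangent (SRp m n p) z)
    {φ : Pair m n p → ℝ} (hφ : DifferentiableWithinAt ℝ φ (SRp m n p) z)
    (hV : IsField (SRp m n p) V) :
    nablaBar z η (fun y => φ y • V y) =
      fderivWithin ℝ φ (SRp m n p) z η • V z + φ z • nablaBar z η V := by
  refine (congrArg (tproj z) (fderivWithin_smul_of_mem_tangent hφ
    ((hV.1 z hz).differentiableWithinAt (by simp)) hη)).trans ?_
  rw [tproj_add, tproj_smul, tproj_smul, tproj_of_mem ((mem_tangent_SRp_iff hz).1 (hV.2 z hz))]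
  rfl

theorem nablaBar_torsion_free (hz : z ∈ SRp m n p) (hV : IsField (SRp m n p) V)
    (hW : IsField (SRp m n p) W) :
    nablaBar z (V z) W - nablaBar z (W z) V =
      VectorField.lieBracketWithin ℝ V W (SRp m n p) z := by
  rw [nablaBar, nablaBar, ← tproj_sub, VectorField.lieBracketWithin]
  refine tproj_of_mem (mem_tangentSpace.2 ?_)
  rw [← sub_eq_zero.2 ((fderivWithin_tangency hW hz (hV.2 z hz)).trans
    (fderivWithin_tangency hV hz (hW.2 z hz)).symm)]
  simp only [Prod.fst_sub, Matrix.mul_sub, Matrix.transpose_sub, Matrix.sub_mul]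
  abel

theorem nablaBar_metric (hz : z ∈ SRp m n p) (hη : η ∈ tangent (SRp m n p) z)
    (hV : IsField (SRp m n p) V) (hW : IsField (SRp m n p) W) :
    fderivWithin ℝ (fun y => gBar y (V y) (W y)) (SRp m n p) z η =
      gBar z (nablaBar z η V) (W z) + gBar z (V z) (nablaBar z η W) := by
  rw [nablaBar, nablaBar, gBar_tproj _ ((mem_tangent_SRp_iff hz).1 (hW.2 z hz)),
    gBar_comm z (V z), gBar_tproj _ ((mem_tangent_SRp_iff hz).1 (hV.2 z hz)), gBar_comm z _ (V z)]
  refine fderivWithin_eq_of_curve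
    ((contDiffOn_gBar hV.1 hW.1 z hz).differentiableWithinAt (by simp)) hη ?_
  rintro c rfl hd hS
  exact hasDerivAt_gBar _
    (hasDerivAt_comp_curve ((hV.1 _ hz).differentiableWithinAt (by simp)) hd hS)
    (hasDerivAt_comp_curve ((hW.1 _ hz).differentiableWithinAt (by simp)) hd hS)

theorem isLeviCivita_nablaBar : IsLeviCivita (SRp m n p) gBar nablaBar where
  mem_tangent _ hz _ _ _ _ := (mem_tangent_SRp_iff hz).2 (tproj_mem hz.1 _)
  smooth _ _ hV hW := contDiffOn_tproj contDiffOn_id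
    (contDiffOn_fderivWithin_apply (fun _ h => exists_retraction h) hW.1 hV)
  congr _ hz η _ _ _ _ _ h := nablaBar_congr h hz η
  add_left _ _ _ _ _ _ _ _ := by simp only [nablaBar, map_add, tproj_add]
  smul_left _ _ _ _ _ _ _ := by simp only [nablaBar, map_smul, tproj_smul]
  add_right z hz _ hη _ _ hV hW := nablaBar_add_right hη
    ((hV.1 z hz).differentiableWithinAt (by simp)) ((hW.1 z hz).differentiableWithinAt (by simp))
  leibniz z hz _ hη _ _ hφ hV :=
    nablaBar_leibniz hz hη ((hφ z hz).differentiableWithinAt (by simp)) hV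
  torsion_free _ hz _ _ hV hW := nablaBar_torsion_free hz hV hW
  metric _ hz _ hη _ _ hV hW := nablaBar_metric hz hη hV hW

end TotalSpace

section TotalSpaceGeodesics

variable {m n p : ℕ} {z η : Pair m n p} {γ : ℝ → Pair m n p} {J : Set ℝ} {t : ℝ}

theorem isCovDerivAt_tproj (hJ : IsOpen J) (hγ : ContDiffOn ℝ ∞ γ J)
    (hS : ∀ s ∈ J, γ s ∈ SRp m n p) (ht : t ∈ J) :
    IsCovDerivAt (SRp m n p) nablaBar γ J t fun Z => tproj (γ t) (deriv Z t) where
  add _ _ hY hZ := by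
    rw [← tproj_add]
    exact congrArg _ ((hasDerivAt_deriv_of_contDiffOn hY.1 hJ ht).add
      (hasDerivAt_deriv_of_contDiffOn hZ.1 hJ ht)).deriv
  leibniz φ Z hφ hZ := by
    have hderiv := ((hasDerivAt_deriv_of_contDiffOn hφ hJ ht).smul
      (hasDerivAt_deriv_of_contDiffOn hZ.1 hJ ht)).deriv
    refine (congrArg (tproj (γ t)) hderiv).trans ?_
    rw [tproj_add, tproj_smul, tproj_smul,
      tproj_of_mem ((mem_tangent_SRp_iff (hS t ht)).1 (hZ.2 t ht)), add_comm]
    rfl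
  comp V hV := congrArg (tproj (γ t)) (hasDerivAt_comp_curve
    ((hV.1 _ (hS t ht)).differentiableWithinAt (by simp))
    (hasDerivAt_deriv_of_contDiffOn hγ hJ ht) (Filter.mem_of_superset (hJ.mem_nhds ht) hS)).deriv

theorem isCovDerivAlong_tproj (hJ : IsOpen J) (hγ : ContDiffOn ℝ ∞ γ J)
    (hS : ∀ t ∈ J, γ t ∈ SRp m n p) :
    IsCovDerivAlong (SRp m n p) nablaBar γ J fun Z t => tproj (γ t) (deriv Z t) :=
  isCovDerivAlong_iff.2
    ⟨fun _ hZ => ⟨contDiffOn_tproj hγ (hZ.1.deriv_of_isOpen hJ (by simp)),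
      fun t ht => (mem_tangent_SRp_iff (hS t ht)).2 (tproj_mem (hS t ht).1 _)⟩,
    fun _ ht => isCovDerivAt_tproj hJ hγ hS ht⟩

/-- The Euclidean acceleration of a geodesic of the total space with position `z` and velocity
`η`. -/
def geodesicAccel (z η : Pair m n p) : Pair m n p := (-(z.1 * (η.1ᵀ * η.1)), 0)

theorem tproj_geodesicAccel (hz : z.1ᵀ * z.1 = 1) (η : Pair m n p) :
    tproj z (geodesicAccel z η) = 0 := by
  have hsymm : z.1ᵀ * -(z.1 * (η.1ᵀ * η.1)) = -(η.1ᵀ * η.1) := by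
    rw [Matrix.mul_neg, ← Matrix.mul_assoc, hz, Matrix.one_mul]
  have hnormal : (1 - z.1 * z.1ᵀ) * -(z.1 * (η.1ᵀ * η.1)) = 0 := by
    rw [Matrix.mul_neg, ← Matrix.mul_assoc, one_sub_mul_transpose_mul_self hz, Matrix.zero_mul,
      neg_zero]
  simp [tproj, geodesicAccel, hsymm, hnormal]

theorem deriv_geod (z η : Pair m n p) :
    deriv (geod z η) = fun t => (stiefelVel z.1 η.1 t, η.2) :=
  funext fun t => (hasDerivAt_geod z η t).deriv

theorem hasDerivAt_deriv_geod (hz : z.1ᵀ * z.1 = 1) (hη : η ∈ tangentSpace z) (t : ℝ) :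
    HasDerivAt (deriv (geod z η)) (geodesicAccel (geod z η t) (deriv (geod z η) t)) t := by
  rw [deriv_geod]
  exact (hasDerivAt_stiefelVel t hz hη).prodMk (hasDerivAt_const t η.2)

theorem isGeodesic_geod (hη : η ∈ tangentSpace z) (hz : z.1ᵀ * z.1 = 1) (hJ : IsOpen J)
    (hS : ∀ t ∈ J, geod z η t ∈ SRp m n p) : IsGeodesic (SRp m n p) nablaBar (geod z η) J := by
  refine ⟨(contDiff_geod z η).contDiffOn, hS, _,
    isCovDerivAlong_tproj hJ (contDiff_geod z η).contDiffOn hS, fun t ht => ?_⟩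
  exact (congrArg (tproj _) (hasDerivAt_deriv_geod hz hη t).deriv).trans
    (tproj_geodesicAccel (hS t ht).1 _)

theorem tproj_eq_sub_geodesicAccel {a : Pair m n p}
    (h : z.1ᵀ * a.1 + a.1ᵀ * z.1 + (η.1ᵀ * η.1 + η.1ᵀ * η.1) = 0) :
    tproj z a = a - geodesicAccel z η := by
  rw [tproj_eq, eq_neg_of_add_eq_zero_left h, geodesicAccel, ← two_smul ℝ (η.1ᵀ * _), smul_neg,
    smul_smul]
  norm_num

theorem hasDerivAt_deriv_of_isGeodesic_nablaBar (hJ : IsOpen J)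
    (hγ : IsGeodesic (SRp m n p) nablaBar γ J) (ht : t ∈ J) :
    HasDerivAt (deriv γ) (geodesicAccel (γ t) (deriv γ t)) t := by
  have hvel := isFieldAlong_deriv hJ hγ.1 hγ.2.1
  obtain ⟨a, hacc⟩ : ∃ a, HasDerivAt (deriv γ) a t :=
    ⟨_, hasDerivAt_deriv_of_contDiffOn hvel.1 hJ ht⟩
  have hzero : tproj (γ t) a = 0 := (congrArg (tproj _) hacc.deriv.symm).trans
    (hγ.covDerivAt_deriv isTangentProjection_tproj hJ ht (isCovDerivAt_tproj hJ hγ.1 hγ.2.1 ht))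
  have htan := deriv_tangency (hasDerivAt_deriv_of_contDiffOn hγ.1 hJ ht) hacc
    (Filter.mem_of_superset (hJ.mem_nhds ht)
      fun s hs => (mem_tangent_SRp_iff (hγ.2.1 s hs)).1 (hvel.2 s hs))
  exact hacc.congr_deriv (sub_eq_zero.1 ((tproj_eq_sub_geodesicAccel htan).symm.trans hzero))

theorem eqOn_geod_of_isGeodesic (hJ : IsOpen J) (hJ01 : Set.Icc 0 1 ⊆ J)
    (hγ : IsGeodesic (SRp m n p) nablaBar γ J) :
    Set.EqOn γ (geod (γ 0) (deriv γ 0)) (Set.Icc 0 1) := by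
  have h0 : (0 : ℝ) ∈ J := hJ01 (Set.left_mem_Icc.2 zero_le_one)
  have hz := hγ.2.1 0 h0
  have hη := (mem_tangent_SRp_iff hz).1 ((isFieldAlong_deriv hJ hγ.1 hγ.2.1).2 0 h0)
  have hsmooth : ContDiff ℝ 1 fun q : Pair m n p × Pair m n p => (q.2, geodesicAccel q.1 q.2) := by
    unfold geodesicAccel
    fun_prop
  have heq := eqOn_of_hasDerivAt hsmooth
    (f := fun t => (γ t, deriv γ t))
    (g := fun t => (geod (γ 0) (deriv γ 0) t, deriv (geod (γ 0) (deriv γ 0)) t))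
    (fun t ht => (hasDerivAt_deriv_of_contDiffOn hγ.1 hJ (hJ01 ht)).prodMk
      (hasDerivAt_deriv_of_isGeodesic_nablaBar hJ hγ (hJ01 ht)))
    (fun t _ => (hasDerivAt_geod _ _ t).differentiableAt.hasDerivAt.prodMk
      (hasDerivAt_deriv_geod hz.1 hη t))
    (Prod.ext (geod_zero _ _).symm (hasDerivAt_geod_zero _ _).deriv.symm)
  exact fun t ht => congrArg Prod.fst (heq ht)

theorem exists_open_interval {U : Set ℝ} (hU : IsOpen U) (h : Set.Icc (0 : ℝ) 1 ⊆ U) :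
    ∃ J : Set ℝ, IsOpen J ∧ J.OrdConnected ∧ Set.Icc 0 1 ⊆ J ∧ J ⊆ U := by
  obtain ⟨δ, hδ, hthick⟩ := isCompact_Icc.exists_thickening_subset_open hU h
  refine ⟨_, Metric.isOpen_thickening, ?_, Metric.self_subset_thickening hδ _, hthick⟩
  exact ((convex_Icc (0 : ℝ) 1).thickening δ).ordConnected

theorem exists_interval_geod_mem (hz : z.1ᵀ * z.1 = 1) (hη : η ∈ tangentSpace z)
    (hr : StaysFullRank z η) : ∃ J : Set ℝ, IsOpen J ∧ J.OrdConnected ∧ Set.Icc 0 1 ⊆ J ∧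
      ∀ t ∈ J, geod z η t ∈ SRp m n p := by
  have hc : Continuous fun t : ℝ => z.2 + t • η.2 := by fun_prop
  obtain ⟨J, hJ, hJc, hJ01, hJr⟩ := exists_open_interval (isOpen_setOf_rank_eq.preimage hc) hr
  exact ⟨J, hJ, hJc, hJ01, fun t ht => (geod_mem_iff hz hη).2 (hJr ht)⟩

theorem hasExp_SRp_iff (hz : z ∈ SRp m n p) (hη : η ∈ tangent (SRp m n p) z) (w : Pair m n p) :
    HasExp (SRp m n p) nablaBar z η w ↔ StaysFullRank z η ∧ w = expTotal z η := by
  have hη' := (mem_tangent_SRp_iff hz).1 hη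
  constructor
  · rintro ⟨γ, J, hJ, -, hJ01, hγ, rfl, rfl, rfl⟩
    have heq := eqOn_geod_of_isGeodesic hJ hJ01 hγ
    exact ⟨fun t ht => (geod_mem_iff hz.1 hη').1 (heq ht ▸ hγ.2.1 t (hJ01 ht)),
      (heq (Set.right_mem_Icc.2 zero_le_one)).trans (geod_one _ _)⟩
  · rintro ⟨hr, rfl⟩
    obtain ⟨J, hJ, hJc, hJ01, hS⟩ := exists_interval_geod_mem hz.1 hη' hr
    exact ⟨geod z η, J, hJ, hJc, hJ01, isGeodesic_geod hη' hz.1 hJ hS, geod_zero z η,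
      (hasDerivAt_geod_zero z η).deriv, geod_one z η⟩

end TotalSpaceGeodesics

section HorizontalFields

variable {m n p : ℕ} {z η : Pair m n p}
  {V W : Matrix (Fin m) (Fin n) ℝ → Matrix (Fin m) (Fin n) ℝ}

theorem isTangentProjection_frameField : IsTangentProjection (Mp m n p) (frameField p) where
  isField := isField_frameField
  isLinearMap X hX := by
    obtain ⟨z, hz, rfl⟩ := exists_proj_eq hX
    refine ⟨fun w w' => ?_, fun a w => ?_⟩
    · rw [frameField_proj hz, frameField_proj hz, frameField_proj hz, ← dproj_add]
      congr 1
      simp [tangentLift, Matrix.mul_add, Matrix.add_mul]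
    · rw [frameField_proj hz, frameField_proj hz, ← dproj_smul]
      congr 1
      simp [tangentLift]
  eq_self X hX ξ hξ := by
    obtain ⟨z, hz, rfl⟩ := exists_proj_eq hX
    exact frameField_self hz hξ

/-- The horizontal lift of a vector field on `M_p` to the total space. -/
def liftField (p : ℕ) (V : Matrix (Fin m) (Fin n) ℝ → Matrix (Fin m) (Fin n) ℝ) (z : Pair m n p) :
    Pair m n p := lift z (V (proj z))

theorem IsField.tangent_proj (hV : IsField (Mp m n p) V) (hz : z ∈ SRp m n p) :
    V (proj z) ∈ tangent (Mp m n p) (proj z) := hV.2 _ (proj_mem hz)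

theorem liftField_mem (hV : IsField (Mp m n p) V) (hz : z ∈ SRp m n p) :
    liftField p V z ∈ horizontalSpace z := lift_mem hz (hV.tangent_proj hz)

theorem dproj_liftField (hV : IsField (Mp m n p) V) (hz : z ∈ SRp m n p) :
    dproj z (liftField p V z) = V (proj z) := dproj_lift hz (hV.tangent_proj hz)

theorem isField_liftField (hV : IsField (Mp m n p) V) : IsField (SRp m n p) (liftField p V) :=
  ⟨contDiffOn_lift contDiffOn_id (contDiffOn_comp_proj hV.1) (fun _ h => h)
    fun _ h => hV.tangent_proj h,
    fun _ hz => (mem_tangent_SRp_iff hz).2 (liftField_mem hV hz).1⟩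

theorem hasDerivAt_act {c : ℝ → Pair m n p} {v : Pair m n p} {Q : ℝ → Matrix (Fin p) (Fin p) ℝ}
    {R : Matrix (Fin p) (Fin p) ℝ} {t : ℝ} (hc : HasDerivAt c v t) (hQ : HasDerivAt Q R t) :
    HasDerivAt (fun s => act (c s) (Q s)) (act v (Q t) + act (c t) R) t :=
  (hasDerivAt_matrix_mul (hasDerivAt_fst hc) hQ).prodMk
    (hasDerivAt_matrix_mul (hasDerivAt_snd hc) hQ)

theorem nablaBar_liftField_act (hV : IsField (Mp m n p) V) (hz : z ∈ SRp m n p)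
    (hη : η ∈ tangentSpace z) {Q : Matrix (Fin p) (Fin p) ℝ} (hQ : Qᵀ * Q = 1) :
    nablaBar (act z Q) (act η Q) (liftField p V) = act (nablaBar z η (liftField p V)) Q := by
  have hdiff (x : Pair m n p) (hx : x ∈ SRp m n p) :=
    ((isField_liftField hV).1 x hx).differentiableWithinAt (by simp)
  have hact {c : ℝ → Pair m n p} {v : Pair m n p} {t : ℝ} (hc : HasDerivAt c v t) :
      HasDerivAt (fun s => act (c s) Q) (act v Q) t :=
    (hasDerivAt_act hc (hasDerivAt_const t Q)).congr_deriv (by simp [act])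
  obtain ⟨c, rfl, hd, hS, -⟩ := exists_curve_of_mem_tangent ((mem_tangent_SRp_iff hz).2 hη)
  have hleft := hasDerivAt_comp_curve (c := fun s => act (c s) Q) (hdiff _ (act_mem hz hQ))
    (hact hd) (hS.mono fun _ h => act_mem h hQ)
  have hright := hact (hasDerivAt_comp_curve (hdiff _ hz) hd hS)
  have hequiv := hleft.unique (hright.congr_of_eventuallyEq (hS.mono fun t ht => by
    simp only [liftField, proj_act _ hQ]
    exact lift_act ht (hV.tangent_proj ht) hQ))
  rw [nablaBar, nablaBar, ← tproj_act_act _ _ hQ]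
  exact congrArg (tproj _) hequiv

theorem fderivWithin_comp_proj {F : Type*} [NormedAddCommGroup F] [NormedSpace ℝ F]
    {φ : Matrix (Fin m) (Fin n) ℝ → F} (hφ : ContDiffOn ℝ ∞ φ (Mp m n p)) (hz : z ∈ SRp m n p)
    (hη : η ∈ tangentSpace z) :
    fderivWithin ℝ (fun w : Pair m n p => φ (proj w)) (SRp m n p) z η =
      fderivWithin ℝ φ (Mp m n p) (proj z) (dproj z η) := by
  refine fderivWithin_eq_of_curve
    ((contDiffOn_comp_proj hφ z hz).differentiableWithinAt (by simp))
    ((mem_tangent_SRp_iff hz).2 hη) ?_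
  rintro c rfl hd hS
  exact hasDerivAt_comp_curve (c := fun t => proj (c t))
    ((hφ _ (proj_mem hz)).differentiableWithinAt (by simp)) (hasDerivAt_proj hd)
    (hS.mono fun _ h => proj_mem h)

theorem dproj_fderivWithin_liftField (hV : IsField (Mp m n p) V) (hz : z ∈ SRp m n p)
    (hη : η ∈ tangentSpace z) :
    dproj z (fderivWithin ℝ (liftField p V) (SRp m n p) z η) =
      fderivWithin ℝ V (Mp m n p) (proj z) (dproj z η) -
        ((liftField p V z).1 * η.2ᵀ + η.1 * (liftField p V z).2ᵀ) := by
  obtain ⟨c, rfl, hd, hS, -⟩ := exists_curve_of_mem_tangent ((mem_tangent_SRp_iff hz).2 hη)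
  have hlift := hasDerivAt_comp_curve
    (((isField_liftField hV).1 _ hz).differentiableWithinAt (by simp)) hd hS
  have hproduct := (hasDerivAt_matrix_mul (hasDerivAt_fst hlift)
      (hasDerivAt_matrix_transpose (hasDerivAt_snd hd))).add
    (hasDerivAt_matrix_mul (hasDerivAt_fst hd)
      (hasDerivAt_matrix_transpose (hasDerivAt_snd hlift)))
  have hfield := hasDerivAt_comp_curve (c := fun t => proj (c t))
    ((hV.1 _ (proj_mem hz)).differentiableWithinAt (by simp)) (hasDerivAt_proj hd)
    (hS.mono fun _ h => proj_mem h)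
  have hderiv := hproduct.unique (hfield.congr_of_eventuallyEq (hS.mono fun t ht => by
    have h := dproj_liftField hV ht
    rw [dproj_eq] at h
    exact h))
  rw [eq_sub_iff_add_eq, dproj_eq]
  refine Eq.trans ?_ hderiv
  have hcomm (A B C D : Matrix (Fin m) (Fin n) ℝ) : A + B + (C + D) = A + C + (D + B) := by abel
  exact hcomm _ _ _ _

end HorizontalFields

section QuotientConnection

variable {m n p : ℕ} {z η : Pair m n p} {ξ : Matrix (Fin m) (Fin n) ℝ}
  {V W : Matrix (Fin m) (Fin n) ℝ → Matrix (Fin m) (Fin n) ℝ}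

theorem contDiffOn_quotMetric (hV : IsField (Mp m n p) V) (hW : IsField (Mp m n p) W) :
    ContDiffOn ℝ ∞ (fun X => quotMetric p X (V X) (W X)) (Mp m n p) :=
  contDiffOn_Mp_of_comp_proj ((contDiffOn_gBar (Z := id) (isField_liftField hV).1
    (isField_liftField hW).1).congr fun _ hz =>
      quotMetric_proj hz (hV.tangent_proj hz) (hW.tangent_proj hz))

theorem isRiemannianMetric_quotMetric :
    IsRiemannianMetric (Mp m n p) (quotMetric p) where
  add_left X hX ξ hξ ζ hζ η hη := by
    obtain ⟨z, hz, rfl⟩ := exists_proj_eq hX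
    rw [quotMetric_proj hz (tangent_Mp_add hz hξ hζ) hη, quotMetric_proj hz hξ hη,
      quotMetric_proj hz hζ hη, lift_add hz hξ hζ, gBar_add_left]
  smul_left X hX a ξ hξ η hη := by
    obtain ⟨z, hz, rfl⟩ := exists_proj_eq hX
    rw [quotMetric_proj hz (tangent_Mp_smul hz a hξ) hη, quotMetric_proj hz hξ hη,
      lift_smul hz a hξ, gBar_smul_left]
  symm X hX ξ hξ η hη := by
    obtain ⟨z, hz, rfl⟩ := exists_proj_eq hX
    rw [quotMetric_proj hz hξ hη, quotMetric_proj hz hη hξ, gBar_comm]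
  pos X hX ξ hξ hne := by
    obtain ⟨z, hz, rfl⟩ := exists_proj_eq hX
    rw [quotMetric_proj hz hξ hξ]
    refine gBar_self_pos z fun hzero => hne ?_
    rw [← dproj_lift hz hξ, hzero, ← sub_self (0 : Pair m n p), dproj_sub, sub_self]
  smooth V W hV hW := contDiffOn_quotMetric hV hW

theorem quotMetric_dproj_left (hz : z ∈ SRp m n p) (hη : η ∈ tangentSpace z)
    (hξ : ξ ∈ tangent (Mp m n p) (proj z)) :
    quotMetric p (proj z) (dproj z η) ξ = gBar z η (lift z ξ) := by
  rw [quotMetric_proj hz (dproj_mem_tangent hz hη) hξ, lift_dproj hz hη,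
    gBar_hproj hz hη (lift_mem hz hξ)]

theorem nablaBar_mem (hz : z ∈ SRp m n p) (η : Pair m n p) (V : Pair m n p → Pair m n p) :
    nablaBar z η V ∈ tangentSpace z := tproj_mem hz.1 _

theorem lift_mem_tangent (hz : z ∈ SRp m n p) (hξ : ξ ∈ tangent (Mp m n p) (proj z)) :
    lift z ξ ∈ tangent (SRp m n p) z :=
  (mem_tangent_SRp_iff hz).2 (lift_mem hz hξ).1

/-- The quotient connection: the image under `Dπ` of the covariant derivative of the horizontal
lifts, computed at the chosen point of the fiber. -/
def nablaQuot (p : ℕ) (X ξ : Matrix (Fin m) (Fin n) ℝ)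
    (V : Matrix (Fin m) (Fin n) ℝ → Matrix (Fin m) (Fin n) ℝ) : Matrix (Fin m) (Fin n) ℝ :=
  dproj (fiberPoint p X) (nablaBar (fiberPoint p X) (lift (fiberPoint p X) ξ) (liftField p V))

theorem nablaQuot_proj (hz : z ∈ SRp m n p) (hξ : ξ ∈ tangent (Mp m n p) (proj z))
    (hV : IsField (Mp m n p) V) :
    nablaQuot p (proj z) ξ V = dproj z (nablaBar z (lift z ξ) (liftField p V)) := by
  obtain ⟨Q, hQ, hact⟩ := exists_fiberPoint_proj_eq_act hz
  rw [nablaQuot, hact, lift_act hz hξ hQ, nablaBar_liftField_act hV hz (lift_mem hz hξ).1 hQ,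
    dproj_act_act _ _ hQ]

theorem contDiffOn_nablaQuot (hV : IsField (Mp m n p) V) (hW : IsField (Mp m n p) W) :
    ContDiffOn ℝ ∞ (fun X => nablaQuot p X (V X) W) (Mp m n p) :=
  contDiffOn_Mp_of_comp_proj ((contDiffOn_dproj contDiffOn_id
    (isLeviCivita_nablaBar.smooth _ _ (isField_liftField hV) (isField_liftField hW))).congr
      fun _ hz => nablaQuot_proj hz (hV.tangent_proj hz) hW)

theorem nablaQuot_add_right (hz : z ∈ SRp m n p) (hξ : ξ ∈ tangent (Mp m n p) (proj z))
    (hV : IsField (Mp m n p) V) (hW : IsField (Mp m n p) W) :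
    nablaQuot p (proj z) ξ (fun y => V y + W y) =
      nablaQuot p (proj z) ξ V + nablaQuot p (proj z) ξ W := by
  have hVW : IsField (Mp m n p) fun y => V y + W y := ⟨hV.1.add hW.1, fun Y hY =>
    isTangentProjection_frameField.add_mem hY (hV.2 Y hY) (hW.2 Y hY)⟩
  rw [nablaQuot_proj hz hξ hV, nablaQuot_proj hz hξ hW, nablaQuot_proj hz hξ hVW,
    nablaBar_congr (V := liftField p fun y => V y + W y)
      (W := fun w => liftField p V w + liftField p W w)
      (fun w hw => lift_add hw (hV.tangent_proj hw) (hW.tangent_proj hw)) hz,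
    isLeviCivita_nablaBar.add_right z hz _ (lift_mem_tangent hz hξ) _ _ (isField_liftField hV)
      (isField_liftField hW), dproj_add]

theorem nablaQuot_leibniz (hz : z ∈ SRp m n p) (hξ : ξ ∈ tangent (Mp m n p) (proj z))
    {φ : Matrix (Fin m) (Fin n) ℝ → ℝ} (hφ : ContDiffOn ℝ ∞ φ (Mp m n p))
    (hV : IsField (Mp m n p) V) :
    nablaQuot p (proj z) ξ (fun y => φ y • V y) =
      fderivWithin ℝ φ (Mp m n p) (proj z) ξ • V (proj z) +
        φ (proj z) • nablaQuot p (proj z) ξ V := by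
  have hφV : IsField (Mp m n p) fun y => φ y • V y := ⟨hφ.smul hV.1, fun Y hY =>
    isTangentProjection_frameField.smul_mem hY _ (hV.2 Y hY)⟩
  have hderiv := fderivWithin_comp_proj hφ hz (lift_mem hz hξ).1
  rw [dproj_lift hz hξ] at hderiv
  rw [nablaQuot_proj hz hξ hV, nablaQuot_proj hz hξ hφV,
    nablaBar_congr (V := liftField p fun y => φ y • V y)
      (W := fun w => φ (proj w) • liftField p V w)
      (fun w hw => lift_smul hw _ (hV.tangent_proj hw)) hz,
    isLeviCivita_nablaBar.leibniz z hz _ (lift_mem_tangent hz hξ) (fun w => φ (proj w)) _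
      (contDiffOn_comp_proj hφ) (isField_liftField hV), dproj_add, dproj_smul, dproj_smul,
    dproj_liftField hV hz]
  exact congrArg (fun a : ℝ => a • V (proj z) + _) hderiv

theorem nablaQuot_torsion_free (hz : z ∈ SRp m n p) (hV : IsField (Mp m n p) V)
    (hW : IsField (Mp m n p) W) :
    nablaQuot p (proj z) (V (proj z)) W - nablaQuot p (proj z) (W (proj z)) V =
      VectorField.lieBracketWithin ℝ V W (Mp m n p) (proj z) := by
  have hbracket := isLeviCivita_nablaBar.torsion_free z hz _ _ (isField_liftField hV)
    (isField_liftField hW)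
  have hderivW := dproj_fderivWithin_liftField hW hz (liftField_mem hV hz).1
  have hderivV := dproj_fderivWithin_liftField hV hz (liftField_mem hW hz).1
  rw [dproj_liftField hV hz] at hderivW
  rw [dproj_liftField hW hz] at hderivV
  rw [nablaQuot_proj hz (hV.tangent_proj hz) hW, nablaQuot_proj hz (hW.tangent_proj hz) hV,
    ← dproj_sub]
  refine (congrArg (dproj z) hbracket).trans ?_
  rw [VectorField.lieBracketWithin, VectorField.lieBracketWithin, dproj_sub]
  have hcancel (A B C D : Matrix (Fin m) (Fin n) ℝ) : A - (C + D) - (B - (D + C)) = A - B := by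
    abel
  exact (congrArg₂ (· - ·) hderivW hderivV).trans (hcancel _ _ _ _)

theorem nablaQuot_metric (hz : z ∈ SRp m n p) (hξ : ξ ∈ tangent (Mp m n p) (proj z))
    (hV : IsField (Mp m n p) V) (hW : IsField (Mp m n p) W) :
    fderivWithin ℝ (fun y => quotMetric p y (V y) (W y)) (Mp m n p) (proj z) ξ =
      quotMetric p (proj z) (nablaQuot p (proj z) ξ V) (W (proj z)) +
        quotMetric p (proj z) (V (proj z)) (nablaQuot p (proj z) ξ W) := by
  have hderiv := fderivWithin_comp_proj (contDiffOn_quotMetric hV hW) hz (lift_mem hz hξ).1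
  rw [dproj_lift hz hξ] at hderiv
  have hlift : Set.EqOn (fun w : Pair m n p => quotMetric p (proj w) (V (proj w)) (W (proj w)))
      (fun w => gBar w (liftField p V w) (liftField p W w)) (SRp m n p) := fun w hw =>
    quotMetric_proj hw (hV.tangent_proj hw) (hW.tangent_proj hw)
  rw [nablaQuot_proj hz hξ hV, nablaQuot_proj hz hξ hW,
    quotMetric_dproj_left hz (nablaBar_mem hz _ _) (hW.tangent_proj hz),
    isRiemannianMetric_quotMetric.symm _ (proj_mem hz) _ (hV.tangent_proj hz) _
      (dproj_mem_tangent hz (nablaBar_mem hz _ _)),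
    quotMetric_dproj_left hz (nablaBar_mem hz _ _) (hV.tangent_proj hz),
    gBar_comm z _ (lift z (V (proj z)))]
  exact hderiv.symm.trans ((DFunLike.congr_fun (fderivWithin_congr hlift (hlift hz)) _).trans
    (isLeviCivita_nablaBar.metric z hz _ (lift_mem_tangent hz hξ) _ _
      (isField_liftField hV) (isField_liftField hW)))

theorem isLeviCivita_nablaQuot : IsLeviCivita (Mp m n p) (quotMetric p) (nablaQuot p) where
  mem_tangent X hX ξ hξ V hV := by
    obtain ⟨z, hz, rfl⟩ := exists_proj_eq hX
    rw [nablaQuot_proj hz hξ hV]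
    exact dproj_mem_tangent hz (nablaBar_mem hz _ _)
  smooth _ _ hV hW := contDiffOn_nablaQuot hV hW
  congr X hX ξ hξ V W hV hW h := by
    obtain ⟨z, hz, rfl⟩ := exists_proj_eq hX
    rw [nablaQuot_proj hz hξ hV, nablaQuot_proj hz hξ hW, nablaBar_congr (fun w hw => ?_) hz]
    rw [liftField, h (proj_mem hw), liftField]
  add_left X hX ξ hξ ζ hζ V hV := by
    obtain ⟨z, hz, rfl⟩ := exists_proj_eq hX
    rw [nablaQuot_proj hz hξ hV, nablaQuot_proj hz hζ hV,
      nablaQuot_proj hz (tangent_Mp_add hz hξ hζ) hV, lift_add hz hξ hζ,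
      isLeviCivita_nablaBar.add_left z hz _ (lift_mem_tangent hz hξ) _ (lift_mem_tangent hz hζ) _
        (isField_liftField hV), dproj_add]
  smul_left X hX a ξ hξ V hV := by
    obtain ⟨z, hz, rfl⟩ := exists_proj_eq hX
    rw [nablaQuot_proj hz hξ hV, nablaQuot_proj hz (tangent_Mp_smul hz a hξ) hV,
      lift_smul hz a hξ, isLeviCivita_nablaBar.smul_left z hz a _ (lift_mem_tangent hz hξ) _
        (isField_liftField hV), dproj_smul]
  add_right X hX ξ hξ V W hV hW := by
    obtain ⟨z, hz, rfl⟩ := exists_proj_eq hX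
    exact nablaQuot_add_right hz hξ hV hW
  leibniz X hX ξ hξ φ V hφ hV := by
    obtain ⟨z, hz, rfl⟩ := exists_proj_eq hX
    exact nablaQuot_leibniz hz hξ hφ hV
  torsion_free X hX V W hV hW := by
    obtain ⟨z, hz, rfl⟩ := exists_proj_eq hX
    exact nablaQuot_torsion_free hz hV hW
  metric X hX ξ hξ V W hV hW := by
    obtain ⟨z, hz, rfl⟩ := exists_proj_eq hX
    exact nablaQuot_metric hz hξ hV hW

theorem IsLeviCivita.nabla_proj {nabla : Matrix (Fin m) (Fin n) ℝ → Matrix (Fin m) (Fin n) ℝ →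
      (Matrix (Fin m) (Fin n) ℝ → Matrix (Fin m) (Fin n) ℝ) → Matrix (Fin m) (Fin n) ℝ}
    (hL : IsLeviCivita (Mp m n p) (quotMetric p) nabla) (hz : z ∈ SRp m n p)
    (hξ : ξ ∈ tangent (Mp m n p) (proj z)) (hV : IsField (Mp m n p) V) :
    nabla (proj z) ξ V = dproj z (nablaBar z (lift z ξ) (liftField p V)) := by
  rw [← nablaQuot_proj hz hξ hV]
  exact hL.unique isRiemannianMetric_quotMetric isTangentProjection_frameField
    isLeviCivita_nablaQuot (proj_mem hz) hξ hV

end QuotientConnection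

section HorizontalLifts

variable {m n p : ℕ} {z η : Pair m n p} {γ Z : ℝ → Matrix (Fin m) (Fin n) ℝ} {c : ℝ → Pair m n p}
  {J : Set ℝ} {t : ℝ}
  {nabla : Matrix (Fin m) (Fin n) ℝ → Matrix (Fin m) (Fin n) ℝ →
    (Matrix (Fin m) (Fin n) ℝ → Matrix (Fin m) (Fin n) ℝ) → Matrix (Fin m) (Fin n) ℝ}

/-- The smooth curve `c` in the total space lifts the curve `γ` of matrices near the time `t`, and
its velocity at the time `t` (but not necessarily at other times) is horizontal. -/
structure IsHorizontalLiftAt (γ : ℝ → Matrix (Fin m) (Fin n) ℝ) (c : ℝ → Pair m n p) (t : ℝ) :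
    Prop where
  contDiffAt : ∀ᶠ s in 𝓝 t, ContDiffAt ℝ ∞ c s
  mem : ∀ᶠ s in 𝓝 t, c s ∈ SRp m n p
  proj_eq : ∀ᶠ s in 𝓝 t, proj (c s) = γ s
  deriv_mem : deriv c t ∈ horizontalSpace (c t)

theorem exists_lift_of_contDiffOn (hJ : IsOpen J) (hγ : ContDiffOn ℝ ∞ γ J)
    (hS : ∀ s ∈ J, γ s ∈ Mp m n p) (ht : t ∈ J) :
    ∃ c : ℝ → Pair m n p, ∀ᶠ s in 𝓝 t, ContDiffAt ℝ ∞ c s ∧ c s ∈ SRp m n p ∧ proj (c s) = γ s := by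
  obtain ⟨z, hz, hzt⟩ := exists_proj_eq (hS t ht)
  obtain ⟨σ, -, hσ⟩ := exists_section hz
  rw [hzt] at hσ
  refine ⟨fun s => σ (γ s), ?_⟩
  filter_upwards [hJ.mem_nhds ht,
    (hasDerivAt_deriv_of_contDiffOn hγ hJ ht).continuousAt.eventually hσ] with s hs hσs
  exact ⟨hσs.1.comp s (hγ.contDiffAt (hJ.mem_nhds hs)), hσs.2 (hS s hs)⟩

theorem contDiffAt_act {Q : ℝ → Matrix (Fin p) (Fin p) ℝ} (hc : ContDiffAt ℝ ∞ c t)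
    (hQ : ContDiffAt ℝ ∞ Q t) : ContDiffAt ℝ ∞ (fun s => act (c s) (Q s)) t := by
  unfold act
  fun_prop

theorem exists_isHorizontalLiftAt (hJ : IsOpen J) (hγ : ContDiffOn ℝ ∞ γ J)
    (hS : ∀ s ∈ J, γ s ∈ Mp m n p) (ht : t ∈ J) :
    ∃ c : ℝ → Pair m n p, IsHorizontalLiftAt γ c t := by
  obtain ⟨c, hc⟩ := exists_lift_of_contDiffOn hJ hγ hS ht
  have hmem := hc.mono fun _ h => h.2.1
  obtain ⟨v, hv⟩ : ∃ v, HasDerivAt c v t :=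
    ⟨_, (hc.self_of_nhds.1.differentiableAt (by simp)).hasDerivAt⟩
  have hvt := deriv_mem_tangentSpace hv hmem
  obtain ⟨Ω, hΩ, hvert⟩ := (mem_vertical_iff hmem.self_of_nhds).1
    (sub_hproj_mem hmem.self_of_nhds hvt)
  -- Moving `c` along its fibers with the angular velocity `-Ω` removes the vertical part of `v`.
  have hQ (s : ℝ) : (NormedSpace.exp ((s - t) • -Ω))ᵀ * NormedSpace.exp ((s - t) • -Ω) = 1 :=
    exp_transpose_mul_exp (by rw [Matrix.transpose_smul, Matrix.transpose_neg, hΩ, smul_neg])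
  have hexp : HasDerivAt (fun s => NormedSpace.exp ((s - t) • -Ω)) (-Ω) t :=
    ((hasDerivAt_matrix_exp_smul (-Ω) (t - t)).comp_sub_const t t).congr_deriv (by simp)
  have hderiv : HasDerivAt (fun s => act (c s) (NormedSpace.exp ((s - t) • -Ω)))
      (hproj (c t) v) t := (hasDerivAt_act hv hexp).congr_deriv (by
    rw [← sub_sub_cancel v (hproj (c t) v), hvert]
    simp [act, sub_eq_add_neg])
  refine ⟨fun s => act (c s) (NormedSpace.exp ((s - t) • -Ω)), ?_, ?_, ?_, ?_⟩
  · filter_upwards [hc] with s hs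
    exact contDiffAt_act hs.1 ((contDiff_matrix_exp_smul (-Ω)).comp
      (contDiff_id.sub contDiff_const)).contDiffAt
  · filter_upwards [hmem] with s hs using act_mem hs (hQ s)
  · filter_upwards [hc] with s hs using (proj_act _ (hQ s)).trans hs.2.2
  · have hct : act (c t) (NormedSpace.exp ((t - t) • -Ω)) = c t := by simp [act]
    rw [hct]
    exact (congrArg (· ∈ horizontalSpace (c t)) hderiv.deriv).mpr
      (hproj_mem hmem.self_of_nhds hvt)

namespace IsHorizontalLiftAt

theorem proj_apply (h : IsHorizontalLiftAt γ c t) : proj (c t) = γ t := h.proj_eq.self_of_nhds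

theorem hasDerivAt (h : IsHorizontalLiftAt γ c t) : HasDerivAt c (deriv c t) t :=
  (h.contDiffAt.self_of_nhds.differentiableAt (by simp)).hasDerivAt

theorem dproj_deriv (h : IsHorizontalLiftAt γ c t) : dproj (c t) (deriv c t) = deriv γ t :=
  ((hasDerivAt_proj h.hasDerivAt).congr_of_eventuallyEq
    (h.proj_eq.mono fun _ hs => hs.symm)).deriv.symm

theorem lift_deriv (h : IsHorizontalLiftAt γ c t) : lift (c t) (deriv γ t) = deriv c t :=
  lift_eq_of_mem h.mem.self_of_nhds h.deriv_mem h.dproj_deriv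

theorem eventually_mem_tangent (h : IsHorizontalLiftAt γ c t) (hJ : IsOpen J) (ht : t ∈ J)
    (hZ : IsFieldAlong (Mp m n p) γ J Z) :
    ∀ᶠ s in 𝓝 t, c s ∈ SRp m n p ∧ Z s ∈ tangent (Mp m n p) (proj (c s)) := by
  filter_upwards [hJ.mem_nhds ht, h.mem, h.proj_eq] with s hs hmem hproj
  exact ⟨hmem, hproj ▸ hZ.2 s hs⟩

theorem hasDerivAt_lift (h : IsHorizontalLiftAt γ c t) (hJ : IsOpen J) (ht : t ∈ J)
    (hZ : IsFieldAlong (Mp m n p) γ J Z) :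
    HasDerivAt (fun s => lift (c s) (Z s)) (deriv (fun s => lift (c s) (Z s)) t) t := by
  obtain ⟨U, hU, hUo, htU⟩ := eventually_nhds_iff.1
    ((h.contDiffAt.and (h.eventually_mem_tangent hJ ht hZ)).and (hJ.mem_nhds ht))
  exact hasDerivAt_deriv_of_contDiffOn (contDiffOn_lift
    (fun s hs => (hU s hs).1.1.contDiffWithinAt)
    (fun s hs => (hZ.1.contDiffAt (hJ.mem_nhds (hU s hs).2)).contDiffWithinAt)
    (fun s hs => (hU s hs).1.2.1) fun s hs => (hU s hs).1.2.2) hUo htU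

theorem isCovDerivAt (h : IsHorizontalLiftAt γ c t)
    (hL : IsLeviCivita (Mp m n p) (quotMetric p) nabla) (hJ : IsOpen J) (ht : t ∈ J) :
    IsCovDerivAt (Mp m n p) nabla γ J t fun Z =>
      dproj (c t) (tproj (c t) (deriv (fun s => lift (c s) (Z s)) t)) where
  add Y Z hY hZ := by
    have hsum := ((h.hasDerivAt_lift hJ ht hY).add
      (h.hasDerivAt_lift hJ ht hZ)).congr_of_eventuallyEq
      (f₁ := fun s => lift (c s) (Y s + Z s)) (by
        filter_upwards [h.eventually_mem_tangent hJ ht hY, h.eventually_mem_tangent hJ ht hZ]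
          with s hYs hZs using lift_add hYs.1 hYs.2 hZs.2)
    rw [← dproj_add, ← tproj_add]
    exact congrArg (fun w => dproj (c t) (tproj (c t) w)) hsum.deriv
  leibniz φ Z hφ hZ := by
    have hsmul := ((hasDerivAt_deriv_of_contDiffOn hφ hJ ht).smul
      (h.hasDerivAt_lift hJ ht hZ)).congr_of_eventuallyEq
      (f₁ := fun s => lift (c s) (φ s • Z s)) (by
        filter_upwards [h.eventually_mem_tangent hJ ht hZ] with s hs using lift_smul hs.1 _ hs.2)
    obtain ⟨hct, hZt⟩ := (h.eventually_mem_tangent hJ ht hZ).self_of_nhds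
    refine (congrArg (fun w => dproj (c t) (tproj (c t) w)) hsmul.deriv).trans ?_
    simp only [tproj_add, tproj_smul, dproj_add, dproj_smul]
    rw [tproj_of_mem (lift_mem hct hZt).1, dproj_lift hct hZt, add_comm]
  comp V hV := by
    have hct := h.mem.self_of_nhds
    have hcomp := (hasDerivAt_comp_curve (((isField_liftField hV).1 _ hct).differentiableWithinAt
      (by simp)) h.hasDerivAt h.mem).congr_of_eventuallyEq (f₁ := fun s => lift (c s) (V (γ s)))
      (h.proj_eq.mono fun s hs => by simp only [liftField, hs])
    have hnabla := hL.nabla_proj hct (dproj_mem_tangent hct h.deriv_mem.1) hV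
    rw [lift_eq_of_mem hct h.deriv_mem rfl, h.proj_apply] at hnabla
    exact (congrArg (fun w => dproj (c t) (tproj (c t) w)) hcomp.deriv).trans
      (hnabla.symm.trans (congrArg (fun u => nabla (γ t) u V) h.dproj_deriv))

end IsHorizontalLiftAt

end HorizontalLifts

section QuotientGeodesics

variable {m n p : ℕ} {z η : Pair m n p} {ξ : Matrix (Fin m) (Fin n) ℝ}
  {γ : ℝ → Matrix (Fin m) (Fin n) ℝ} {c Z : ℝ → Pair m n p} {v w : Pair m n p} {J : Set ℝ} {t : ℝ}
  {nabla : Matrix (Fin m) (Fin n) ℝ → Matrix (Fin m) (Fin n) ℝ →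
    (Matrix (Fin m) (Fin n) ℝ → Matrix (Fin m) (Fin n) ℝ) → Matrix (Fin m) (Fin n) ℝ}

theorem deriv_geod_mem_horizontalSpace (hz : z.1ᵀ * z.1 = 1) (hη : η ∈ horizontalSpace z) (t : ℝ) :
    deriv (geod z η) t ∈ horizontalSpace (geod z η t) := by
  have hvel := stiefelVel_transpose_mul_stiefelGeod t hz hη.1
  have hvel' := congrArg Matrix.transpose hvel
  rw [Matrix.transpose_mul, Matrix.transpose_mul, Matrix.transpose_transpose,
    Matrix.transpose_transpose] at hvel'
  have hsymm : (momentum z η)ᵀ = momentum z η := hη.2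
  rw [deriv_geod]
  refine ⟨?_, ?_⟩
  · rw [mem_tangentSpace, geod, hvel, hvel']
    exact hη.1
  · have hmom : momentum (geod z η t) (stiefelVel z.1 η.1 t, η.2) =
        momentum z η + t • (η.2ᵀ * η.2) := by
      simp only [momentum_apply, geod, hvel, Matrix.mul_add, Matrix.mul_smul, add_assoc]
    rw [hmom, Matrix.transpose_add, hsymm]
    simp

theorem isHorizontalLiftAt_proj (hJ : IsOpen J) (hc : ContDiffOn ℝ ∞ c J)
    (hS : ∀ s ∈ J, c s ∈ SRp m n p) (ht : t ∈ J) (hh : deriv c t ∈ horizontalSpace (c t)) :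
    IsHorizontalLiftAt (fun s => proj (c s)) c t where
  contDiffAt := by filter_upwards [hJ.mem_nhds ht] with s hs using hc.contDiffAt (hJ.mem_nhds hs)
  mem := Filter.mem_of_superset (hJ.mem_nhds ht) hS
  proj_eq := Filter.Eventually.of_forall fun _ => rfl
  deriv_mem := hh

theorem isCovDerivAlong_proj (hL : IsLeviCivita (Mp m n p) (quotMetric p) nabla) (hJ : IsOpen J)
    (hc : ContDiffOn ℝ ∞ c J) (hS : ∀ s ∈ J, c s ∈ SRp m n p)
    (hh : ∀ s ∈ J, deriv c s ∈ horizontalSpace (c s)) :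
    IsCovDerivAlong (Mp m n p) nabla (fun s => proj (c s)) J fun Y s =>
      dproj (c s) (tproj (c s) (deriv (fun r => lift (c r) (Y r)) s)) := by
  refine isCovDerivAlong_iff.2 ⟨fun Y hY => ⟨?_, fun s hs => ?_⟩, fun s hs =>
    (isHorizontalLiftAt_proj hJ hc hS hs (hh s hs)).isCovDerivAt hL hJ hs⟩
  · exact contDiffOn_dproj hc (contDiffOn_tproj hc
      ((contDiffOn_lift hc hY.1 hS hY.2).deriv_of_isOpen hJ (by simp)))
  · exact dproj_mem_tangent (hS s hs) (tproj_mem (hS s hs).1 _)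

theorem isGeodesic_proj_geod (hL : IsLeviCivita (Mp m n p) (quotMetric p) nabla)
    (hz : z.1ᵀ * z.1 = 1) (hη : η ∈ horizontalSpace z) (hJ : IsOpen J)
    (hS : ∀ t ∈ J, geod z η t ∈ SRp m n p) :
    IsGeodesic (Mp m n p) nabla (fun t => proj (geod z η t)) J := by
  have hc := (contDiff_geod z η).contDiffOn (s := J)
  have hh := deriv_geod_mem_horizontalSpace hz hη
  refine ⟨contDiff_proj.comp_contDiffOn hc, fun t ht => proj_mem (hS t ht), _,
    isCovDerivAlong_proj hL hJ hc hS fun t _ => hh t, fun t ht => ?_⟩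
  have hvel : ∀ᶠ s in 𝓝 t, lift (geod z η s) (deriv (fun r => proj (geod z η r)) s) =
      deriv (geod z η) s := by
    filter_upwards [hJ.mem_nhds ht] with s hs
    exact (isHorizontalLiftAt_proj hJ hc hS hs (hh s)).lift_deriv
  have hacc := (hasDerivAt_deriv_geod hz hη.1 t).congr_of_eventuallyEq hvel
  refine (congrArg (fun a => dproj (geod z η t) (tproj (geod z η t) a)) hacc.deriv).trans ?_
  rw [tproj_geodesicAccel (hS t ht).1, dproj_eq]
  simp

theorem hasExp_proj_of_staysFullRank (hL : IsLeviCivita (Mp m n p) (quotMetric p) nabla)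
    (hz : z.1ᵀ * z.1 = 1) (hη : η ∈ horizontalSpace z) (hr : StaysFullRank z η) :
    HasExp (Mp m n p) nabla (proj z) (dproj z η) (proj (expTotal z η)) := by
  obtain ⟨J, hJ, hJc, hJ01, hS⟩ := exists_interval_geod_mem hz hη.1 hr
  refine ⟨_, J, hJ, hJc, hJ01, isGeodesic_proj_geod hL hz hη hJ hS, congrArg proj (geod_zero z η),
    ?_, congrArg proj (geod_one z η)⟩
  have hderiv := hasDerivAt_proj (hasDerivAt_geod_zero z η)
  rw [geod_zero] at hderiv
  exact hderiv.deriv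

theorem hasDerivAt_momentum (hc : HasDerivAt c v t) (hZ : HasDerivAt Z w t) :
    HasDerivAt (fun s => momentum (c s) (Z s)) (momentum (c t) w + momentum v (Z t)) t :=
  ((hasDerivAt_matrix_mul (hasDerivAt_matrix_transpose (hasDerivAt_fst hZ))
    (hasDerivAt_fst hc)).add (hasDerivAt_matrix_mul (hasDerivAt_matrix_transpose
    (hasDerivAt_snd hZ)) (hasDerivAt_snd hc))).congr_deriv (add_add_add_comm _ _ _ _)

theorem momentum_self_transpose (η : Pair m n p) : (momentum η η)ᵀ = momentum η η := by
  simp [momentum_apply]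

theorem momentum_deriv_transpose (hc : HasDerivAt c (Z t) t) (hZ : HasDerivAt Z w t)
    (h : ∀ᶠ s in 𝓝 t, Z s ∈ horizontalSpace (c s)) :
    (momentum (c t) w)ᵀ = momentum (c t) w := by
  have hmom := hasDerivAt_momentum hc hZ
  have hsymm := (hasDerivAt_matrix_transpose hmom).unique
    (hmom.congr_of_eventuallyEq (h.mono fun _ hs => hs.2))
  rwa [Matrix.transpose_add, momentum_self_transpose, add_left_inj] at hsymm

theorem momentum_geodesicAccel (hz : z.1ᵀ * z.1 = 1) (η : Pair m n p) :
    momentum z (geodesicAccel z η) = -(η.1ᵀ * η.1) := by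
  simp [momentum_apply, geodesicAccel, Matrix.mul_assoc, hz]

theorem eq_geodesicAccel_of_dproj_tproj_eq_zero {a : Pair m n p} (hz : z ∈ SRp m n p)
    (htan : z.1ᵀ * a.1 + a.1ᵀ * z.1 + (η.1ᵀ * η.1 + η.1ᵀ * η.1) = 0)
    (hmom : (momentum z a)ᵀ = momentum z a) (h : dproj z (tproj z a) = 0) :
    a = geodesicAccel z η := by
  obtain ⟨Ω, hΩ, hvert⟩ := exists_act_of_dproj_eq_zero hz (tproj_mem hz.1 a) h
  rw [tproj_eq_sub_geodesicAccel htan] at hvert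
  have hsymm : (momentum z (act z Ω))ᵀ = momentum z (act z Ω) := by
    rw [← hvert, map_sub, Matrix.transpose_sub, hmom, momentum_geodesicAccel hz.1]
    simp
  rw [momentum_act hz.1, hΩ] at hsymm
  have hΩ0 : Ω = 0 := eq_zero_of_sylvesterOp_eq_zero (posDef_gram_add_one z.2) (by
    rw [sylvesterOp_apply, ← sub_neg_eq_add, ← Matrix.neg_mul, ← hsymm, sub_eq_zero]
    simp [hΩ])
  rw [hΩ0] at hvert
  exact sub_eq_zero.1 (hvert.trans (by simp [act]))

theorem IsHorizontalLiftAt.hasDerivAt_lift_deriv (h : IsHorizontalLiftAt γ c t)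
    (hL : IsLeviCivita (Mp m n p) (quotMetric p) nabla) (hJ : IsOpen J)
    (hγ : IsGeodesic (Mp m n p) nabla γ J) (ht : t ∈ J) :
    HasDerivAt (fun s => lift (c s) (deriv γ s))
      (geodesicAccel (c t) (lift (c t) (deriv γ t))) t := by
  have hvel := isFieldAlong_deriv hJ hγ.1 hγ.2.1
  have hmem := h.eventually_mem_tangent hJ ht hvel
  have hhor : ∀ᶠ s in 𝓝 t, lift (c s) (deriv γ s) ∈ horizontalSpace (c s) :=
    hmem.mono fun s hs => lift_mem hs.1 hs.2
  have hc : HasDerivAt c (lift (c t) (deriv γ t)) t := h.hasDerivAt.congr_deriv h.lift_deriv.symm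
  obtain ⟨a, ha⟩ : ∃ a, HasDerivAt (fun s => lift (c s) (deriv γ s)) a t :=
    ⟨_, h.hasDerivAt_lift hJ ht hvel⟩
  have hzero : dproj (c t) (tproj (c t) a) = 0 :=
    (congrArg (fun b => dproj (c t) (tproj (c t) b)) ha.deriv.symm).trans
      (hγ.covDerivAt_deriv isTangentProjection_frameField hJ ht (h.isCovDerivAt hL hJ ht))
  exact ha.congr_deriv (eq_geodesicAccel_of_dproj_tproj_eq_zero h.mem.self_of_nhds
    (deriv_tangency hc ha (hhor.mono fun _ hs => hs.1)) (momentum_deriv_transpose hc ha hhor) hzero)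

/-- The space in which `orthInvariants` takes its values. -/
abbrev Invariants (m n : ℕ) : Type :=
  Matrix (Fin m) (Fin n) ℝ × Matrix (Fin m) (Fin n) ℝ × Matrix (Fin m) (Fin n) ℝ ×
    Matrix (Fin m) (Fin n) ℝ × Matrix (Fin m) (Fin m) ℝ × Matrix (Fin m) (Fin m) ℝ

/-- Quadratic functions of a point `z` and a vector `η` that are invariant under the orthogonal
group and among whose time derivatives along a geodesic no further invariants occur. -/
def orthInvariants (z η : Pair m n p) : Invariants m n :=
  (z.1 * z.2ᵀ, η.1 * z.2ᵀ, z.1 * η.2ᵀ, η.1 * η.2ᵀ, z.1 * η.1ᵀ, η.1 * η.1ᵀ)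

/-- The vector field whose integral curves are the values of `orthInvariants` along the geodesics of
the total space. -/
def invariantSpray : Invariants m n → Invariants m n := fun (_, e, f, h, b, d) =>
  (e + f, h - b * e, h, -(b * h), d - b * bᵀ, -(b * d) - d * bᵀ)

theorem contDiff_invariantSpray : ContDiff ℝ 1 (invariantSpray (m := m) (n := n)) := by
  unfold invariantSpray
  fun_prop

theorem orthInvariants_act (z η : Pair m n p) {Q : Matrix (Fin p) (Fin p) ℝ} (hQ : Qᵀ * Q = 1) :
    orthInvariants (act z Q) (act η Q) = orthInvariants z η := by
  simp only [orthInvariants, act, mul_mul_transpose_mul_of_orthogonal hQ]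

theorem hasDerivAt_orthInvariants (hc : HasDerivAt c (Z t) t)
    (hZ : HasDerivAt Z (geodesicAccel (c t) (Z t)) t) :
    HasDerivAt (fun s => orthInvariants (c s) (Z s)) (invariantSpray (orthInvariants (c t) (Z t)))
      t := by
  have hc₁ := hasDerivAt_fst hc
  have hc₂ := hasDerivAt_matrix_transpose (hasDerivAt_snd hc)
  have hZ₁ := hasDerivAt_fst hZ
  have hZ₁' := hasDerivAt_matrix_transpose hZ₁
  have hZ₂ := hasDerivAt_matrix_transpose (hasDerivAt_snd hZ)
  refine ((hasDerivAt_matrix_mul hc₁ hc₂).congr_deriv ?_).prodMk <|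
    ((hasDerivAt_matrix_mul hZ₁ hc₂).congr_deriv ?_).prodMk <|
    ((hasDerivAt_matrix_mul hc₁ hZ₂).congr_deriv ?_).prodMk <|
    ((hasDerivAt_matrix_mul hZ₁ hZ₂).congr_deriv ?_).prodMk <|
    ((hasDerivAt_matrix_mul hc₁ hZ₁').congr_deriv ?_).prodMk <|
    (hasDerivAt_matrix_mul hZ₁ hZ₁').congr_deriv ?_
  all_goals
    simp only [geodesicAccel, Matrix.transpose_neg, Matrix.transpose_mul,
      Matrix.transpose_transpose, Matrix.neg_mul, Matrix.mul_neg, Matrix.mul_assoc,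
      Matrix.transpose_zero, Matrix.mul_zero]
  all_goals abel

/-- The invariants `orthInvariants` of the horizontal lift of the tangent vector `ξ` at `X`. -/
def liftInvariants (p : ℕ) (X ξ : Matrix (Fin m) (Fin n) ℝ) : Invariants m n :=
  orthInvariants (fiberPoint p X) (lift (fiberPoint p X) ξ)

theorem liftInvariants_proj (hz : z ∈ SRp m n p) (hξ : ξ ∈ tangent (Mp m n p) (proj z)) :
    liftInvariants p (proj z) ξ = orthInvariants z (lift z ξ) := by
  obtain ⟨Q, hQ, hact⟩ := exists_fiberPoint_proj_eq_act hz
  rw [liftInvariants, hact, lift_act hz hξ hQ, orthInvariants_act _ _ hQ]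

theorem hasDerivAt_liftInvariants (hL : IsLeviCivita (Mp m n p) (quotMetric p) nabla)
    (hJ : IsOpen J) (hγ : IsGeodesic (Mp m n p) nabla γ J) (ht : t ∈ J) :
    HasDerivAt (fun s => liftInvariants p (γ s) (deriv γ s))
      (invariantSpray (liftInvariants p (γ t) (deriv γ t))) t := by
  obtain ⟨c, hc⟩ := exists_isHorizontalLiftAt hJ hγ.1 hγ.2.1 ht
  have hinv : ∀ᶠ s in 𝓝 t, liftInvariants p (γ s) (deriv γ s) =
      orthInvariants (c s) (lift (c s) (deriv γ s)) := by
    filter_upwards [hc.proj_eq, hc.eventually_mem_tangent hJ ht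
      (isFieldAlong_deriv hJ hγ.1 hγ.2.1)] with s hproj hs
    exact (congrArg (liftInvariants p · (deriv γ s)) hproj.symm).trans
      (liftInvariants_proj hs.1 hs.2)
  have hlift := hasDerivAt_orthInvariants (Z := fun s => lift (c s) (deriv γ s))
    (hc.hasDerivAt.congr_deriv hc.lift_deriv.symm) (hc.hasDerivAt_lift_deriv hL hJ hγ ht)
  exact (hlift.congr_of_eventuallyEq hinv).congr_deriv
    (congrArg invariantSpray hinv.self_of_nhds.symm)

theorem eqOn_proj_geod_of_isGeodesic (hL : IsLeviCivita (Mp m n p) (quotMetric p) nabla)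
    (hz : z ∈ SRp m n p) (hη : η ∈ horizontalSpace z) (hJ : IsOpen J) (hJ01 : Set.Icc 0 1 ⊆ J)
    (hγ : IsGeodesic (Mp m n p) nabla γ J) (h0 : γ 0 = proj z) (hd0 : deriv γ 0 = dproj z η) :
    Set.EqOn γ (fun t => proj (geod z η t)) (Set.Icc 0 1) := by
  have hfst (t : ℝ) (ht : t ∈ J) : (liftInvariants p (γ t) (deriv γ t)).1 = γ t := by
    obtain ⟨w, hw, hwt⟩ := exists_proj_eq (hγ.2.1 t ht)
    obtain ⟨Q, hQ, hact⟩ := exists_fiberPoint_proj_eq_act hw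
    rw [← hwt]
    exact (congrArg proj hact).trans (proj_act w hQ)
  have heq := eqOn_of_hasDerivAt contDiff_invariantSpray
    (g := fun t => orthInvariants (geod z η t) (deriv (geod z η) t))
    (fun t ht => hasDerivAt_liftInvariants hL hJ hγ (hJ01 ht))
    (fun t _ => hasDerivAt_orthInvariants (hasDerivAt_geod z η t).differentiableAt.hasDerivAt
      (hasDerivAt_deriv_geod hz.1 hη.1 t))
    (by
      rw [h0, hd0, liftInvariants_proj hz (dproj_mem_tangent hz hη.1), lift_eq_of_mem hz hη rfl,
        geod_zero]
      exact congrArg (orthInvariants z) (hasDerivAt_geod_zero z η).deriv.symm)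
  exact fun t ht => (hfst t (hJ01 ht)).symm.trans (congrArg Prod.fst (heq ht))

theorem hasExp_Mp_iff (hL : IsLeviCivita (Mp m n p) (quotMetric p) nabla) (hz : z ∈ SRp m n p)
    (hξ : ξ ∈ tangent (Mp m n p) (proj z)) (Y : Matrix (Fin m) (Fin n) ℝ) :
    HasExp (Mp m n p) nabla (proj z) ξ Y ↔
      StaysFullRank z (lift z ξ) ∧ Y = proj (expTotal z (lift z ξ)) := by
  have hη := lift_mem hz hξ
  have hproj := dproj_lift hz hξ
  constructor
  · rintro ⟨γ, J, hJ, -, hJ01, hγ, h0, hd0, rfl⟩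
    have heq := eqOn_proj_geod_of_isGeodesic hL hz hη hJ hJ01 hγ h0 (hd0.trans hproj.symm)
    refine ⟨fun t ht => ?_, (heq (Set.right_mem_Icc.2 zero_le_one)).trans
      (congrArg proj (geod_one _ _))⟩
    exact (rank_mul_transpose_eq_iff (rank_eq_of_transpose_mul_self_eq_one
      (stiefelGeod_transpose_mul_self t hz.1 hη.1))).1
      ((congrArg Matrix.rank (heq ht)).symm.trans (hγ.2.1 t (hJ01 ht)))
  · rintro ⟨hr, rfl⟩
    have h := hasExp_proj_of_staysFullRank hL hz.1 hη hr
    rwa [hproj] at h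

end QuotientGeodesics

section Gradients

variable {E : Type*} [NormedAddCommGroup E] [NormedSpace ℝ E] {S : Set E} {g : E → E → E → ℝ}
  {P : E → E → E} {f : E → ℝ} {x v : E}

theorem rgrad_eq_of_forall (hg : IsRiemannianMetric S g) (hP : IsTangentProjection S P)
    (hx : x ∈ S) (hv : v ∈ tangent S x)
    (h : ∀ ξ ∈ tangent S x, g x v ξ = fderivWithin ℝ f S x ξ) : rgrad S g f x = v := by
  have hexists : ∃ w, w ∈ tangent S x ∧ ∀ ξ ∈ tangent S x, g x w ξ = fderivWithin ℝ f S x ξ :=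
    ⟨v, hv, h⟩
  obtain ⟨hmem, hgrad⟩ : rgrad S g f x ∈ tangent S x ∧
      ∀ ξ ∈ tangent S x, g x (rgrad S g f x) ξ = fderivWithin ℝ f S x ξ :=
    Classical.epsilon_spec hexists
  have hsub := hP.sub_mem hx hmem hv
  by_contra hne
  refine (hg.pos x hx _ hsub (sub_ne_zero.2 hne)).ne' ?_
  rw [hg.sub_left hP hx hmem hv hsub, hgrad _ hsub, h _ hsub, sub_self]

end Gradients

section Newton

variable {m n p : ℕ} {z η : Pair m n p} {ξ : Matrix (Fin m) (Fin n) ℝ}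
  {f : Matrix (Fin m) (Fin n) ℝ → ℝ}

theorem contDiffAt_comp_proj (hf : ContDiffOn ℝ ∞ f (Mp m n p)) (hz : z ∈ SRp m n p) :
    ContDiffAt ℝ ∞ (fun w : Pair m n p => f (proj w)) z := by
  have hopen : IsOpen {w : Pair m n p | w.1.rank = p ∧ w.2.rank = p} :=
    (isOpen_setOf_rank_eq.preimage continuous_fst).inter
      (isOpen_setOf_rank_eq.preimage continuous_snd)
  exact (hf.comp contDiff_proj.contDiffOn
    fun w hw => (rank_mul_transpose_eq_iff hw.1).2 hw.2).contDiffAt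
      (hopen.mem_nhds ⟨rank_eq_of_transpose_mul_self_eq_one hz.1, hz.2⟩)

theorem trace_of_linearMap_transpose_mul {k l : Type*} [Fintype k] [Fintype l] [DecidableEq k]
    [DecidableEq l] (L : Matrix k l ℝ →ₗ[ℝ] ℝ) (A : Matrix k l ℝ) :
    ((Matrix.of fun i j => L (Matrix.single i j 1))ᵀ * A).trace = L A := by
  conv_rhs => rw [Matrix.matrix_eq_sum_single A]
  simp only [map_sum, Matrix.trace, Matrix.diag_apply, Matrix.mul_apply, Matrix.transpose_apply,
    Matrix.of_apply]
  rw [Finset.sum_comm]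
  refine Finset.sum_congr rfl fun i _ => Finset.sum_congr rfl fun j _ => ?_
  rw [mul_comm, ← smul_eq_mul, ← map_smul, Matrix.smul_single, smul_eq_mul, mul_one]

theorem gBar_euclGrad (F : Pair m n p → ℝ) (z η : Pair m n p) :
    gBar z (euclGrad F z) η = fderiv ℝ F z η := by
  have hfst := trace_of_linearMap_transpose_mul
    ((fderiv ℝ F z).toLinearMap ∘ₗ LinearMap.inl ℝ _ _) η.1
  have hsnd := trace_of_linearMap_transpose_mul
    ((fderiv ℝ F z).toLinearMap ∘ₗ LinearMap.inr ℝ _ _) η.2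
  rw [gBar, Matrix.trace_add]
  refine (congrArg₂ (· + ·) hfst hsnd).trans ?_
  rw [LinearMap.comp_apply, LinearMap.comp_apply, ← map_add]
  simp

theorem gBar_tproj_euclGrad (hf : ContDiffOn ℝ ∞ f (Mp m n p)) (hz : z ∈ SRp m n p)
    (hη : η ∈ tangentSpace z) :
    gBar z (tproj z (euclGrad (fun w => f (proj w)) z)) η =
      fderivWithin ℝ (fun w => f (proj w)) (SRp m n p) z η := by
  have hdiff := ((contDiffAt_comp_proj hf hz).differentiableAt (by simp)).hasFDerivAt
  rw [gBar_tproj _ hη, gBar_euclGrad]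
  refine (fderivWithin_eq_of_curve hdiff.differentiableAt.differentiableWithinAt
    ((mem_tangent_SRp_iff hz).2 hη) fun c hc hd _ => ?_).symm
  exact hdiff.comp_hasDerivAt_of_eq (0 : ℝ) hd hc.symm

theorem gradBar_eq (hf : ContDiffOn ℝ ∞ f (Mp m n p)) (hz : z ∈ SRp m n p) :
    gradBar f z = tproj z (euclGrad (fun w => f (proj w)) z) :=
  rgrad_eq_of_forall isRiemannianMetric_gBar isTangentProjection_tproj hz
    ((mem_tangent_SRp_iff hz).2 (tproj_mem hz.1 _))
    fun _ hξ => gBar_tproj_euclGrad hf hz ((mem_tangent_SRp_iff hz).1 hξ)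

theorem gBar_gradBar (hf : ContDiffOn ℝ ∞ f (Mp m n p)) (hz : z ∈ SRp m n p)
    (hη : η ∈ tangentSpace z) :
    gBar z (gradBar f z) η = fderivWithin ℝ f (Mp m n p) (proj z) (dproj z η) := by
  rw [gradBar_eq hf hz, gBar_tproj_euclGrad hf hz hη]
  exact fderivWithin_comp_proj hf hz hη

theorem gradBar_mem (hf : ContDiffOn ℝ ∞ f (Mp m n p)) (hz : z ∈ SRp m n p) :
    gradBar f z ∈ horizontalSpace z := by
  refine (mem_horizontal_iff hz).1 ⟨(mem_tangent_SRp_iff hz).2 ?_, fun v hv => ?_⟩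
  · rw [gradBar_eq hf hz]
    exact tproj_mem hz.1 _
  · rw [gBar_gradBar hf hz (vertical_subset_tangentSpace hv), dproj_vertical hz hv]
    exact map_zero _

theorem contDiffOn_gradBar (hf : ContDiffOn ℝ ∞ f (Mp m n p)) :
    ContDiffOn ℝ ∞ (gradBar f) (SRp m n p) := by
  have heucl : ContDiffOn ℝ ∞ (euclGrad fun w : Pair m n p => f (proj w)) (SRp m n p) := by
    intro z hz
    have hpartial (v : Pair m n p) : ContDiffWithinAt ℝ ∞
        (fun w => fderiv ℝ (fun w : Pair m n p => f (proj w)) w v) (SRp m n p) z :=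
      (((contDiffAt_comp_proj hf hz).fderiv_right (m := ∞) (by simp)).clm_apply
        contDiffAt_const).contDiffWithinAt
    exact (contDiffWithinAt_matrix_iff.2 fun _ _ => hpartial _).prodMk
      (contDiffWithinAt_matrix_iff.2 fun _ _ => hpartial _)
  exact (contDiffOn_tproj contDiffOn_id heucl).congr fun z hz => gradBar_eq hf hz

theorem rgrad_proj (hf : ContDiffOn ℝ ∞ f (Mp m n p)) (hz : z ∈ SRp m n p) :
    rgrad (Mp m n p) (quotMetric p) f (proj z) = dproj z (gradBar f z) := by
  have hgrad := (gradBar_mem hf hz).1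
  refine rgrad_eq_of_forall isRiemannianMetric_quotMetric isTangentProjection_frameField
    (proj_mem hz) (dproj_mem_tangent hz hgrad) fun ξ hξ => ?_
  rw [quotMetric_dproj_left hz hgrad hξ, gBar_gradBar hf hz (lift_mem hz hξ).1]
  exact congrArg _ (dproj_lift hz hξ)

theorem isField_rgrad (hf : ContDiffOn ℝ ∞ f (Mp m n p)) :
    IsField (Mp m n p) (rgrad (Mp m n p) (quotMetric p) f) := by
  refine ⟨contDiffOn_Mp_of_comp_proj ((contDiffOn_dproj contDiffOn_id (contDiffOn_gradBar hf)).congr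
    fun z hz => rgrad_proj hf hz), fun X hX => ?_⟩
  obtain ⟨z, hz, rfl⟩ := exists_proj_eq hX
  rw [rgrad_proj hf hz]
  exact dproj_mem_tangent hz (gradBar_mem hf hz).1

theorem liftField_rgrad (hf : ContDiffOn ℝ ∞ f (Mp m n p)) :
    Set.EqOn (liftField p (rgrad (Mp m n p) (quotMetric p) f)) (gradBar f) (SRp m n p) :=
  fun _ hz => lift_eq_of_mem hz (gradBar_mem hf hz) (rgrad_proj hf hz).symm

theorem dproj_eq_iff_hproj_eq (hz : z ∈ SRp m n p) (hη : η ∈ tangentSpace z) {ζ : Pair m n p}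
    (hζ : ζ ∈ horizontalSpace z) : dproj z η = dproj z ζ ↔ hproj z η = ζ := by
  rw [← lift_dproj hz hη]
  exact ⟨fun h => lift_eq_of_mem hz hζ h.symm, fun h => by
    rw [← h, dproj_lift hz (dproj_mem_tangent hz hη)]⟩

variable {nabla : Matrix (Fin m) (Fin n) ℝ → Matrix (Fin m) (Fin n) ℝ →
    (Matrix (Fin m) (Fin n) ℝ → Matrix (Fin m) (Fin n) ℝ) → Matrix (Fin m) (Fin n) ℝ}

theorem isNewtonVector_iff (hL : IsLeviCivita (Mp m n p) (quotMetric p) nabla)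
    (hf : ContDiffOn ℝ ∞ f (Mp m n p)) (hz : z ∈ SRp m n p)
    (hξ : ξ ∈ tangent (Mp m n p) (proj z)) :
    IsNewtonVector (Mp m n p) (quotMetric p) nabla f (proj z) ξ ↔
      IsLiftedNewtonVector f z (lift z ξ) := by
  have hneg : -dproj z (gradBar f z) = dproj z (-gradBar f z) := (map_neg _ _).symm
  rw [IsNewtonVector, and_iff_right hξ, IsLiftedNewtonVector,
    and_iff_right ((mem_horizontal_iff hz).2 (lift_mem hz hξ)), hL.nabla_proj hz hξ
    (isField_rgrad hf), nablaBar_congr (liftField_rgrad hf) hz, rgrad_proj hf hz, hneg]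
  exact dproj_eq_iff_hproj_eq hz (nablaBar_mem hz _ _) (neg_mem (gradBar_mem hf hz))

theorem isNewtonStep_iff (hL : IsLeviCivita (Mp m n p) (quotMetric p) nabla)
    (hf : ContDiffOn ℝ ∞ f (Mp m n p)) (hz : z ∈ SRp m n p) (Y : Matrix (Fin m) (Fin n) ℝ) :
    IsNewtonStep (Mp m n p) (quotMetric p) nabla f (proj z) Y ↔
      ∃ η : Pair m n p, IsLiftedNewtonVector f z η ∧ StaysFullRank z η ∧
        Y = proj (expTotal z η) := by
  constructor
  · rintro ⟨ξ, h, hY⟩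
    exact ⟨lift z ξ, (isNewtonVector_iff hL hf hz h.1).1 h, (hasExp_Mp_iff hL hz h.1 Y).1 hY⟩
  · rintro ⟨η, h, hexp⟩
    have hη := (mem_horizontal_iff hz).1 h.1
    have hξ := dproj_mem_tangent hz hη.1
    rw [← lift_eq_of_mem hz hη rfl] at h hexp
    exact ⟨dproj z η, (isNewtonVector_iff hL hf hz hξ).2 h, (hasExp_Mp_iff hL hz hξ Y).2 hexp⟩

end Newton

section Submersion

variable {m n p : ℕ} {z η : Pair m n p}

theorem image_proj : proj '' SRp m n p = Mp m n p :=
  Set.Subset.antisymm (Set.image_subset_iff.2 fun _ hz => proj_mem hz) fun _ hX => exists_proj_eq hX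

theorem bijOn_dproj (hz : z ∈ SRp m n p) :
    Set.BijOn (dproj z) (horizontal z) (tangent (Mp m n p) (proj z)) := by
  refine ⟨fun η hη => ?_, fun η hη ζ hζ h => ?_, fun ξ hξ => ?_⟩
  · exact dproj_mem_tangent hz ((mem_horizontal_iff hz).1 hη).1
  · exact horizontal_ext hz ((mem_horizontal_iff hz).1 hη) ((mem_horizontal_iff hz).1 hζ) h
  · exact ⟨lift z ξ, (mem_horizontal_iff hz).2 (lift_mem hz hξ), dproj_lift hz hξ⟩

theorem eq_omegaOf_iff {Ω : Matrix (Fin p) (Fin p) ℝ} :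
    Ω = omegaOf z η ↔ (z.2ᵀ * z.2 + 1) * Ω + Ω * (z.2ᵀ * z.2 + 1) =
      η.1ᵀ * z.1 - z.1ᵀ * η.1 + η.2ᵀ * z.2 - z.2ᵀ * η.2 := by
  have hmomentum : momentum z η - (momentum z η)ᵀ =
      η.1ᵀ * z.1 - z.1ᵀ * η.1 + η.2ᵀ * z.2 - z.2ᵀ * η.2 := by
    simp only [momentum_apply, Matrix.transpose_add, Matrix.transpose_mul,
      Matrix.transpose_transpose]
    abel
  rw [eq_comm, omegaOf, sylvester_eq_iff (posDef_gram_add_one z.2), hmomentum]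

theorem existsUnique_sylvester (z η : Pair m n p) :
    ∃! Ω : Matrix (Fin p) (Fin p) ℝ, Ωᵀ = -Ω ∧
      (z.2ᵀ * z.2 + 1) * Ω + Ω * (z.2ᵀ * z.2 + 1) =
        η.1ᵀ * z.1 - z.1ᵀ * η.1 + η.2ᵀ * z.2 - z.2ᵀ * η.2 :=
  ⟨omegaOf z η, ⟨omegaOf_skew z η, eq_omegaOf_iff.1 rfl⟩, fun _ h => eq_omegaOf_iff.2 h.2⟩

theorem hproj_eq_of_sylvester (hz : z ∈ SRp m n p) (hη : η ∈ tangentSpace z)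
    {Ω : Matrix (Fin p) (Fin p) ℝ} (h : (z.2ᵀ * z.2 + 1) * Ω + Ω * (z.2ᵀ * z.2 + 1) =
      η.1ᵀ * z.1 - z.1ᵀ * η.1 + η.2ᵀ * z.2 - z.2ᵀ * η.2) :
    hproj z η = (η.1 + z.1 * Ω, η.2 + z.2 * Ω) := by
  rw [hproj_eq hz hη, eq_omegaOf_iff.2 h]
  rfl

end Submersion

end FixedRank

end

theorem mainTheorem1 (m n p : ℕ) (hp : 0 < p) (hpm : p ≤ m) (hpn : p ≤ n) :
    -- the quotient metric is a Riemannian metric on `M_p` and `π` is a Riemannian submersion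
    IsRiemannianMetric (SRp m n p) gBar ∧
    IsRiemannianMetric (Mp m n p) (quotMetric p) ∧
    proj '' SRp m n p = Mp m n p ∧
    (∀ z ∈ SRp m n p,
      Set.BijOn (dproj z) (horizontal z) (tangent (Mp m n p) (proj z)) ∧
      (∀ ξ ∈ tangent (Mp m n p) (proj z), lift z ξ ∈ horizontal z ∧ dproj z (lift z ξ) = ξ) ∧
      ∀ ξ ∈ tangent (Mp m n p) (proj z), ∀ ζ ∈ tangent (Mp m n p) (proj z),
        quotMetric p (proj z) ξ ζ = gBar z (lift z ξ) (lift z ζ)) ∧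
    -- the horizontal projection
    (∀ z ∈ SRp m n p, ∀ η ∈ tangent (SRp m n p) z,
      (hproj z η ∈ horizontal z ∧ η - hproj z η ∈ vertical z) ∧
      (∃! Ω : Matrix (Fin p) (Fin p) ℝ, Ωᵀ = -Ω ∧
        (z.2ᵀ * z.2 + 1) * Ω + Ω * (z.2ᵀ * z.2 + 1) =
          η.1ᵀ * z.1 - z.1ᵀ * η.1 + η.2ᵀ * z.2 - z.2ᵀ * η.2) ∧
      ∀ Ω : Matrix (Fin p) (Fin p) ℝ, Ωᵀ = -Ω →
        (z.2ᵀ * z.2 + 1) * Ω + Ω * (z.2ᵀ * z.2 + 1) =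
          η.1ᵀ * z.1 - z.1ᵀ * η.1 + η.2ᵀ * z.2 - z.2ᵀ * η.2 →
        hproj z η = (η.1 + z.1 * Ω, η.2 + z.2 * Ω)) ∧
    -- the Riemannian connection and the Riemannian exponential of the total space
    IsLeviCivita (SRp m n p) gBar nablaBar ∧
    (∀ z ∈ SRp m n p, ∀ η ∈ tangent (SRp m n p) z, ∀ w : Pair m n p,
      HasExp (SRp m n p) nablaBar z η w ↔ StaysFullRank z η ∧ w = expTotal z η) ∧
    -- the Riemannian connection of `M_p`
    (∃ nabla, IsLeviCivita (Mp m n p) (quotMetric p) nabla) ∧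
    ∀ nabla, IsLeviCivita (Mp m n p) (quotMetric p) nabla →
      -- the Riemannian exponential of `M_p`
      (∀ z ∈ SRp m n p, ∀ ξ ∈ tangent (Mp m n p) (proj z), ∀ Y : Matrix (Fin m) (Fin n) ℝ,
        HasExp (Mp m n p) nabla (proj z) ξ Y ↔
          StaysFullRank z (lift z ξ) ∧ Y = proj (expTotal z (lift z ξ))) ∧
      -- the Riemannian Newton method
      ∀ f : Matrix (Fin m) (Fin n) ℝ → ℝ, ContDiffOn ℝ ∞ f (Mp m n p) →
        ∀ z ∈ SRp m n p,
          gradBar f z = tproj z (euclGrad (fun w => f (proj w)) z) ∧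
          (∀ ξ ∈ tangent (Mp m n p) (proj z),
            IsNewtonVector (Mp m n p) (quotMetric p) nabla f (proj z) ξ ↔
              IsLiftedNewtonVector f z (lift z ξ)) ∧
          ∀ Y : Matrix (Fin m) (Fin n) ℝ,
            IsNewtonStep (Mp m n p) (quotMetric p) nabla f (proj z) Y ↔
              ∃ η : Pair m n p, IsLiftedNewtonVector f z η ∧ StaysFullRank z η ∧
                Y = proj (expTotal z η) := by
  refine ⟨isRiemannianMetric_gBar, isRiemannianMetric_quotMetric, image_proj,
    fun z hz => ⟨bijOn_dproj hz,
      fun ξ hξ => ⟨(mem_horizontal_iff hz).2 (lift_mem hz hξ), dproj_lift hz hξ⟩,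
      fun ξ hξ ζ hζ => quotMetric_proj hz hξ hζ⟩,
    fun z hz η hη => ?_, isLeviCivita_nablaBar, fun z hz η hη w => hasExp_SRp_iff hz hη w,
    ⟨nablaQuot p, isLeviCivita_nablaQuot⟩,
    fun nabla hL => ⟨fun z hz ξ hξ Y => hasExp_Mp_iff hL hz hξ Y, fun f hf z hz =>
      ⟨gradBar_eq hf hz, fun ξ hξ => isNewtonVector_iff hL hf hz hξ,
        fun Y => isNewtonStep_iff hL hf hz Y⟩⟩⟩
  rw [mem_tangent_SRp_iff hz] at hη
  exact ⟨⟨(mem_horizontal_iff hz).2 (hproj_mem hz hη), sub_hproj_mem hz hη⟩,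
    existsUnique_sylvester z η, fun Ω _ h => hproj_eq_of_sylvester hz hη h⟩
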